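/- Let $0<\mu<1$, let $\Omega\subset\mathbb{R}^2$ be a bounded domain of class $\mathcal{C}^{1,\mu}$, and let $D$ be a domain of class $\mathcal{C}^{1,\mu}$ with $\overline{D}\subset\Omega$. Put $\Gamma_i=\partial D$ and $\Gamma_e=\partial\Omega$, with outward unit normals $\nu_i,\nu_e$ and arc length $d\sigma$, and let $G(x)=\frac{1}{2\pi}\ln|x|$. For $\Gamma\in\{\Gamma_i,\Gamma_e\}$, with outward normal $\nu$, and $\varphi\in L^2(\Gamma)$ (complex valued) let $$\mathcal{S}_\Gamma[\varphi](x)=\int_\Gamma G(x-y)\varphi(y)\,d\sigma(y)\quad(x\in\mathbb{R}^2),\qquad \mathcal{D}_\Gamma[\varphi](x)=\int_\Gamma \frac{\partial G(x-y)}{\partial\nu(y)}\varphi(y)\,d\sigma(y)\quad(x\in\mathbb{R}^2\setminus\Gamma),$$ $$\mathcal{K}_\Gamma[\varphi](x)=\frac1{2\pi}\int_\Gamma\frac{\langle y-x,\nu(y)\rangle}{|x-y|^2}\varphi(y)\,d\sigma(y),\qquad \mathcal{K}_\Gamma^*[\varphi](x)=\frac1{2\pi}\int_\Gamma\frac{\langle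 x-y,\nu(x)\rangle}{|x-y|^2}\varphi(y)\,d\sigma(y)\quad(x\in\Gamma).$$ These integrals converge absolutely (for almost every $x\in\Gamma$ in the case of $\mathcal{K}_\Gamma$ and $\mathcal{K}_\Gamma^*$), $\mathcal{S}_\Gamma[\varphi]$ is differentiable off $\Gamma$, and $$\mathbb{S}=\begin{bmatrix}\mathcal{S}_{\Gamma_i}&\mathcal{S}_{\Gamma_e}\\ \mathcal{S}_{\Gamma_i}&\mathcal{S}_{\Gamma_e}\end{bmatrix},\qquad \mathbb{K}^*=\begin{bmatrix}-\mathcal{K}_{\Gamma_i}^*&-\frac{\partial}{\partial\nu_i}\mathcal{S}_{\Gamma_e}\\ \frac{\partial}{\partial\nu_e}\mathcal{S}_{\Gamma_i}&\mathcal{K}_{\Gamma_e}^*\end{bmatrix},\qquad \mathbb{K}=\begin{bmatrix}-\mathcal{K}_{\Gamma_i}&\mathcal{D}_{\Gamma_e}\\ -\mathcal{D}_{\Gamma_i}&\mathcal{K}_{\Gamma_e}\end{bmatrix}$$ are bounded operators on the Hilbert space $\mathcal{H}=L^2(\Gamma_i)\times L^2(\Gamma_e)$ (the first row of each giving a function on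 $\Gamma_i$, the second a function on $\Gamma_e$). The operator $\mathbb{K}$ is the adjoint of $\mathbb{K}^*$, and $$\mathbb{S}\mathbb{K}^*=\mathbb{K}\mathbb{S}\quad\text{on }\mathcal{H};$$ moreover $\mathbb{S}\mathbb{K}^*$ is self-adjoint. -/

import Mathlib

open MeasureTheory
open scoped NNReal

/-- The Euclidean plane. -/
abbrev Plane : Type := EuclideanSpace ℝ (Fin 2)

/-- `Ω ⊆ ℝ²` is a domain of class `C^{1,μ}`: it is nonempty, open and connected and, near each of
its boundary points and in suitable Cartesian coordinates, it is the region below the graph of a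
`C¹` function whose derivative is `μ`-Hölder continuous. -/
structure IsC1HolderDomain (μ : ℝ≥0) (Ω : Set Plane) : Prop where
  isOpen : IsOpen Ω
  isConnected : IsConnected Ω
  graph : ∀ p ∈ frontier Ω, ∃ (R : Plane ≃ₗᵢ[ℝ] Plane) (f : ℝ → ℝ) (r : ℝ) (C : ℝ≥0),
    0 < r ∧ ContDiff ℝ 1 f ∧ HolderWith C μ (deriv f) ∧
    Ω ∩ Metric.ball p r = {x | (R x) 1 < f ((R x) 0)} ∩ Metric.ball p r

/-- `n` is the outward unit normal to `∂Ω` at `x`: it is a unit vector, every direction making an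
obtuse angle with `n` enters `Ω` at `x`, and every direction making an acute angle with `n` leaves
the closure of `Ω` at `x`. At most one vector `n` has this property. -/
def IsOutwardUnitNormal (Ω : Set Plane) (x n : Plane) : Prop :=
  ‖n‖ = 1 ∧
  (∀ v : Plane, inner ℝ v n < 0 → ∃ ε > 0, ∀ t : ℝ, 0 < t → t < ε → x + t • v ∈ Ω) ∧
  (∀ v : Plane, 0 < inner ℝ v n → ∃ ε > 0, ∀ t : ℝ, 0 < t → t < ε → x + t • v ∉ closure Ω)

open Classical in
/-- The outward unit normal `ν(x)` to `∂Ω` at `x` (and `0` at points where there is none, of which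
a `C¹` boundary has none). -/
noncomputable def outwardNormal (Ω : Set Plane) (x : Plane) : Plane :=
  if h : ∃ n, IsOutwardUnitNormal Ω x n then h.choose else 0

/-- The arc length measure `dσ` on `∂Ω`. -/
noncomputable def arcLength (Ω : Set Plane) : Measure Plane :=
  (Measure.hausdorffMeasure 1 : Measure Plane).restrict (frontier Ω)

/-- The complex Hilbert space `L²(∂Ω)`. -/
abbrev L2Boundary (Ω : Set Plane) : Type := Lp ℂ 2 (arcLength Ω)

/-- The fundamental solution `G(x) = (1/2π) ln |x|` of the Laplacian in the plane. -/
noncomputable def fundSol (x : Plane) : ℝ := 1 / (2 * Real.pi) * Real.log ‖x‖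

/-- The kernel `∂G(x - y)/∂ν(y)` of the double layer potential. -/
noncomputable def doubleLayerKernel (Ω : Set Plane) (x y : Plane) : ℝ :=
  fderiv ℝ (fun z => fundSol (x - z)) y (outwardNormal Ω y)

/-- The kernel `(1/2π) ⟨y - x, ν(y)⟩ / |x - y|²` of the operator `K` on `L²(∂Ω)`. -/
noncomputable def npKernel (Ω : Set Plane) (x y : Plane) : ℝ :=
  1 / (2 * Real.pi) * (inner ℝ (y - x) (outwardNormal Ω y) / ‖x - y‖ ^ 2)

/-- The single layer potential `S[φ](x) = ∫ G(x - y) φ(y) dσ(y)` on `ℝ²`. -/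
noncomputable def singleLayer (Ω : Set Plane) (φ : Plane → ℂ) (x : Plane) : ℂ :=
  ∫ y, fundSol (x - y) • φ y ∂(arcLength Ω)

/-- The double layer potential `D[φ](x) = ∫ (∂G(x - y)/∂ν(y)) φ(y) dσ(y)` off `∂Ω`. -/
noncomputable def doubleLayer (Ω : Set Plane) (φ : Plane → ℂ) (x : Plane) : ℂ :=
  ∫ y, doubleLayerKernel Ω x y • φ y ∂(arcLength Ω)

/-- `K[φ](x) = (1/2π) ∫ ⟨y - x, ν(y)⟩ / |x - y|² φ(y) dσ(y)` on `∂Ω`. -/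
noncomputable def npOp (Ω : Set Plane) (φ : Plane → ℂ) (x : Plane) : ℂ :=
  ∫ y, npKernel Ω x y • φ y ∂(arcLength Ω)

/-- `K*[φ](x) = (1/2π) ∫ ⟨x - y, ν(x)⟩ / |x - y|² φ(y) dσ(y)` on `∂Ω`. -/
noncomputable def npAdjOp (Ω : Set Plane) (φ : Plane → ℂ) (x : Plane) : ℂ :=
  ∫ y, npKernel Ω y x • φ y ∂(arcLength Ω)

/-- The derivative `∂u/∂ν (x)` in the direction of the outward normal to `∂Ω` at `x`, for a
function `u` that is differentiable at `x`. -/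
noncomputable def normalDeriv (Ω : Set Plane) (u : Plane → ℂ) (x : Plane) : ℂ :=
  fderiv ℝ u x (outwardNormal Ω x)

/-- For every density in `L²(∂Ω)` the integrals above converge, and the single layer potential is
differentiable off `∂Ω`. -/
structure LayerPotentialsConverge (Ω : Set Plane) : Prop where
  single : ∀ (φ : L2Boundary Ω) (x : Plane),
    Integrable (fun y => fundSol (x - y) • φ y) (arcLength Ω)
  double : ∀ (φ : L2Boundary Ω), ∀ x ∉ frontier Ω,
    Integrable (fun y => doubleLayerKernel Ω x y • φ y) (arcLength Ω)
  np : ∀ φ : L2Boundary Ω, ∀ᵐ x ∂(arcLength Ω),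
    Integrable (fun y => npKernel Ω x y • φ y) (arcLength Ω)
  npAdj : ∀ φ : L2Boundary Ω, ∀ᵐ x ∂(arcLength Ω),
    Integrable (fun y => npKernel Ω y x • φ y) (arcLength Ω)
  differentiable : ∀ (φ : L2Boundary Ω), ∀ x ∉ frontier Ω,
    DifferentiableAt ℝ (singleLayer Ω φ) x

/-- The Hilbert space `H = L²(Γ_i) × L²(Γ_e)`, where `Γ_i = ∂D` and `Γ_e = ∂Ω`, with the inner
product `⟨φ_i, ψ_i⟩ + ⟨φ_e, ψ_e⟩`. -/
abbrev BlockL2 (D Ω : Set Plane) : Type := WithLp 2 (L2Boundary D × L2Boundary Ω)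

/-- The bounded operator `T` on `H` is the block operator `[[S_i, S_e], [S_i, S_e]]`. -/
def IsBlockS (D Ω : Set Plane) (T : BlockL2 D Ω →L[ℂ] BlockL2 D Ω) : Prop :=
  ∀ Φ : BlockL2 D Ω,
    (∀ᵐ x ∂(arcLength D), (T Φ).fst x = singleLayer D Φ.fst x + singleLayer Ω Φ.snd x) ∧
    (∀ᵐ x ∂(arcLength Ω), (T Φ).snd x = singleLayer D Φ.fst x + singleLayer Ω Φ.snd x)

/-- The bounded operator `T` on `H` is the block operator
`[[-K_i*, -∂S_e/∂ν_i], [∂S_i/∂ν_e, K_e*]]`. -/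
def IsBlockKStar (D Ω : Set Plane) (T : BlockL2 D Ω →L[ℂ] BlockL2 D Ω) : Prop :=
  ∀ Φ : BlockL2 D Ω,
    (∀ᵐ x ∂(arcLength D),
      (T Φ).fst x = -npAdjOp D Φ.fst x - normalDeriv D (singleLayer Ω Φ.snd) x) ∧
    (∀ᵐ x ∂(arcLength Ω),
      (T Φ).snd x = normalDeriv Ω (singleLayer D Φ.fst) x + npAdjOp Ω Φ.snd x)

/-- The bounded operator `T` on `H` is the block operator `[[-K_i, D_e], [-D_i, K_e]]`. -/
def IsBlockK (D Ω : Set Plane) (T : BlockL2 D Ω →L[ℂ] BlockL2 D Ω) : Prop :=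
  ∀ Φ : BlockL2 D Ω,
    (∀ᵐ x ∂(arcLength D), (T Φ).fst x = -npOp D Φ.fst x + doubleLayer Ω Φ.snd x) ∧
    (∀ᵐ x ∂(arcLength Ω), (T Φ).snd x = -doubleLayer D Φ.fst x + npOp Ω Φ.snd x)

/-! Every entry of the three block operators is an integral operator with a real, weakly singular
kernel. The logarithm is dominated by any negative power of the distance, and on a boundary of class
`C^{1,μ}` the normal component of a chord is `O(|z - y| ^ (1 + μ))`, so the normal derivative of `G`
is `O(|z - y| ^ (μ - 1))`. The Schur test (`SchurKernel`) then gives bounded operators whose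
adjoints have the transposed kernels. The kernels of `K` are the transposes of those of `K*`, and
`G` is even; hence `K` is the adjoint of `K*`, and `S` is self-adjoint.

By Fubini, `S K* = K S` reduces to an identity between kernels. For distinct boundary points `x`,
`y` it says that the integral of `G(z - x) ∂G(z - y)/∂ν(z) - G(z - y) ∂G(z - x)/∂ν(z)` over the
boundary of the shell between `D` and `Ω` vanishes, with `ν = ν_e` on `Γ_e` and `ν = -ν_i` on `Γ_i`;
these are the signs in the block operators. This is Green's second identity with both poles on the
boundary. Since the shell has a tangent half plane at each pole, each Laplacian contributes half a
Dirac mass, and the two contributions are both proportional to `G(x - y)` and cancel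
(`integral_fundSol_mul_npKernel_symm`).

To make this rigorous, `G` is replaced by the smooth `(1/4π) log(|x|² + ε²)`. Green's identity then
follows from the divergence theorem on `Ω` and on `D`. As `ε → 0` the volume terms converge by
rescaling at the pole (`tendsto_setIntegral_regFundSol_mul_regDelta`) and the boundary terms by
dominated convergence (`IsC1HolderDomain.tendsto_integral_reg_mul`). The divergence theorem is
proved in graph charts and glued by a partition of unity. As arc length is a Hausdorff measure, this
requires the length formula for `C¹` curves.

Self-adjointness is then formal: `(S K*)* = K S = S K*`. -/

/-! ### Hausdorff measure of `C¹` curves -/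

open Set Filter Topology in
/-- Near a point, a strictly differentiable curve dilates distances by about its speed. -/
theorem HasStrictDerivAt.eventually_abs_norm_sub_le {E : Type*} [NormedAddCommGroup E]
    [NormedSpace ℝ E] {γ : ℝ → E} {γ' : E} {s : ℝ} (h : HasStrictDerivAt γ γ' s) {ε : ℝ}
    (hε : 0 < ε) :
    ∃ δ > 0, ∀ x ∈ Icc s (s + δ), ∀ y ∈ Icc s (s + δ),
      |(‖γ x - γ y‖ - ‖γ'‖ * |x - y|)| ≤ ε * |x - y| := by
  have h1 := (hasStrictDerivAt_iff_hasStrictFDerivAt.1 h).isLittleO.def hε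
  rw [nhds_prod_eq, eventually_prod_self_iff'] at h1
  obtain ⟨t, ht, h2⟩ := h1
  obtain ⟨δ, hδ, h3⟩ := Metric.nhds_basis_closedBall.mem_iff.1 ht
  refine ⟨δ, hδ, fun x hx y hy => ?_⟩
  have hmem : ∀ z ∈ Icc s (s + δ), z ∈ t := fun z hz => h3 (by
    rw [Metric.mem_closedBall, Real.dist_eq, abs_le]
    constructor <;> linarith [hz.1, hz.2])
  have h4 := h2 x (hmem x hx) y (hmem y hy)
  simp only [ContinuousLinearMap.toSpanSingleton_apply, Real.norm_eq_abs] at h4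
  refine le_trans ?_ h4
  have := abs_norm_sub_norm_le (γ x - γ y) ((x - y) • γ')
  rwa [norm_smul, Real.norm_eq_abs, mul_comm] at this

open Set Filter Topology in
/-- The length of an injective `C¹` curve: its Hausdorff measure is the integral of its speed. -/
theorem hausdorffMeasure_image_Ioc_eq_integral {E : Type*} [NormedAddCommGroup E]
    [NormedSpace ℝ E] [MeasurableSpace E] [BorelSpace E] {γ : ℝ → E} (hγ : ContDiff ℝ 1 γ)
    (hm : MeasurableEmbedding γ) (h0 : ∀ s, deriv γ s ≠ 0) {a b : ℝ} (hab : a ≤ b) :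
    (Measure.hausdorffMeasure 1 : Measure E) (γ '' Ioc a b) =
      ENNReal.ofReal (∫ s in a..b, ‖deriv γ s‖) := by
  classical
  set ν : Measure ℝ := (Measure.hausdorffMeasure 1 : Measure E).comap γ with hν
  have hνE : ∀ S, ν S = (Measure.hausdorffMeasure 1 : Measure E) (γ '' S) := fun S => hm.comap_apply _ S
  have hcont : Continuous (deriv γ) := hγ.continuous_deriv le_rfl
  have hup : ∀ {S : Set ℝ} {K : ℝ≥0}, LipschitzOnWith K γ S → ν S ≤ K * volume S := by
    intro S K hK
    have := hK.hausdorffMeasure_image_le (d := 1) zero_le_one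
    rwa [← hνE, hausdorffMeasure_real, ENNReal.rpow_one] at this
  obtain ⟨K, hK⟩ : ∃ K : ℝ≥0, LipschitzOnWith K γ (Icc a b) := by
    obtain ⟨K, hK⟩ := (isCompact_Icc (a := a) (b := b)).exists_bound_of_continuousOn
      hcont.continuousOn
    refine ⟨K.toNNReal, Convex.lipschitzOnWith_of_nnnorm_deriv_le
      (fun x _ => (hγ.differentiable one_ne_zero) x) (fun x hx => ?_) (convex_Icc a b)⟩
    rw [← NNReal.coe_le_coe, coe_nnnorm]
    exact (hK x hx).trans (Real.le_coe_toNNReal K)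
  have hupI : ∀ x y, a ≤ x → x ≤ y → y ≤ b → ν (Ioc x y) ≤ ENNReal.ofReal (K * (y - x)) := by
    intro x y hx hxy hy
    have := hup (hK.mono (Ioc_subset_Icc_self.trans (Icc_subset_Icc hx hy)))
    rwa [Real.volume_Ioc, ← ENNReal.ofReal_coe_nnreal, ← ENNReal.ofReal_mul K.coe_nonneg] at this
  have hfin : ∀ x y, a ≤ x → x ≤ y → y ≤ b → ν (Ioc x y) ≠ ⊤ := fun x y hx hxy hy =>
    ((hupI x y hx hxy hy).trans_lt ENNReal.ofReal_lt_top).ne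
  set F : ℝ → ℝ := fun s => (ν (Ioc a s)).toReal with hF
  have hFsub : ∀ x y, a ≤ x → x ≤ y → y ≤ b → F y - F x = (ν (Ioc x y)).toReal := by
    intro x y hx hxy hy
    have h1 : ν (Ioc a y) = ν (Ioc a x) + ν (Ioc x y) := by
      rw [← measure_union (Ioc_disjoint_Ioc_of_le le_rfl) measurableSet_Ioc,
        Ioc_union_Ioc_eq_Ioc hx hxy]
    simp only [hF]
    rw [h1, ENNReal.toReal_add (hfin a x le_rfl hx (hxy.trans hy)) (hfin x y hx hxy hy)]
    ring
  have hFK : ∀ x y, a ≤ x → x ≤ y → y ≤ b → |F x - F y| ≤ K * |x - y| := by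
    intro x y hx hxy hy
    rw [abs_sub_comm, hFsub x y hx hxy hy, abs_sub_comm x, abs_of_nonneg ENNReal.toReal_nonneg,
      abs_of_nonneg (sub_nonneg.2 hxy)]
    exact ENNReal.toReal_le_of_le_ofReal (mul_nonneg K.coe_nonneg (sub_nonneg.2 hxy)) (hupI x y hx hxy hy)
  have hFlip : LipschitzOnWith K F (Icc a b) := by
    refine LipschitzOnWith.of_dist_le_mul fun x hx y hy => ?_
    rw [Real.dist_eq, Real.dist_eq]
    rcases le_total x y with h | h
    · exact hFK x y hx.1 h hy.2
    · rw [abs_sub_comm, abs_sub_comm x]; exact hFK y x hy.1 h hx.2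
  -- The right difference quotients of the cumulative length are squeezed: near `x` the curve is `(c
  -- + ε)`-Lipschitz and its inverse is `(c - ε)⁻¹`-Lipschitz. A right derivative is all that the
  -- fundamental theorem of calculus below needs.
  have hderiv : ∀ x ∈ Ioo a b, HasDerivWithinAt F ‖deriv γ x‖ (Ioi x) x := by
    intro x hx
    have hst : HasStrictDerivAt γ (deriv γ x) x :=
      (hγ.contDiffAt).hasStrictDerivAt one_ne_zero
    have hc : 0 < ‖deriv γ x‖ := norm_pos_iff.2 (h0 x)
    set c := ‖deriv γ x‖ with hcdef
    rw [hasDerivWithinAt_iff_isLittleO, Asymptotics.isLittleO_iff]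
    intro ε' hε'
    -- The cap `c / 2` keeps `c - ε` positive, as the Lipschitz constant of the inverse requires.
    set ε := min ε' (c / 2) with hεd
    have hε : 0 < ε := lt_min hε' (by positivity)
    have hεc : ε < c := (min_le_right _ _).trans_lt (by linarith)
    obtain ⟨δ, hδ, hb⟩ := hst.eventually_abs_norm_sub_le hε
    have hδ' : 0 < min δ (b - x) := lt_min hδ (by linarith [hx.2])
    filter_upwards [Ioo_mem_nhdsGT (show x < x + min δ (b - x) by linarith)] with y hy
    have hyδ : y ≤ x + δ := by linarith [hy.2, min_le_left δ (b - x)]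
    have hyb : y ≤ b := by linarith [hy.2, min_le_right δ (b - x)]
    have hsub : Ioc x y ⊆ Icc x (x + δ) := fun z hz => ⟨hz.1.le, hz.2.trans hyδ⟩
    have hFy := hFsub x y hx.1.le hy.1.le hyb
    have hlip : LipschitzOnWith (c + ε).toNNReal γ (Ioc x y) := by
      refine LipschitzOnWith.of_dist_le_mul fun u hu w hw => ?_
      rw [Real.coe_toNNReal _ (by linarith), dist_eq_norm, Real.dist_eq]
      have := (abs_le.1 (hb u (hsub hu) w (hsub hw))).2
      linarith
    have h1 : F y - F x ≤ (c + ε) * (y - x) := by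
      rw [hFy]
      refine ENNReal.toReal_le_of_le_ofReal (mul_nonneg (by linarith) (by linarith [hy.1])) ?_
      have := hup hlip
      rwa [Real.volume_Ioc, ← ENNReal.ofReal_coe_nnreal, Real.coe_toNNReal _ (by linarith),
        ← ENNReal.ofReal_mul (by linarith)] at this
    have h2 : (c - ε) * (y - x) ≤ F y - F x := by
      rw [hFy]
      set g := Function.invFun γ with hg
      have hgl : ∀ u, g (γ u) = u := Function.leftInverse_invFun hm.injective
      have hlip2 : LipschitzOnWith (c - ε)⁻¹.toNNReal g (γ '' Ioc x y) := by
        refine LipschitzOnWith.of_dist_le_mul ?_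
        rintro _ ⟨u, hu, rfl⟩ _ ⟨w, hw, rfl⟩
        rw [Real.coe_toNNReal _ (by simp; linarith), hgl, hgl, dist_eq_norm (γ u), Real.dist_eq,
          inv_mul_eq_div, le_div_iff₀ (by linarith)]
        have := (abs_le.1 (hb u (hsub hu) w (hsub hw))).1
        linarith
      have h3 := hlip2.hausdorffMeasure_image_le (d := 1) zero_le_one
      rw [image_image] at h3
      simp only [hgl, image_id'] at h3
      rw [← hνE, hausdorffMeasure_real, ENNReal.rpow_one, Real.volume_Ioc,
        ← ENNReal.ofReal_toReal (hfin x y hx.1.le hy.1.le hyb), ← ENNReal.ofReal_coe_nnreal,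
        ← ENNReal.ofReal_mul (by positivity), ENNReal.ofReal_le_ofReal_iff (by positivity),
        Real.coe_toNNReal _ (by simp; linarith), inv_mul_eq_div, le_div_iff₀ (by linarith)] at h3
      linarith
    rw [Real.norm_eq_abs, Real.norm_eq_abs, abs_of_pos (sub_pos.2 hy.1), smul_eq_mul, abs_le]
    have h3 : ε * (y - x) ≤ ε' * (y - x) :=
      mul_le_mul_of_nonneg_right (min_le_left _ _) (by linarith [hy.1])
    constructor <;> nlinarith
  have hFTC := intervalIntegral.integral_eq_sub_of_hasDeriv_right_of_le hab hFlip.continuousOn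
    hderiv (hcont.norm.intervalIntegrable a b)
  rw [hFTC, hFsub a b le_rfl hab le_rfl, ENNReal.ofReal_toReal (hfin a b le_rfl hab le_rfl), hνE]

open Set Filter Topology in
/-- Arc length on an injective `C¹` curve is the image of its speed times Lebesgue measure. -/
theorem hausdorffMeasure_restrict_range_eq_map {E : Type*} [NormedAddCommGroup E]
    [NormedSpace ℝ E] [MeasurableSpace E] [BorelSpace E] {γ : ℝ → E} (hγ : ContDiff ℝ 1 γ)
    (hm : MeasurableEmbedding γ) (h0 : ∀ s, deriv γ s ≠ 0) :
    (Measure.hausdorffMeasure 1 : Measure E).restrict (range γ) =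
      (volume.withDensity fun s => ENNReal.ofReal ‖deriv γ s‖).map γ := by
  have hcont : Continuous (deriv γ) := hγ.continuous_deriv le_rfl
  -- The restriction to the range is the image of the pulled back measure, so it suffices to compare
  -- two measures on the line on half-open intervals.
  rw [← hm.map_comap]
  congr 1
  refine Measure.ext_of_Ioc' _ _ (fun a b hab => ?_) (fun a b hab => ?_)
  · rw [hm.comap_apply, hausdorffMeasure_image_Ioc_eq_integral hγ hm h0 hab.le]
    exact ENNReal.ofReal_ne_top
  · rw [hm.comap_apply, hausdorffMeasure_image_Ioc_eq_integral hγ hm h0 hab.le,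
      withDensity_apply _ measurableSet_Ioc, intervalIntegral.integral_of_le hab.le,
      ofReal_integral_eq_lintegral_ofReal]
    · exact (hcont.norm.integrableOn_Icc (a := a) (b := b)).mono_set Ioc_subset_Icc_self
    · exact Eventually.of_forall fun _ => norm_nonneg _

/-! ### Graph charts and the outward normal -/

theorem Plane.inner_eq (x y : Plane) : inner ℝ x y = x 0 * y 0 + x 1 * y 1 := by
  simp [PiLp.inner_apply, Fin.sum_univ_two, mul_comm]

theorem Plane.norm_sq_eq (x : Plane) : ‖x‖ ^ 2 = x 0 ^ 2 + x 1 ^ 2 := by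
  rw [← real_inner_self_eq_norm_sq, Plane.inner_eq]; ring

/-- A chart of class `C^{1,μ}` of `∂Ω` around `p`: in the ball of radius `r` around `p`, the set
`Ω` is the region below the graph of `f` in the coordinates given by the isometry `R`. -/
structure GraphChart (μ : ℝ≥0) (Ω : Set Plane) (p : Plane) where
  R : Plane ≃ₗᵢ[ℝ] Plane
  f : ℝ → ℝ
  r : ℝ
  C : ℝ≥0
  r_pos : 0 < r
  contDiff : ContDiff ℝ 1 f
  holder : HolderWith C μ (deriv f)
  inter_ball : Ω ∩ Metric.ball p r = {x | (R x) 1 < f ((R x) 0)} ∩ Metric.ball p r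

theorem IsC1HolderDomain.nonempty_graphChart {μ : ℝ≥0} {Ω : Set Plane} (h : IsC1HolderDomain μ Ω)
    {p : Plane} (hp : p ∈ frontier Ω) : Nonempty (GraphChart μ Ω p) := by
  obtain ⟨R, f, r, C, h1, h2, h3, h4⟩ := h.graph p hp
  exact ⟨⟨R, f, r, C, h1, h2, h3, h4⟩⟩

/-- A unit outward normal, if there is one, is unique. -/
theorem IsOutwardUnitNormal.unique {Ω : Set Plane} {x n m : Plane}
    (hn : IsOutwardUnitNormal Ω x n) (hm : IsOutwardUnitNormal Ω x m) : n = m := by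
  by_contra hne
  have h1 : inner ℝ n m < 1 := (inner_lt_one_iff_real_of_norm_eq_one hn.1 hm.1).2 hne
  -- The direction `m - n` is obtuse to `n` and acute to `m`, so it would both enter `Ω` and leave
  -- its closure.
  have hv1 : inner ℝ (m - n) n < 0 := by
    rw [inner_sub_left, real_inner_self_eq_norm_sq, hn.1, real_inner_comm]; linarith
  have hv2 : 0 < inner ℝ (m - n) m := by
    rw [inner_sub_left, real_inner_self_eq_norm_sq, hm.1]; linarith
  obtain ⟨ε, hε, h2⟩ := hn.2.1 _ hv1
  obtain ⟨δ, hδ, h3⟩ := hm.2.2 _ hv2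
  have hpos : 0 < min ε δ := lt_min hε hδ
  refine h3 (min ε δ / 2) (by positivity) ?_ (subset_closure (h2 (min ε δ / 2) (by positivity) ?_))
  · linarith [min_le_right ε δ]
  · linarith [min_le_left ε δ]

theorem IsOutwardUnitNormal.outwardNormal_eq {Ω : Set Plane} {x n : Plane}
    (hn : IsOutwardUnitNormal Ω x n) : outwardNormal Ω x = n := by
  have h : ∃ n, IsOutwardUnitNormal Ω x n := ⟨n, hn⟩
  rw [outwardNormal, dif_pos h]
  exact h.choose_spec.unique hn

namespace GraphChart

variable {μ : ℝ≥0} {Ω : Set Plane} {p : Plane} (c : GraphChart μ Ω p)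

/-- The height of a point above the graph. -/
noncomputable def height (x : Plane) : ℝ := (c.R x) 1 - c.f ((c.R x) 0)

/-- The unit normal to the graph pointing upwards. -/
noncomputable def normal (x : Plane) : Plane :=
  (√(1 + deriv c.f ((c.R x) 0) ^ 2))⁻¹ • c.R.symm !₂[-deriv c.f ((c.R x) 0), 1]

/-- The parametrisation of the graph by the first coordinate. -/
noncomputable def curve (s : ℝ) : Plane := c.R.symm !₂[s, c.f s]

theorem continuous_deriv : Continuous (deriv c.f) := c.contDiff.continuous_deriv le_rfl

theorem continuous_height : Continuous c.height := by
  have := c.contDiff.continuous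
  unfold height
  fun_prop

theorem continuous_normal : Continuous c.normal := by
  have h := c.continuous_deriv
  unfold normal
  refine Continuous.smul (Continuous.inv₀ (f := fun x => √(1 + deriv c.f ((c.R x) 0) ^ 2))
    (by fun_prop) fun x => ?_) ?_
  · positivity
  · refine c.R.symm.continuous.comp ?_
    refine (PiLp.continuous_toLp 2 _).comp (continuous_pi fun i => ?_)
    fin_cases i <;> simp <;> fun_prop

theorem inner_normal (x v : Plane) : inner ℝ v (c.normal x) =
    (√(1 + deriv c.f ((c.R x) 0) ^ 2))⁻¹ *
      ((c.R v) 1 - deriv c.f ((c.R x) 0) * (c.R v) 0) := by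
  rw [normal, inner_smul_right, ← c.R.inner_map_map, LinearIsometryEquiv.apply_symm_apply,
    Plane.inner_eq]
  simp
  ring_nf
  simp

theorem norm_normal (x : Plane) : ‖c.normal x‖ = 1 := by
  have h : ‖c.normal x‖ ^ 2 = 1 := by
    rw [normal, norm_smul, LinearIsometryEquiv.norm_map, mul_pow, Plane.norm_sq_eq]
    simp only [norm_inv, inv_pow, Real.norm_eq_abs, sq_abs]
    rw [Real.sq_sqrt (by positivity)]
    simp
    field_simp
    ring_nf
  exact (sq_eq_sq₀ (norm_nonneg _) zero_le_one).1 (by rw [h, one_pow])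

/-- By `inner_normal` this derivative is a positive multiple of the inner product of `v` with the
normal, whose sign therefore decides on which side of the graph a short step along `v` ends. -/
theorem hasDerivAt_height (x v : Plane) :
    HasDerivAt (fun t : ℝ => c.height (x + t • v))
      ((c.R v) 1 - deriv c.f ((c.R x) 0) * (c.R v) 0) 0 := by
  have h1 : ∀ i, HasDerivAt (fun t : ℝ => (c.R (x + t • v)) i) ((c.R v) i) 0 := by
    intro i
    simp only [map_add, map_smul, PiLp.add_apply, PiLp.smul_apply, smul_eq_mul]
    simpa using ((hasDerivAt_id (0 : ℝ)).mul_const ((c.R v) i)).const_add ((c.R x) i)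
  have h2 : HasDerivAt c.f (deriv c.f ((c.R x) 0)) ((c.R (x + (0 : ℝ) • v)) 0) := by
    simpa using (c.contDiff.differentiable one_ne_zero _).hasDerivAt
  exact (h1 1).sub (h2.comp (h := fun t : ℝ => (c.R (x + t • v)) 0) (0 : ℝ) (h1 0))

theorem mem_iff {x : Plane} (hx : x ∈ Metric.ball p c.r) : x ∈ Ω ↔ c.height x < 0 := by
  have := Set.ext_iff.1 c.inter_ball x
  simp only [Set.mem_inter_iff, hx, and_true, Set.mem_ofPred_eq] at this
  rw [this, height, sub_neg]

open Filter Topology in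
theorem eventually_height_neg {x v : Plane} (hx : c.height x = 0)
    (hv : inner ℝ v (c.normal x) < 0) : ∀ᶠ t : ℝ in 𝓝[>] 0, c.height (x + t • v) < 0 := by
  have h := (c.hasDerivAt_height x v)
  rw [inner_normal] at hv
  have hneg := neg_of_mul_neg_right hv (by positivity)
  have h3 := (hasDerivAt_iff_tendsto_slope.1 h).eventually (gt_mem_nhds hneg)
  have h4 : ∀ᶠ t : ℝ in 𝓝[>] 0, slope (fun t : ℝ => c.height (x + t • v)) 0 t < 0 :=
    h3.filter_mono (nhdsWithin_mono _ fun t (ht : 0 < t) => ht.ne')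
  filter_upwards [h4, self_mem_nhdsWithin] with t ht ht0
  rw [slope_def_field] at ht
  simp only [zero_smul, add_zero, hx, sub_zero] at ht
  exact (div_neg_iff.1 ht).resolve_left (fun h => absurd h.2 (not_lt.2 (le_of_lt ht0))) |>.1

open Filter Topology in
theorem eventually_height_pos {x v : Plane} (hx : c.height x = 0)
    (hv : 0 < inner ℝ v (c.normal x)) : ∀ᶠ t : ℝ in 𝓝[>] 0, 0 < c.height (x + t • v) := by
  have h := (c.hasDerivAt_height x v)
  rw [inner_normal] at hv
  have hneg := pos_of_mul_pos_right hv (by positivity)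
  have h3 := (hasDerivAt_iff_tendsto_slope.1 h).eventually (lt_mem_nhds hneg)
  have h4 : ∀ᶠ t : ℝ in 𝓝[>] 0, 0 < slope (fun t : ℝ => c.height (x + t • v)) 0 t :=
    h3.filter_mono (nhdsWithin_mono _ fun t (ht : 0 < t) => ht.ne')
  filter_upwards [h4, self_mem_nhdsWithin] with t ht ht0
  rw [slope_def_field] at ht
  simp only [zero_smul, add_zero, hx, sub_zero] at ht
  exact (div_pos_iff.1 ht).resolve_right (fun h => absurd h.2 (not_lt.2 (le_of_lt ht0))) |>.1

open Filter Topology in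
theorem eventually_mem_ball {x : Plane} (hx : x ∈ Metric.ball p c.r) (v : Plane) :
    ∀ᶠ t : ℝ in 𝓝[>] 0, x + t • v ∈ Metric.ball p c.r := by
  have : Tendsto (fun t : ℝ => x + t • v) (𝓝 0) (𝓝 x) := by
    have h : Continuous fun t : ℝ => x + t • v := by fun_prop
    simpa using h.tendsto 0
  exact (this.mono_left nhdsWithin_le_nhds).eventually (Metric.isOpen_ball.mem_nhds hx)

theorem height_le_of_mem_closure {x : Plane} (hx : x ∈ Metric.ball p c.r) (h : x ∈ closure Ω) :
    c.height x ≤ 0 := by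
  have h1 : x ∈ closure (Ω ∩ Metric.ball p c.r) := by
    rw [Set.inter_comm]
    exact Metric.isOpen_ball.inter_closure ⟨hx, h⟩
  exact closure_minimal (fun y hy => ((c.mem_iff hy.2).1 hy.1).le)
    (isClosed_le c.continuous_height continuous_const) h1

/-- The frontier of an open set is its closure minus the set. In the ball, heights are at most 0 on
the closure and at least 0 off `Ω`; conversely, a point of height 0 is approached from `Ω` along
minus the normal. -/
theorem mem_frontier_iff (hΩ : IsOpen Ω) {x : Plane} (hx : x ∈ Metric.ball p c.r) :
    x ∈ frontier Ω ↔ c.height x = 0 := by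
  rw [hΩ.frontier_eq, Set.mem_sdiff, c.mem_iff hx]
  constructor
  · rintro ⟨h1, h2⟩
    exact le_antisymm (c.height_le_of_mem_closure hx h1) (not_lt.1 h2)
  · intro h
    refine ⟨?_, by rw [h]; exact lt_irrefl _⟩
    have hv : inner ℝ (-c.normal x) (c.normal x) < 0 := by
      rw [inner_neg_left, real_inner_self_eq_norm_sq, norm_normal]; norm_num
    have hev : ∀ᶠ t : ℝ in nhdsWithin 0 (Set.Ioi 0), x + t • (-c.normal x) ∈ Ω := by
      filter_upwards [c.eventually_height_neg h hv, c.eventually_mem_ball hx (-c.normal x)]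
        with t h1 h2
      exact (c.mem_iff h2).2 h1
    have ht : Filter.Tendsto (fun t : ℝ => x + t • (-c.normal x)) (nhdsWithin 0 (Set.Ioi 0))
        (nhds x) := by
      have h : Continuous fun t : ℝ => x + t • (-c.normal x) := by fun_prop
      simpa using (h.tendsto 0).mono_left nhdsWithin_le_nhds
    exact mem_closure_of_tendsto ht hev

theorem isOutwardUnitNormal (hΩ : IsOpen Ω) {x : Plane} (hx : x ∈ Metric.ball p c.r)
    (h : x ∈ frontier Ω) : IsOutwardUnitNormal Ω x (c.normal x) := by
  rw [c.mem_frontier_iff hΩ hx] at h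
  refine ⟨c.norm_normal x, fun v hv => ?_, fun v hv => ?_⟩
  · have hev : ∀ᶠ t : ℝ in nhdsWithin 0 (Set.Ioi 0), x + t • v ∈ Ω := by
      filter_upwards [c.eventually_height_neg h hv, c.eventually_mem_ball hx v] with t h1 h2
      exact (c.mem_iff h2).2 h1
    obtain ⟨ε, hε, h1⟩ := mem_nhdsGT_iff_exists_Ioo_subset.1 hev
    exact ⟨ε, hε, fun t ht1 ht2 => h1 ⟨ht1, ht2⟩⟩
  · have hev : ∀ᶠ t : ℝ in nhdsWithin 0 (Set.Ioi 0), x + t • v ∉ closure Ω := by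
      filter_upwards [c.eventually_height_pos h hv, c.eventually_mem_ball hx v] with t h1 h2 h3
      exact absurd (c.height_le_of_mem_closure h2 h3) (not_le.2 h1)
    obtain ⟨ε, hε, h1⟩ := mem_nhdsGT_iff_exists_Ioo_subset.1 hev
    exact ⟨ε, hε, fun t ht1 ht2 => h1 ⟨ht1, ht2⟩⟩

theorem outwardNormal_eq (hΩ : IsOpen Ω) {x : Plane} (hx : x ∈ Metric.ball p c.r)
    (h : x ∈ frontier Ω) : outwardNormal Ω x = c.normal x :=
  (c.isOutwardUnitNormal hΩ hx h).outwardNormal_eq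

/-- Between `s` and `t` the derivative of `u ↦ f u - f' s * u` is at most `C |t - s| ^ μ` by Hölder
continuity, and the mean value inequality supplies one more factor `|t - s|`. -/
theorem abs_taylor_le (s t : ℝ) :
    |c.f t - c.f s - deriv c.f s * (t - s)| ≤ c.C * |t - s| ^ (1 + μ : ℝ) := by
  have hd : ∀ u, HasDerivAt (fun u => c.f u - deriv c.f s * u) (deriv c.f u - deriv c.f s) u := by
    intro u
    have h := ((hasDerivAt_id' u).const_mul (deriv c.f s))
    rw [mul_one] at h
    exact (c.contDiff.differentiable one_ne_zero u).hasDerivAt.sub h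
  have hb : ∀ u ∈ Set.uIcc s t, ‖deriv c.f u - deriv c.f s‖ ≤ c.C * |t - s| ^ (μ : ℝ) := by
    intro u hu
    have := c.holder.dist_le u s
    rw [Real.dist_eq, Real.dist_eq] at this
    refine this.trans ?_
    exact mul_le_mul_of_nonneg_left (Real.rpow_le_rpow (abs_nonneg _)
      (Set.abs_sub_left_of_mem_uIcc hu) μ.coe_nonneg) c.C.coe_nonneg
  have := (convex_uIcc s t).norm_image_sub_le_of_norm_hasDerivWithin_le
    (fun u _ => (hd u).hasDerivWithinAt) hb Set.left_mem_uIcc Set.right_mem_uIcc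
  rw [Real.norm_eq_abs, Real.norm_eq_abs, mul_assoc] at this
  rcases eq_or_ne t s with rfl | hts
  · simp; positivity
  · rw [Real.rpow_add (abs_pos.2 (sub_ne_zero.2 hts)), Real.rpow_one, mul_comm |t - s|]
    refine le_trans (le_of_eq ?_) this
    congr 1
    ring

/-- For two points of the graph the inner product is the Taylor remainder of `f` divided by a square
root that is at least 1. The gain `μ` in the exponent makes the normal derivative of `G` weakly
singular on the boundary. -/
theorem abs_inner_normal_le {x y : Plane} (hx : c.height x = 0) (hy : c.height y = 0) :
    |inner ℝ (x - y) (c.normal y)| ≤ c.C * ‖x - y‖ ^ (1 + μ : ℝ) := by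
  rw [inner_normal]
  rw [height, sub_eq_zero] at hx hy
  set s := (c.R y) 0
  set t := (c.R x) 0
  have h1 : |t - s| ≤ ‖x - y‖ := by
    have := PiLp.norm_apply_le (c.R (x - y)) 0
    rwa [LinearIsometryEquiv.norm_map, map_sub, PiLp.sub_apply, Real.norm_eq_abs] at this
  have h2 : (√(1 + deriv c.f s ^ 2))⁻¹ ≤ 1 := by
    apply inv_le_one_of_one_le₀
    rw [Real.one_le_sqrt]
    nlinarith [sq_nonneg (deriv c.f s)]
  rw [abs_mul, abs_of_nonneg (by positivity), map_sub, PiLp.sub_apply, PiLp.sub_apply, hx, hy]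
  calc _ ≤ 1 * (c.C * |t - s| ^ (1 + μ : ℝ)) := by
        gcongr
        exact c.abs_taylor_le s t
    _ ≤ _ := by rw [one_mul]; gcongr

theorem height_curve (s : ℝ) : c.height (c.curve s) = 0 := by
  simp [height, curve]

theorem coord_curve (s : ℝ) : (c.R (c.curve s)) 0 = s := by simp [curve]

theorem curve_coord {x : Plane} (hx : c.height x = 0) : c.curve ((c.R x) 0) = x := by
  rw [height, sub_eq_zero] at hx
  rw [curve, ← hx, LinearIsometryEquiv.symm_apply_eq]
  ext i
  fin_cases i <;> simp

theorem range_curve : Set.range c.curve = {x | c.height x = 0} := by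
  ext x
  constructor
  · rintro ⟨s, rfl⟩
    exact c.height_curve s
  · intro hx
    exact ⟨_, c.curve_coord hx⟩

theorem hasDerivAt_curve (s : ℝ) :
    HasDerivAt c.curve (c.R.symm !₂[1, deriv c.f s]) s := by
  have h : HasDerivAt (fun s => !₂[s, c.f s]) !₂[1, deriv c.f s] s := by
    refine (PiLp.hasStrictFDerivAt_toLp 2 _).hasFDerivAt.comp_hasDerivAt s
      (f := fun s => ![s, c.f s]) (f' := ![1, deriv c.f s]) ?_
    rw [hasDerivAt_pi]
    intro i
    fin_cases i
    · simpa using hasDerivAt_id' s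
    · simpa using (c.contDiff.differentiable one_ne_zero s).hasDerivAt
  exact (c.R.symm.toContinuousLinearEquiv.hasFDerivAt).comp_hasDerivAt s h

theorem norm_deriv_curve (s : ℝ) : ‖deriv c.curve s‖ = √(1 + deriv c.f s ^ 2) := by
  rw [(c.hasDerivAt_curve s).deriv, LinearIsometryEquiv.norm_map, ← Real.sqrt_sq (norm_nonneg _),
    Plane.norm_sq_eq]
  simp

theorem contDiff_curve : ContDiff ℝ 1 c.curve := by
  unfold curve
  refine c.R.symm.contDiff.comp ((PiLp.contDiff_toLp).comp (contDiff_pi.2 fun i => ?_))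
  fin_cases i
  · simpa using contDiff_fun_id
  · simpa using c.contDiff

theorem measurableEmbedding_curve : MeasurableEmbedding c.curve := by
  refine c.contDiff_curve.continuous.measurableEmbedding fun s t hst => ?_
  rw [← c.coord_curve s, hst, c.coord_curve]

/-- Arc length on the graph in terms of the first coordinate. -/
theorem hausdorffMeasure_restrict_eq_map :
    (Measure.hausdorffMeasure 1 : Measure Plane).restrict {x | c.height x = 0} =
      (volume.withDensity fun s => ENNReal.ofReal √(1 + deriv c.f s ^ 2)).map c.curve := by
  rw [← range_curve, hausdorffMeasure_restrict_range_eq_map c.contDiff_curve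
    c.measurableEmbedding_curve]
  · simp only [norm_deriv_curve]
  · intro s
    rw [← norm_pos_iff, norm_deriv_curve]
    positivity

end GraphChart

theorem IsC1HolderDomain.isOutwardUnitNormal_outwardNormal {μ : ℝ≥0} {Ω : Set Plane}
    (h : IsC1HolderDomain μ Ω) {x : Plane} (hx : x ∈ frontier Ω) :
    IsOutwardUnitNormal Ω x (outwardNormal Ω x) := by
  obtain ⟨c⟩ := h.nonempty_graphChart hx
  have := c.isOutwardUnitNormal h.isOpen (Metric.mem_ball_self c.r_pos) hx
  rwa [this.outwardNormal_eq]

theorem IsC1HolderDomain.continuousOn_outwardNormal {μ : ℝ≥0} {Ω : Set Plane}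
    (h : IsC1HolderDomain μ Ω) : ContinuousOn (outwardNormal Ω) (frontier Ω) := by
  intro x hx
  obtain ⟨c⟩ := h.nonempty_graphChart hx
  refine c.continuous_normal.continuousWithinAt.congr_of_eventuallyEq ?_
    (c.outwardNormal_eq h.isOpen (Metric.mem_ball_self c.r_pos) hx)
  filter_upwards [self_mem_nhdsWithin, nhdsWithin_le_nhds (Metric.ball_mem_nhds x c.r_pos)]
    with y hy1 hy2
  exact c.outwardNormal_eq h.isOpen hy2 hy1

/-! ### Weakly singular integrals along the boundary -/

theorem lintegral_ball_abs_rpow_lt_top {a : ℝ} (ha1 : a < 1) :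
    ∫⁻ s in Metric.ball (0 : ℝ) 1, ENNReal.ofReal (|s| ^ (-a)) < ⊤ := by
  have h : IntegrableOn (fun s : ℝ => |s| ^ (-a)) (Metric.ball (0 : ℝ) 1) := by
    have h1 : IntervalIntegrable (fun s : ℝ => |s| ^ (-a)) volume 0 1 := by
      refine (intervalIntegral.intervalIntegrable_rpow' (r := -a) (by linarith)).congr ?_
      rw [Set.uIoc_of_le zero_le_one]
      intro s hs
      simp only [abs_of_pos hs.1]
    have h2 : IntervalIntegrable (fun s : ℝ => |s| ^ (-a)) volume (-1) 0 := by
      have := h1.comp_sub_left 0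
      simp only [zero_sub, abs_neg, neg_zero] at this
      simpa using this.symm
    have h3 := h2.trans h1
    rw [intervalIntegrable_iff_integrableOn_Ioc_of_le (by norm_num)] at h3
    refine h3.mono_set fun s hs => ?_
    rw [Metric.mem_ball, Real.dist_eq, sub_zero, abs_lt] at hs
    exact ⟨hs.1, hs.2.le⟩
  have h2 := h.2
  rw [hasFiniteIntegral_iff_norm] at h2
  refine lt_of_le_of_lt (lintegral_mono fun s => ?_) h2
  exact ENNReal.ofReal_le_ofReal (le_abs_self _)

/-- Farther than 1 from `x` the integrand is at most 1; nearer, a translation moves the singularity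
to the origin. The bound is independent of `x`, which the Schur test needs. -/
theorem lintegral_ball_abs_sub_rpow_le {a : ℝ} (ha : 0 ≤ a) (s₀ x r : ℝ) :
    ∫⁻ s in Metric.ball s₀ r, ENNReal.ofReal (|x - s| ^ (-a)) ≤
      ENNReal.ofReal (2 * r) + ∫⁻ s in Metric.ball (0 : ℝ) 1, ENNReal.ofReal (|s| ^ (-a)) := by
  have hm : Measurable fun s : ℝ => ENNReal.ofReal (|s| ^ (-a)) := by fun_prop
  have hle : ∀ s : ℝ, ENNReal.ofReal (|x - s| ^ (-a)) ≤
      1 + (Metric.ball (0 : ℝ) 1).indicator (fun s => ENNReal.ofReal (|s| ^ (-a))) (x - s) := by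
    intro s
    by_cases h : x - s ∈ Metric.ball (0 : ℝ) 1
    · rw [Set.indicator_of_mem h]
      exact le_add_self
    · rw [Set.indicator_of_notMem h, add_zero]
      rw [Metric.mem_ball, Real.dist_eq, sub_zero, not_lt] at h
      exact ENNReal.ofReal_le_one.2 (Real.rpow_le_one_of_one_le_of_nonpos h (by linarith))
  calc _ ≤ ∫⁻ s in Metric.ball s₀ r, (1 +
        (Metric.ball (0 : ℝ) 1).indicator (fun s => ENNReal.ofReal (|s| ^ (-a))) (x - s)) :=
        lintegral_mono hle
    _ = volume (Metric.ball s₀ r) + ∫⁻ s in Metric.ball s₀ r,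
        (Metric.ball (0 : ℝ) 1).indicator (fun s => ENNReal.ofReal (|s| ^ (-a))) (x - s) := by
        rw [lintegral_add_left measurable_const]; simp
    _ ≤ ENNReal.ofReal (2 * r) + ∫⁻ s,
        (Metric.ball (0 : ℝ) 1).indicator (fun s => ENNReal.ofReal (|s| ^ (-a))) (x - s) := by
        rw [Real.volume_ball]
        gcongr
        exact Measure.restrict_le_self
    _ = _ := by
        rw [lintegral_sub_left_eq_self, lintegral_indicator Metric.isOpen_ball.measurableSet]

namespace GraphChart

variable {μ : ℝ≥0} {Ω : Set Plane} {p : Plane} (c : GraphChart μ Ω p)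

/-- In the chart, arc length is a bounded density times Lebesgue measure, and projecting to the
first coordinate only shrinks distances, so the one-dimensional bound applies for every `x` in the
plane. -/
theorem exists_lintegral_norm_sub_rpow_le (hΩ : IsOpen Ω) {a : ℝ} (ha : 0 ≤ a) (ha1 : a < 1) :
    ∃ M : ℝ≥0, ∀ x : Plane, ∫⁻ z in Metric.ball p c.r, ENNReal.ofReal (‖x - z‖ ^ (-a))
      ∂(arcLength Ω) ≤ M := by
  obtain ⟨K, hK⟩ := (isCompact_closedBall ((c.R p) 0) c.r).exists_bound_of_continuousOn
    (f := fun s => √(1 + deriv c.f s ^ 2)) (by have := c.continuous_deriv; fun_prop)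
  set B := ENNReal.ofReal (2 * c.r) +
    ∫⁻ s in Metric.ball (0 : ℝ) 1, ENNReal.ofReal (|s| ^ (-a))
  have hB : ENNReal.ofReal K * B ≠ ⊤ := ENNReal.mul_ne_top ENNReal.ofReal_ne_top
    (ENNReal.add_ne_top.2 ⟨ENNReal.ofReal_ne_top, (lintegral_ball_abs_rpow_lt_top ha1).ne⟩)
  refine ⟨(ENNReal.ofReal K * B).toNNReal, fun x => ?_⟩
  rw [ENNReal.coe_toNNReal hB]
  have hmb : MeasurableSet (Metric.ball p c.r) := Metric.isOpen_ball.measurableSet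
  have hset : Metric.ball p c.r ∩ frontier Ω = Metric.ball p c.r ∩ {x | c.height x = 0} := by
    ext z
    exact and_congr_right fun hz => c.mem_frontier_iff hΩ hz
  have hmg : Measurable fun z => ENNReal.ofReal (‖x - z‖ ^ (-a)) := by fun_prop
  rw [arcLength, Measure.restrict_restrict hmb, hset, ← Measure.restrict_restrict hmb,
    c.hausdorffMeasure_restrict_eq_map, ← lintegral_indicator hmb,
    c.measurableEmbedding_curve.lintegral_map, lintegral_withDensity_eq_lintegral_mul _
    (by have := c.continuous_deriv; fun_prop) (show Measurable fun s =>
      (Metric.ball p c.r).indicator (fun z => ENNReal.ofReal (‖x - z‖ ^ (-a))) (c.curve s) from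
      (hmg.indicator hmb).comp c.contDiff_curve.continuous.measurable)]
  calc _ ≤ ∫⁻ s, ENNReal.ofReal K * (Metric.ball ((c.R p) 0) c.r).indicator
        (fun s => ENNReal.ofReal (|(c.R x) 0 - s| ^ (-a))) s := by
        refine lintegral_mono_ae ?_
        -- The parameter equal to the coordinate of `x` is discarded: for `a > 0` the negative power
        -- of 0 has the default value 0 and the comparison could fail there.
        filter_upwards [(measure_eq_zero_iff_ae_notMem.1 (Real.volume_singleton (a := (c.R x) 0)))]
          with s hs
        simp only [Pi.mul_apply]
        by_cases h : c.curve s ∈ Metric.ball p c.r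
        · have hn : ∀ y, |(c.R y) 0 - s| ≤ ‖y - c.curve s‖ := fun y => by
            have := PiLp.norm_apply_le (c.R (y - c.curve s)) 0
            rwa [LinearIsometryEquiv.norm_map, map_sub, PiLp.sub_apply, c.coord_curve,
              Real.norm_eq_abs] at this
          have h1 : s ∈ Metric.ball ((c.R p) 0) c.r := by
            rw [Metric.mem_ball', Real.dist_eq]
            rw [Metric.mem_ball', dist_eq_norm] at h
            exact (hn p).trans_lt h
          rw [Set.indicator_of_mem h, Set.indicator_of_mem h1]
          refine mul_le_mul' (ENNReal.ofReal_le_ofReal ((le_abs_self _).trans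
            (hK s (Metric.ball_subset_closedBall h1)))) (ENNReal.ofReal_le_ofReal ?_)
          refine Real.rpow_le_rpow_of_nonpos (abs_pos.2 (sub_ne_zero.2 fun h => hs h.symm)) (hn x)
            (by linarith)
        · rw [Set.indicator_of_notMem h, mul_zero]
          exact zero_le
    _ = ENNReal.ofReal K * ∫⁻ s in Metric.ball ((c.R p) 0) c.r,
          ENNReal.ofReal (|(c.R x) 0 - s| ^ (-a)) := by
        rw [lintegral_const_mul', lintegral_indicator Metric.isOpen_ball.measurableSet]
        exact ENNReal.ofReal_ne_top
    _ ≤ _ := by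
        gcongr
        exact lintegral_ball_abs_sub_rpow_le ha _ _ _

end GraphChart

namespace IsC1HolderDomain

variable {μ : ℝ≥0} {Ω : Set Plane}

theorem isCompact_frontier (hb : Bornology.IsBounded Ω) : IsCompact (frontier Ω) :=
  Metric.isCompact_of_isClosed_isBounded isClosed_frontier
    (hb.closure.subset frontier_subset_closure)

/-- Singular integrals of order less than one converge on the boundary, uniformly. -/
theorem exists_lintegral_norm_sub_rpow_le (h : IsC1HolderDomain μ Ω)
    (hb : Bornology.IsBounded Ω) {a : ℝ} (ha : 0 ≤ a) (ha1 : a < 1) :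
    ∃ M : ℝ≥0, ∀ x : Plane, ∫⁻ z, ENNReal.ofReal (‖x - z‖ ^ (-a)) ∂(arcLength Ω) ≤ M := by
  suffices H : ∃ M : ℝ≥0, ∀ x : Plane,
      ∫⁻ z in frontier Ω, ENNReal.ofReal (‖x - z‖ ^ (-a)) ∂(arcLength Ω) ≤ M by
    simpa only [arcLength, Measure.restrict_restrict isClosed_frontier.measurableSet,
      Set.inter_self] using H
  refine (isCompact_frontier hb).induction_on (p := fun s => ∃ M : ℝ≥0, ∀ x : Plane,
      ∫⁻ z in s, ENNReal.ofReal (‖x - z‖ ^ (-a)) ∂(arcLength Ω) ≤ M) ⟨0, by simp⟩ ?_ ?_ ?_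
  · rintro s t hst ⟨M, hM⟩
    exact ⟨M, fun x => (lintegral_mono_set hst).trans (hM x)⟩
  · rintro s t ⟨M, hM⟩ ⟨N, hN⟩
    refine ⟨M + N, fun x => (lintegral_union_le _ _ _).trans ?_⟩
    rw [ENNReal.coe_add]
    exact add_le_add (hM x) (hN x)
  · intro x hx
    obtain ⟨c⟩ := h.nonempty_graphChart hx
    exact ⟨_, mem_nhdsWithin_of_mem_nhds (Metric.ball_mem_nhds x c.r_pos),
      c.exists_lintegral_norm_sub_rpow_le h.isOpen ha ha1⟩

/-- This is the exponent `a = 0` of the preceding bound, where the integrand is 1. -/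
theorem isFiniteMeasure_arcLength (h : IsC1HolderDomain μ Ω) (hb : Bornology.IsBounded Ω) :
    IsFiniteMeasure (arcLength Ω) := by
  obtain ⟨M, hM⟩ := h.exists_lintegral_norm_sub_rpow_le hb le_rfl zero_lt_one
  refine ⟨?_⟩
  have := hM 0
  simp at this
  exact this.trans_lt ENNReal.coe_lt_top

end IsC1HolderDomain

/-! ### The divergence theorem -/

open Set in
/-- The divergence theorem below the graph of a `C¹` function. -/
theorem integral_subgraph_fderiv {f : ℝ → ℝ} (hf : ContDiff ℝ 1 f) {u : ℝ × ℝ → ℝ}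
    (hu : ContDiff ℝ 1 u) (hc : HasCompactSupport u) (a b : ℝ) :
    ∫ q in {q : ℝ × ℝ | q.2 < f q.1}, fderiv ℝ u q (a, b) =
      ∫ s, u (s, f s) * (b - deriv f s * a) := by
  have hfc := hf.continuous
  have hf'c : Continuous (deriv f) := hf.continuous_deriv le_rfl
  have hfd : ∀ s, HasDerivAt f (deriv f s) s := fun s =>
    (hf.differentiable one_ne_zero s).hasDerivAt
  have hud : ∀ q, HasFDerivAt u (fderiv ℝ u q) q := fun q =>
    (hu.differentiable one_ne_zero q).hasFDerivAt
  have hu'c : Continuous (fderiv ℝ u) := hu.continuous_fderiv one_ne_zero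
  -- An area-preserving shear that carries the lower half plane onto the region below the graph.
  let sh : ℝ × ℝ ≃ₜ ℝ × ℝ :=
    { toFun := fun q => (q.1, q.2 + f q.1)
      invFun := fun q => (q.1, q.2 - f q.1)
      left_inv := fun q => by simp
      right_inv := fun q => by simp
      continuous_toFun := by fun_prop
      continuous_invFun := by fun_prop }
  have hsh : ∀ q, sh q = (q.1, q.2 + f q.1) := fun _ => rfl
  have hmp : MeasurePreserving sh volume volume := by
    refine (MeasurePreserving.id (volume : Measure ℝ)).skew_product
      (g := fun s t => t + f s) (by fun_prop) ?_
    exact Filter.Eventually.of_forall fun s => map_add_right_eq_self volume (f s)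
  have hcs : ∀ w : ℝ × ℝ → ℝ × ℝ, Continuous w →
      Integrable (fun q => fderiv ℝ u (sh q) (w q)) := by
    intro w hw
    refine Continuous.integrable_of_hasCompactSupport ?_ ?_
    · exact (hu'c.comp sh.continuous).clm_apply hw
    · refine ((hc.fderiv (𝕜 := ℝ)).comp_homeomorph sh).mono' ?_
      refine Function.support_subset_iff'.2 (fun q hq => ?_) |>.trans subset_closure
      simp only [Function.mem_support, Function.comp_apply, not_not] at hq
      simp [hq]
  have e1 : ∫ q in {q : ℝ × ℝ | q.2 < f q.1}, fderiv ℝ u q (a, b) =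
      ∫ q in univ ×ˢ Iio 0, fderiv ℝ u (sh q) (a, b) := by
    have h := hmp.setIntegral_preimage_emb sh.measurableEmbedding
      (fun q => fderiv ℝ u q (a, b)) {q : ℝ × ℝ | q.2 < f q.1}
    rw [← h]
    congr 2
    ext q
    simp [hsh]
  -- Along a vertical translate of the graph, the tangential derivative is the total derivative of a
  -- compactly supported function.
  have h1 : ∀ t, ∫ s, fderiv ℝ u (sh (s, t)) (1, deriv f s) = 0 := by
    intro t
    have hd : ∀ s, HasDerivAt (fun s => u (s, t + f s)) (fderiv ℝ u (sh (s, t)) (1, deriv f s)) s :=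
      fun s => (hud (sh (s, t))).comp_hasDerivAt s
        ((hasDerivAt_id' s).prodMk ((hfd s).const_add t))
    have hcu : HasCompactSupport fun s => u (s, t + f s) := by
      refine HasCompactSupport.intro ((hc.isCompact.image sh.symm.continuous).image
        continuous_fst) fun s hs => image_eq_zero_of_notMem_tsupport fun h => hs ?_
      exact ⟨(s, t), ⟨_, h, sh.symm_apply_apply (s, t)⟩, rfl⟩
    refine integral_eq_zero_of_hasDerivAt_of_integrable hd ?_ ?_
    · have hcd : HasCompactSupport (deriv fun s => u (s, t + f s)) := hcu.deriv
      have he : (deriv fun s => u (s, t + f s)) = fun s => fderiv ℝ u (sh (s, t)) (1, deriv f s) :=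
        funext fun s => (hd s).deriv
      rw [he] at hcd
      refine Continuous.integrable_of_hasCompactSupport ?_ hcd
      exact (hu'c.comp (sh.continuous.comp (by fun_prop))).clm_apply (by fun_prop)
    · exact Continuous.integrable_of_hasCompactSupport (by have := hu.continuous; fun_prop) hcu
  have h2 : ∀ s, ∫ t in Iio 0, fderiv ℝ u (sh (s, t)) (0, 1) = u (s, f s) := by
    intro s
    have hd : ∀ t, HasDerivAt (fun t => u (s, t + f s)) (fderiv ℝ u (sh (s, t)) (0, 1)) t :=
      fun t => (hud (sh (s, t))).comp_hasDerivAt t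
        ((hasDerivAt_const t s).prodMk ((hasDerivAt_id' t).add_const (f s)))
    have hcu : HasCompactSupport fun t => u (s, t + f s) := by
      refine HasCompactSupport.intro ((hc.isCompact.image sh.symm.continuous).image
        continuous_snd) fun t ht => image_eq_zero_of_notMem_tsupport fun h => ht ?_
      exact ⟨(s, t), ⟨_, h, sh.symm_apply_apply (s, t)⟩, rfl⟩
    have h := hcu.integral_Iic_deriv_eq (hu.comp (by fun_prop)) 0
    simp only [Function.comp_apply, zero_add] at h
    rw [← h, integral_Iic_eq_integral_Iio]
    exact integral_congr_ae (Filter.Eventually.of_forall fun t => (hd t).deriv.symm)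
  have i1 : IntegrableOn (fun q : ℝ × ℝ => a * fderiv ℝ u (sh q) (1, deriv f q.1))
      (univ ×ˢ Iio 0) := ((hcs _ (by fun_prop)).const_mul a).integrableOn
  have i2 : IntegrableOn (fun q : ℝ × ℝ => (b - deriv f q.1 * a) * fderiv ℝ u (sh q) (0, 1))
      (univ ×ˢ Iio 0) := by
    have := (hcs (fun q => (b - deriv f q.1 * a) • ((0, 1) : ℝ × ℝ)) (by fun_prop)).integrableOn
      (s := univ ×ˢ Iio 0)
    simpa only [map_smul, smul_eq_mul] using this
  -- The direction splits as `(a, b) = a (1, f') + (b - f' a) (0, 1)`; the tangential part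
  -- integrates to zero and the vertical part gives the boundary values.
  calc _ = ∫ q in univ ×ˢ Iio 0, (a * fderiv ℝ u (sh q) (1, deriv f q.1) +
        (b - deriv f q.1 * a) * fderiv ℝ u (sh q) (0, 1)) := by
        rw [e1]
        congr 1
        ext q
        rw [← smul_eq_mul, ← map_smul, ← smul_eq_mul, ← map_smul, ← map_add]
        congr 1
        ext <;> simp
        ring
    _ = 0 + ∫ s, (b - deriv f s * a) * u (s, f s) := by
        rw [integral_add i1 i2]
        congr 1
        · rw [Measure.volume_eq_prod, ← setIntegral_prod_swap, setIntegral_prod]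
          · refine integral_eq_zero_of_ae (Filter.Eventually.of_forall fun t => ?_)
            simp only [Prod.swap_prod_mk, Measure.restrict_univ, integral_const_mul, h1, mul_zero,
              Pi.zero_apply]
          · exact i1.swap
        · rw [Measure.volume_eq_prod, setIntegral_prod _ i2, Measure.restrict_univ]
          simp only [integral_const_mul, h2]
    _ = _ := by simp only [zero_add, mul_comm]

namespace GraphChart

variable {μ : ℝ≥0} {Ω : Set Plane} {p : Plane} (c : GraphChart μ Ω p)

/-- The Cartesian coordinates of the chart, as a map from the coordinates to the plane. -/
noncomputable def coordMap : (ℝ × ℝ) ≃L[ℝ] Plane :=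
  (ContinuousLinearEquiv.finTwoArrow ℝ ℝ).symm.trans
    ((PiLp.continuousLinearEquiv 2 ℝ (fun _ : Fin 2 => ℝ)).symm.trans
      c.R.symm.toContinuousLinearEquiv)

theorem coordMap_apply (q : ℝ × ℝ) : c.coordMap q = c.R.symm !₂[q.1, q.2] := rfl

theorem coordMap_coord (v : Plane) : c.coordMap ((c.R v) 0, (c.R v) 1) = v := by
  rw [coordMap_apply, LinearIsometryEquiv.symm_apply_eq]
  ext i
  fin_cases i <;> simp

theorem height_coordMap (q : ℝ × ℝ) : c.height (c.coordMap q) = q.2 - c.f q.1 := by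
  simp [height, coordMap_apply]

theorem measurePreserving_coordMap : MeasurePreserving c.coordMap volume volume :=
  c.R.symm.measurePreserving.comp ((PiLp.volume_preserving_toLp (Fin 2)).comp
    (volume_preserving_finTwoArrow ℝ).symm)

theorem measurableSet_height_eq : MeasurableSet {x | c.height x = 0} :=
  (isClosed_eq c.continuous_height continuous_const).measurableSet

/-- The divergence theorem in a chart. -/
theorem setIntegral_fderiv_eq (hΩ : IsOpen Ω) {u : Plane → ℝ} (hu : ContDiff ℝ 1 u)
    (hc : HasCompactSupport u) (hs : tsupport u ⊆ Metric.ball p c.r) (v : Plane) :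
    ∫ x in Ω, fderiv ℝ u x v = ∫ x, u x * inner ℝ v (outwardNormal Ω x) ∂(arcLength Ω) := by
  have hΩm : MeasurableSet Ω := hΩ.measurableSet
  have hneg : MeasurableSet {x | c.height x < 0} :=
    (isOpen_lt c.continuous_height continuous_const).measurableSet
  have hd0 : ∀ x ∉ Metric.ball p c.r, fderiv ℝ u x = 0 := fun x hx =>
    image_eq_zero_of_notMem_tsupport fun h => hx (hs (tsupport_fderiv_subset ℝ h))
  have hu0 : ∀ x ∉ Metric.ball p c.r, u x = 0 := fun x hx =>
    image_eq_zero_of_notMem_tsupport fun h => hx (hs h)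
  have hL : ∫ x in Ω, fderiv ℝ u x v = ∫ x in {x | c.height x < 0}, fderiv ℝ u x v := by
    rw [← integral_indicator hΩm, ← integral_indicator hneg]
    congr 1
    ext x
    by_cases hx : x ∈ Metric.ball p c.r
    · by_cases hxΩ : x ∈ Ω
      · rw [Set.indicator_of_mem hxΩ, Set.indicator_of_mem (show x ∈ {x | c.height x < 0} from
          (c.mem_iff hx).1 hxΩ)]
      · rw [Set.indicator_of_notMem hxΩ, Set.indicator_of_notMem
          (show x ∉ {x | c.height x < 0} from fun h => hxΩ ((c.mem_iff hx).2 h))]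
    · simp [Set.indicator_apply, hd0 x hx]
  have hR : ∫ x, u x * inner ℝ v (outwardNormal Ω x) ∂(arcLength Ω) =
      ∫ x in {x | c.height x = 0}, u x * inner ℝ v (c.normal x)
        ∂(Measure.hausdorffMeasure 1 : Measure Plane) := by
    rw [arcLength, ← integral_indicator isClosed_frontier.measurableSet,
      ← integral_indicator c.measurableSet_height_eq]
    congr 1
    ext x
    by_cases hx : x ∈ Metric.ball p c.r
    · by_cases hxΩ : x ∈ frontier Ω
      · rw [Set.indicator_of_mem hxΩ, Set.indicator_of_mem (show x ∈ {x | c.height x = 0} from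
          (c.mem_frontier_iff hΩ hx).1 hxΩ), c.outwardNormal_eq hΩ hx hxΩ]
      · rw [Set.indicator_of_notMem hxΩ, Set.indicator_of_notMem
          (show x ∉ {x | c.height x = 0} from fun h => hxΩ ((c.mem_frontier_iff hΩ hx).2 h))]
    · simp [Set.indicator_apply, hu0 x hx]
  rw [hL, hR, c.hausdorffMeasure_restrict_eq_map, c.measurableEmbedding_curve.integral_map,
    integral_withDensity_eq_integral_toReal_smul (by have := c.continuous_deriv; fun_prop)
      (Filter.Eventually.of_forall fun _ => ENNReal.ofReal_lt_top)]
  have h1 := c.measurePreserving_coordMap.setIntegral_preimage_emb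
    c.coordMap.toHomeomorph.measurableEmbedding (fun x => fderiv ℝ u x v) {x | c.height x < 0}
  rw [← h1]
  have h2 : ∀ q, fderiv ℝ u (c.coordMap q) v =
      fderiv ℝ (u ∘ c.coordMap) q ((c.R v) 0, (c.R v) 1) := by
    intro q
    rw [c.coordMap.comp_right_fderiv, ContinuousLinearMap.comp_apply,
      ContinuousLinearEquiv.coe_coe, c.coordMap_coord]
  have h3 : c.coordMap ⁻¹' {x | c.height x < 0} = {q | q.2 < c.f q.1} := by
    ext q
    simp [height_coordMap]
  simp only [h2]
  rw [h3, integral_subgraph_fderiv c.contDiff (hu.comp c.coordMap.contDiff)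
    (hc.comp_homeomorph c.coordMap.toHomeomorph)]
  congr 1
  ext s
  -- The density of arc length cancels the normalising factor of the unit normal.
  have hpos : 0 < √(1 + deriv c.f s ^ 2) := by positivity
  rw [inner_normal, coord_curve, ENNReal.toReal_ofReal hpos.le, smul_eq_mul]
  have : u (c.curve s) = (u ∘ c.coordMap) (s, c.f s) := rfl
  rw [this]
  field_simp

end GraphChart

/-- The integrand vanishes off `Ω`, so the integral extends to the whole plane, where integration by
parts against the constant 1 gives zero. -/
theorem setIntegral_fderiv_eq_zero_of_tsupport_subset {Ω : Set Plane} {u : Plane → ℝ}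
    (hu : ContDiff ℝ 1 u) (hc : HasCompactSupport u) (hs : tsupport u ⊆ Ω) (v : Plane) :
    ∫ x in Ω, fderiv ℝ u x v = 0 := by
  rw [setIntegral_eq_integral_of_forall_compl_eq_zero]
  · have h := integral_mul_fderiv_eq_neg_fderiv_mul_of_integrable (μ := volume)
      (f := fun _ : Plane => (1 : ℝ)) (g := u) (v := v) (by simp)
      (by
        simp only [one_mul]
        exact ((hu.continuous_fderiv one_ne_zero).clm_apply
          continuous_const).integrable_of_hasCompactSupport (hc.fderiv_apply (𝕜 := ℝ) v))
      (by simpa using hu.continuous.integrable_of_hasCompactSupport hc)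
      (fun x _ => differentiableAt_const _) (fun x _ => hu.differentiable one_ne_zero x)
    simpa using h
  · intro x hx
    rw [image_eq_zero_of_notMem_tsupport fun h => hx (hs (tsupport_fderiv_subset ℝ h))]
    rfl

namespace IsC1HolderDomain

variable {μ : ℝ≥0} {Ω : Set Plane}

theorem norm_outwardNormal (h : IsC1HolderDomain μ Ω) {x : Plane} (hx : x ∈ frontier Ω) :
    ‖outwardNormal Ω x‖ = 1 :=
  (h.isOutwardUnitNormal_outwardNormal hx).1

theorem ae_mem_frontier (Ω : Set Plane) : ∀ᵐ x ∂(arcLength Ω), x ∈ frontier Ω :=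
  ae_restrict_mem isClosed_frontier.measurableSet

theorem aestronglyMeasurable_outwardNormal (h : IsC1HolderDomain μ Ω) :
    AEStronglyMeasurable (outwardNormal Ω) (arcLength Ω) :=
  h.continuousOn_outwardNormal.aestronglyMeasurable isClosed_frontier.measurableSet

theorem integrable_mul_inner_outwardNormal (h : IsC1HolderDomain μ Ω)
    (hb : Bornology.IsBounded Ω) {u : Plane → ℝ} (hu : Continuous u) (v : Plane) :
    Integrable (fun x => u x * inner ℝ v (outwardNormal Ω x)) (arcLength Ω) := by
  have := h.isFiniteMeasure_arcLength hb
  obtain ⟨K, hK⟩ := (isCompact_frontier hb).exists_bound_of_continuousOn hu.continuousOn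
  refine Integrable.of_bound (hu.aestronglyMeasurable.mul
    (aestronglyMeasurable_const.inner h.aestronglyMeasurable_outwardNormal)) (K * ‖v‖) ?_
  filter_upwards [ae_mem_frontier Ω] with x hx
  rw [norm_mul]
  have h1 := norm_inner_le_norm (𝕜 := ℝ) v (outwardNormal Ω x)
  rw [h.norm_outwardNormal hx, mul_one] at h1
  exact mul_le_mul (hK x hx) h1 (norm_nonneg _) ((norm_nonneg _).trans (hK x hx))

open scoped Manifold ContDiff in
/-- The divergence theorem on a bounded domain of class `C^{1,μ}`. -/
theorem setIntegral_fderiv_eq (h : IsC1HolderDomain μ Ω) (hb : Bornology.IsBounded Ω)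
    {u : Plane → ℝ} (hu : ContDiff ℝ 1 u) (v : Plane) :
    ∫ x in Ω, fderiv ℝ u x v = ∫ x, u x * inner ℝ v (outwardNormal Ω x) ∂(arcLength Ω) := by
  have hcpt : IsCompact (closure Ω) := hb.isCompact_closure
  have hex : ∀ x ∈ closure Ω, ∃ ε > 0, ∀ w : Plane → ℝ, ContDiff ℝ 1 w → HasCompactSupport w →
      tsupport w ⊆ Metric.ball x ε → ∫ x in Ω, fderiv ℝ w x v =
        ∫ x, w x * inner ℝ v (outwardNormal Ω x) ∂(arcLength Ω) := by
    intro x hx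
    -- For an interior point a ball inside `Ω` makes both sides vanish; for a boundary point the
    -- ball of a chart is used.
    by_cases hxΩ : x ∈ Ω
    · obtain ⟨ε, hε, hs⟩ := Metric.isOpen_iff.1 h.isOpen x hxΩ
      refine ⟨ε, hε, fun w hw hwc hws => ?_⟩
      rw [setIntegral_fderiv_eq_zero_of_tsupport_subset hw hwc (hws.trans hs)]
      refine (integral_eq_zero_of_ae ?_).symm
      filter_upwards [ae_mem_frontier Ω] with y hy
      rw [image_eq_zero_of_notMem_tsupport (f := w), zero_mul, Pi.zero_apply]
      intro hyt
      rw [h.isOpen.frontier_eq] at hy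
      exact hy.2 (hs (hws hyt))
    · obtain ⟨c⟩ := h.nonempty_graphChart (p := x) (by rw [h.isOpen.frontier_eq]; exact ⟨hx, hxΩ⟩)
      exact ⟨c.r, c.r_pos, fun w hw hwc hws => c.setIntegral_fderiv_eq h.isOpen hw hwc hws v⟩
  choose! ε hε hball using hex
  obtain ⟨t, ht, hcov⟩ := hcpt.elim_nhds_subcover (fun x => Metric.ball x (ε x))
    (fun x hx => Metric.ball_mem_nhds x (hε x hx))
  obtain ⟨ρ, hρ⟩ := SmoothPartitionOfUnity.exists_isSubordinate 𝓘(ℝ, Plane) hcpt.isClosed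
    (fun i : t => Metric.ball (i : Plane) (ε i)) (fun _ => Metric.isOpen_ball)
    (fun x hx => by simpa using hcov hx)
  have hρd : ∀ i, ContDiff ℝ 1 (ρ i) := fun i =>
    (ρ i).contMDiff.contDiff.of_le (by exact_mod_cast le_top)
  have hsum : ∀ x ∈ closure Ω, ∑ i, ρ i x = 1 := by
    intro x hx
    rw [← ρ.sum_eq_one hx, finsum_eq_sum_of_fintype]
  have hcs : ∀ i, HasCompactSupport (ρ i) := fun i =>
    HasCompactSupport.of_support_subset_isCompact (isCompact_closedBall (i : Plane) (ε i))
      ((subset_tsupport _).trans ((hρ i).trans Metric.ball_subset_closedBall))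
  have hwd : ∀ i, ContDiff ℝ 1 (fun x => ρ i x * u x) := fun i => (hρd i).mul hu
  have hwc : ∀ i, HasCompactSupport (fun x => ρ i x * u x) := fun i => (hcs i).mul_right
  have hi := fun i : t => hball i (ht i i.2) _ (hwd i) (hwc i)
    ((tsupport_mul_subset_left (f := ρ i) (g := u)).trans (hρ i))
  have hL : ∫ x in Ω, fderiv ℝ u x v = ∑ i, ∫ x in Ω, fderiv ℝ (fun x => ρ i x * u x) x v := by
    rw [← integral_finsetSum]
    · refine setIntegral_congr_fun h.isOpen.measurableSet fun x hx => ?_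
      -- The partition sums to 1 on a whole neighbourhood of `x`, as `Ω` is open, so the identity
      -- may be differentiated.
      have he : u =ᶠ[nhds x] fun x => ∑ i, ρ i x * u x := by
        filter_upwards [h.isOpen.mem_nhds hx] with y hy
        rw [← Finset.sum_mul, hsum y (subset_closure hy), one_mul]
      rw [he.fderiv_eq, fderiv_fun_sum fun i _ => (hwd i).differentiable one_ne_zero x,
        sum_apply]
    · intro i _
      exact (((hwd i).continuous_fderiv one_ne_zero).clm_apply
          continuous_const).integrable_of_hasCompactSupport ((hwc i).fderiv_apply (𝕜 := ℝ) v)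
          |>.integrableOn
  have hR : ∫ x, u x * inner ℝ v (outwardNormal Ω x) ∂(arcLength Ω) =
      ∑ i, ∫ x, ρ i x * u x * inner ℝ v (outwardNormal Ω x) ∂(arcLength Ω) := by
    rw [← integral_finsetSum _ fun i _ =>
      h.integrable_mul_inner_outwardNormal hb (hwd i).continuous v]
    refine integral_congr_ae ?_
    filter_upwards [ae_mem_frontier Ω] with x hx
    rw [← Finset.sum_mul, ← Finset.sum_mul, hsum x (frontier_subset_closure hx), one_mul]
  rw [hL, hR]
  exact Finset.sum_congr rfl fun i _ => hi i

end IsC1HolderDomain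

/-! ### The Schur test and integral operators on `L²` -/

open scoped ENNReal in
/-- The Cauchy–Schwarz inequality with a weight. -/
theorem lintegral_mul_sq_le {α : Type*} [MeasurableSpace α] {τ : Measure α} {k f : α → ℝ≥0∞}
    (hk : AEMeasurable k τ) (hf : AEMeasurable f τ) :
    (∫⁻ y, k y * f y ∂τ) ^ (2 : ℝ) ≤ (∫⁻ y, k y ∂τ) * ∫⁻ y, k y * f y ^ (2 : ℝ) ∂τ := by
  have hh : ∀ t : ℝ≥0∞, (t ^ (1 / 2 : ℝ)) ^ (2 : ℝ) = t := fun t => by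
    rw [← ENNReal.rpow_mul]; norm_num
  have h2 : ∀ t : ℝ≥0∞, t ^ (1 / 2 : ℝ) * t ^ (1 / 2 : ℝ) = t := fun t => by
    rw [← ENNReal.rpow_add_of_nonneg _ _ (by norm_num) (by norm_num)]; norm_num
  -- Hölder's inequality with exponents 2 and 2, applied to the factors `k^(1/2)` and `k^(1/2) f`.
  have h := ENNReal.lintegral_mul_le_Lp_mul_Lq τ Real.HolderConjugate.two_two
    (hk.pow_const (1 / 2 : ℝ)) ((hk.pow_const (1 / 2 : ℝ)).mul hf)
  calc _ = (∫⁻ y, ((fun y => k y ^ (1 / 2 : ℝ)) * ((fun y => k y ^ (1 / 2 : ℝ)) * f)) y ∂τ)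
        ^ (2 : ℝ) := by
        congr 2
        ext y
        simp only [Pi.mul_apply, ← mul_assoc, h2]
    _ ≤ _ := ENNReal.rpow_le_rpow h (by norm_num)
    _ = _ := by
        rw [ENNReal.mul_rpow_of_nonneg _ _ (by norm_num), hh, hh]
        simp only [Pi.mul_apply, ENNReal.mul_rpow_of_nonneg _ _ (show (0 : ℝ) ≤ 2 by norm_num), hh]

/-- A real kernel whose rows and columns are uniformly integrable, as in the Schur test. -/
structure SchurKernel {α β : Type*} [MeasurableSpace α] [MeasurableSpace β] (σ : Measure α)
    (τ : Measure β) (k : α → β → ℝ) (M : ℝ≥0) : Prop where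
  measurable : Measurable (Function.uncurry k)
  left : ∀ᵐ x ∂σ, ∫⁻ y, ‖k x y‖ₑ ∂τ ≤ M
  right : ∀ᵐ y ∂τ, ∫⁻ x, ‖k x y‖ₑ ∂σ ≤ M

theorem MeasureTheory.MemLp.lintegral_enorm_sq_lt_top {β : Type*} [MeasurableSpace β]
    {τ : Measure β} {φ : β → ℂ} (hφ : MemLp φ 2 τ) :
    ∫⁻ y, ‖φ y‖ₑ ^ (2 : ℝ) ∂τ < ⊤ := by
  simpa using lintegral_rpow_enorm_lt_top_of_eLpNorm_lt_top two_ne_zero ENNReal.ofNat_ne_top hφ.2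

namespace SchurKernel

section

variable {α β : Type*} [MeasurableSpace α] [MeasurableSpace β] {σ : Measure α}
  {τ : Measure β} {k : α → β → ℝ} {M : ℝ≥0}

theorem swap (h : SchurKernel σ τ k M) : SchurKernel τ σ (fun y x => k x y) M :=
  ⟨h.measurable.comp measurable_swap, h.right, h.left⟩

theorem neg (h : SchurKernel σ τ k M) : SchurKernel σ τ (fun x y => -k x y) M :=
  ⟨h.measurable.neg, by simpa using h.left, by simpa using h.right⟩

theorem measurable_enorm (h : SchurKernel σ τ k M) :
    Measurable (Function.uncurry fun x y => ‖k x y‖ₑ) := h.measurable.enorm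

theorem aestronglyMeasurable_smul (h : SchurKernel σ τ k M) {φ : β → ℂ}
    (hφ : AEStronglyMeasurable φ τ) :
    AEStronglyMeasurable (fun p : α × β => k p.1 p.2 • φ p.2) (σ.prod τ) :=
  h.measurable.aestronglyMeasurable.smul hφ.comp_snd

variable [SFinite τ]

theorem aemeasurable_lintegral (h : SchurKernel σ τ k M) {φ : β → ℂ} (hφ : MemLp φ 2 τ) :
    AEMeasurable (fun x => ∫⁻ y, ‖k x y‖ₑ * ‖φ y‖ₑ ∂τ) σ :=
  AEMeasurable.lintegral_prod_right'
    (h.measurable_enorm.aemeasurable.mul hφ.1.comp_snd.enorm : AEMeasurable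
      (fun p : α × β => ‖k p.1 p.2‖ₑ * ‖φ p.2‖ₑ) (σ.prod τ))

variable [SFinite σ]

open scoped ENNReal in
/-- The Schur test for non-negative functions. -/
theorem lintegral_sq_le (h : SchurKernel σ τ k M) {f : β → ℝ≥0∞} (hf : AEMeasurable f τ) :
    ∫⁻ x, (∫⁻ y, ‖k x y‖ₑ * f y ∂τ) ^ (2 : ℝ) ∂σ ≤
      (M : ℝ≥0∞) ^ (2 : ℝ) * ∫⁻ y, f y ^ (2 : ℝ) ∂τ := by
  have hkx : ∀ x, Measurable fun y => ‖k x y‖ₑ := fun x =>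
    h.measurable_enorm.comp measurable_prodMk_left
  have hky : ∀ y, Measurable fun x => ‖k x y‖ₑ := fun y =>
    h.measurable_enorm.comp measurable_prodMk_right
  have hprod : AEMeasurable (Function.uncurry fun x y => ‖k x y‖ₑ * f y ^ (2 : ℝ))
      (σ.prod τ) :=
    h.measurable_enorm.aemeasurable.mul ((hf.comp_snd (μ := σ)).pow_const 2)
  -- Weighted Cauchy–Schwarz uses the row bound; after exchanging the integrals, the column bound
  -- gives the second factor `M`.
  calc _ ≤ ∫⁻ x, M * ∫⁻ y, ‖k x y‖ₑ * f y ^ (2 : ℝ) ∂τ ∂σ := by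
        refine lintegral_mono_ae ?_
        filter_upwards [h.left] with x hx
        exact (lintegral_mul_sq_le (hkx x).aemeasurable hf).trans (by gcongr)
    _ = M * ∫⁻ x, ∫⁻ y, ‖k x y‖ₑ * f y ^ (2 : ℝ) ∂τ ∂σ :=
        lintegral_const_mul' _ _ ENNReal.coe_ne_top
    _ = M * ∫⁻ y, (∫⁻ x, ‖k x y‖ₑ ∂σ) * f y ^ (2 : ℝ) ∂τ := by
        rw [lintegral_lintegral_swap hprod]
        congr 2
        ext y
        rw [lintegral_mul_const _ (hky y)]
    _ ≤ M * ∫⁻ y, M * f y ^ (2 : ℝ) ∂τ := by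
        gcongr 1
        refine lintegral_mono_ae ?_
        filter_upwards [h.right] with y hy
        gcongr
    _ = _ := by
        rw [lintegral_const_mul' _ _ ENNReal.coe_ne_top, ← mul_assoc, ENNReal.rpow_two, sq]

theorem lintegral_enorm_sq_lt_top' (h : SchurKernel σ τ k M) {φ : β → ℂ} (hφ : MemLp φ 2 τ) :
    ∫⁻ x, (∫⁻ y, ‖k x y‖ₑ * ‖φ y‖ₑ ∂τ) ^ (2 : ℝ) ∂σ < ⊤ :=
  (h.lintegral_sq_le hφ.1.enorm).trans_lt (ENNReal.mul_lt_top
    (ENNReal.rpow_lt_top_of_nonneg (by norm_num) ENNReal.coe_ne_top)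
    hφ.lintegral_enorm_sq_lt_top)

theorem ae_integrable (h : SchurKernel σ τ k M) {φ : β → ℂ} (hφ : MemLp φ 2 τ) :
    ∀ᵐ x ∂σ, Integrable (fun y => k x y • φ y) τ := by
  have h1 := ae_lt_top' ((h.aemeasurable_lintegral hφ).pow_const (2 : ℝ))
    (h.lintegral_enorm_sq_lt_top' hφ).ne
  filter_upwards [h1] with x hx
  refine ⟨(h.measurable.comp measurable_prodMk_left).aestronglyMeasurable.smul hφ.1, ?_⟩
  rw [hasFiniteIntegral_iff_enorm]
  simp only [enorm_smul]
  by_contra hc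
  rw [not_lt, top_le_iff] at hc
  rw [hc, ENNReal.top_rpow_of_pos (by norm_num)] at hx
  exact lt_irrefl _ hx

theorem eLpNorm_integral_le (h : SchurKernel σ τ k M) {φ : β → ℂ} (hφ : MemLp φ 2 τ) :
    eLpNorm (fun x => ∫ y, k x y • φ y ∂τ) 2 σ ≤ M * eLpNorm φ 2 τ := by
  rw [eLpNorm_eq_lintegral_rpow_enorm_toReal two_ne_zero ENNReal.ofNat_ne_top,
    eLpNorm_eq_lintegral_rpow_enorm_toReal two_ne_zero ENNReal.ofNat_ne_top]
  simp only [ENNReal.toReal_ofNat]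
  have h2 : ∀ t : ENNReal, (t ^ (2 : ℝ)) ^ (1 / 2 : ℝ) = t := fun t => by
    rw [← ENNReal.rpow_mul]; norm_num
  rw [← h2 (M : ENNReal), ← ENNReal.mul_rpow_of_nonneg _ _ (by norm_num)]
  refine ENNReal.rpow_le_rpow (le_trans (lintegral_mono fun x => ?_)
    (h.lintegral_sq_le hφ.1.enorm)) (by norm_num)
  refine ENNReal.rpow_le_rpow ((enorm_integral_le_lintegral_enorm _).trans_eq ?_) (by norm_num)
  simp only [enorm_smul]

theorem memLp_integral (h : SchurKernel σ τ k M) {φ : β → ℂ} (hφ : MemLp φ 2 τ) :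
    MemLp (fun x => ∫ y, k x y • φ y ∂τ) 2 σ :=
  ⟨(h.aestronglyMeasurable_smul hφ.1).integral_prod_right',
    (h.eLpNorm_integral_le hφ).trans_lt (ENNReal.mul_lt_top ENNReal.coe_lt_top hφ.2)⟩

/-- The integral operator with kernel `k` from `L²(τ)` to `L²(σ)`. -/
noncomputable def kernelOp (h : SchurKernel σ τ k M) : Lp ℂ 2 τ →L[ℂ] Lp ℂ 2 σ :=
  LinearMap.mkContinuous
    { toFun := fun φ => (h.memLp_integral (Lp.memLp φ)).toLp _
      map_add' := fun φ ψ => by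
        rw [← MemLp.toLp_add, MemLp.toLp_eq_toLp_iff]
        filter_upwards [h.ae_integrable (Lp.memLp φ), h.ae_integrable (Lp.memLp ψ)] with x h1 h2
        rw [Pi.add_apply, ← integral_add h1 h2]
        refine integral_congr_ae ?_
        filter_upwards [Lp.coeFn_add φ ψ] with y hy
        rw [hy, Pi.add_apply, smul_add]
      map_smul' := fun c φ => by
        rw [RingHom.id_apply, ← MemLp.toLp_const_smul, MemLp.toLp_eq_toLp_iff]
        refine Filter.Eventually.of_forall fun x => ?_
        rw [Pi.smul_apply, ← integral_smul]
        refine integral_congr_ae ?_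
        filter_upwards [Lp.coeFn_smul c φ] with y hy
        rw [hy, Pi.smul_apply, smul_comm] } M fun φ => by
    rw [LinearMap.coe_mk, AddHom.coe_mk, Lp.norm_toLp, Lp.norm_def, ← ENNReal.coe_toReal M,
      ← ENNReal.toReal_mul]
    exact ENNReal.toReal_mono (ENNReal.mul_ne_top ENNReal.coe_ne_top (Lp.eLpNorm_ne_top φ))
      (h.eLpNorm_integral_le (Lp.memLp φ))

theorem coeFn_kernelOp (h : SchurKernel σ τ k M) (φ : Lp ℂ 2 τ) :
    h.kernelOp φ =ᵐ[σ] fun x => ∫ y, k x y • φ y ∂τ :=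
  MemLp.coeFn_toLp (h.memLp_integral (Lp.memLp φ))

/-- Fubini, the kernel being real. Integrability on the product holds because `∫ |k| |φ|` is square
integrable by the Schur test and is paired with `|ψ|` by Cauchy–Schwarz. -/
theorem inner_kernelOp (h : SchurKernel σ τ k M) (φ : Lp ℂ 2 τ) (ψ : Lp ℂ 2 σ) :
    inner ℂ (h.kernelOp φ) ψ = inner ℂ φ (h.swap.kernelOp ψ) := by
  have hφ := Lp.memLp φ
  have hψ := Lp.memLp ψ
  have hint : Integrable (Function.uncurry fun x y => k x y • ((starRingEnd ℂ) (φ y) * ψ x))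
      (σ.prod τ) := by
    have hm : AEStronglyMeasurable
        (Function.uncurry fun x y => k x y • ((starRingEnd ℂ) (φ y) * ψ x)) (σ.prod τ) :=
      h.measurable.aestronglyMeasurable.smul
        ((Complex.continuous_conj.comp_aestronglyMeasurable hφ.1.comp_snd).mul hψ.1.comp_fst)
    refine ⟨hm, ?_⟩
    rw [hasFiniteIntegral_iff_enorm, lintegral_prod _ hm.enorm]
    have hle := ENNReal.lintegral_mul_le_Lp_mul_Lq σ Real.HolderConjugate.two_two
      (h.aemeasurable_lintegral hφ) hψ.1.enorm
    refine lt_of_le_of_lt (le_of_eq ?_) (hle.trans_lt (ENNReal.mul_lt_top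
      (ENNReal.rpow_lt_top_of_nonneg (by norm_num) (h.lintegral_enorm_sq_lt_top' hφ).ne)
      (ENNReal.rpow_lt_top_of_nonneg (by norm_num) hψ.lintegral_enorm_sq_lt_top.ne)))
    congr 1
    ext x
    rw [Pi.mul_apply, ← lintegral_mul_const' _ _ enorm_ne_top]
    simp only [Function.uncurry_apply_pair, enorm_smul, enorm_mul, RCLike.enorm_conj, mul_assoc]
  rw [L2.inner_def, L2.inner_def]
  calc _ = ∫ x, ∫ y, k x y • ((starRingEnd ℂ) (φ y) * ψ x) ∂τ ∂σ := by
        refine integral_congr_ae ?_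
        filter_upwards [h.coeFn_kernelOp φ] with x hx
        rw [hx, RCLike.inner_apply, ← integral_conj, ← integral_const_mul]
        congr 1
        ext y
        simp only [Complex.real_smul, map_mul, Complex.conj_ofReal]
        ring
    _ = ∫ y, ∫ x, k x y • ((starRingEnd ℂ) (φ y) * ψ x) ∂σ ∂τ := integral_integral_swap hint
    _ = _ := by
        refine integral_congr_ae ?_
        filter_upwards [h.swap.coeFn_kernelOp ψ] with y hy
        rw [hy, RCLike.inner_apply, ← integral_mul_const]
        congr 1
        ext x
        simp only [Complex.real_smul]
        ring

theorem adjoint_kernelOp (h : SchurKernel σ τ k M) :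
    ContinuousLinearMap.adjoint h.kernelOp = h.swap.kernelOp := by
  rw [eq_comm, ContinuousLinearMap.eq_adjoint_iff]
  intro ψ φ
  exact h.swap.inner_kernelOp ψ φ

end

variable {α β γ : Type*} [MeasurableSpace α] [MeasurableSpace β] [MeasurableSpace γ]
  {ρ : Measure α} {σ : Measure β} {τ : Measure γ} {k : α → β → ℝ} {l : β → γ → ℝ} {M N : ℝ≥0}
  [SFinite ρ] [SFinite σ] [IsFiniteMeasure τ]

/-- As `τ` is finite, `φ` is integrable. The column bounds of `l` and then of `k` make the triple
integral of `|k| |l| |φ|` finite, hence the inner double integral finite for almost every `x`. This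
licenses Fubini in a composition. -/
theorem ae_integrable_comp (h : SchurKernel ρ σ k M) (h' : SchurKernel σ τ l N) (φ : Lp ℂ 2 τ) :
    ∀ᵐ x ∂ρ, Integrable (fun p : β × γ => (k x p.1 * l p.1 p.2) • φ p.2) (σ.prod τ) := by
  have hφ := Lp.memLp φ
  have hkx : ∀ x, Measurable fun y => ‖k x y‖ₑ := fun x =>
    h.measurable_enorm.comp measurable_prodMk_left
  have hky : ∀ y, Measurable fun x => ‖k x y‖ₑ := fun y =>
    h.measurable_enorm.comp measurable_prodMk_right
  have hlz : ∀ z, Measurable fun y => ‖l y z‖ₑ := fun y =>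
    h'.measurable_enorm.comp measurable_prodMk_right
  set F : β → ENNReal := fun y => ∫⁻ z, ‖l y z‖ₑ * ‖φ z‖ₑ ∂τ
  have hF : AEMeasurable F σ := h'.aemeasurable_lintegral hφ
  have hFfin : ∫⁻ y, F y ∂σ < ⊤ := by
    have hm : AEMeasurable (Function.uncurry fun y z => ‖l y z‖ₑ * ‖φ z‖ₑ) (σ.prod τ) :=
      h'.measurable_enorm.aemeasurable.mul hφ.1.comp_snd.enorm
    calc ∫⁻ y, F y ∂σ = ∫⁻ z, (∫⁻ y, ‖l y z‖ₑ ∂σ) * ‖φ z‖ₑ ∂τ := by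
          rw [lintegral_lintegral_swap hm]
          congr 1
          ext z
          rw [lintegral_mul_const _ (hlz z)]
      _ ≤ ∫⁻ z, N * ‖φ z‖ₑ ∂τ := by
          refine lintegral_mono_ae ?_
          filter_upwards [h'.right] with z hz
          gcongr
      _ < ⊤ := by
          rw [lintegral_const_mul' _ _ ENNReal.coe_ne_top]
          exact ENNReal.mul_lt_top ENNReal.coe_lt_top
            (hasFiniteIntegral_iff_enorm.1 (hφ.integrable (by norm_num)).2)
  have hmk : AEMeasurable (Function.uncurry fun x y => ‖k x y‖ₑ * F y) (ρ.prod σ) :=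
    h.measurable_enorm.aemeasurable.mul hF.comp_snd
  have htot : ∫⁻ x, ∫⁻ y, ‖k x y‖ₑ * F y ∂σ ∂ρ < ⊤ := by
    calc _ = ∫⁻ y, (∫⁻ x, ‖k x y‖ₑ ∂ρ) * F y ∂σ := by
          rw [lintegral_lintegral_swap hmk]
          congr 1
          ext z
          rw [lintegral_mul_const _ (hky z)]
      _ ≤ ∫⁻ y, M * F y ∂σ := by
          refine lintegral_mono_ae ?_
          filter_upwards [h.right] with z hz
          gcongr
      _ < ⊤ := by
          rw [lintegral_const_mul' _ _ ENNReal.coe_ne_top]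
          exact ENNReal.mul_lt_top ENNReal.coe_lt_top hFfin
  filter_upwards [ae_lt_top' hmk.lintegral_prod_right' htot.ne] with x hx
  have hm : AEStronglyMeasurable (fun p : β × γ => (k x p.1 * l p.1 p.2) • φ p.2)
      (σ.prod τ) := by
    have h1 : Measurable fun p : β × γ => k x p.1 :=
      (h.measurable.comp measurable_prodMk_left).comp measurable_fst
    exact (h1.mul h'.measurable).aestronglyMeasurable.smul hφ.1.comp_snd
  refine ⟨hm, ?_⟩
  rw [hasFiniteIntegral_iff_enorm, lintegral_prod _ hm.enorm]
  refine lt_of_le_of_lt (le_of_eq ?_) hx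
  congr 1
  ext y
  simp only [Function.uncurry_apply_pair, F]
  rw [← lintegral_const_mul' _ _ enorm_ne_top]
  simp only [enorm_smul, enorm_mul, mul_assoc]

/-- The kernel of a composition of integral operators. -/
theorem coeFn_kernelOp_kernelOp (h : SchurKernel ρ σ k M) (h' : SchurKernel σ τ l N)
    (φ : Lp ℂ 2 τ) :
    ∀ᵐ x ∂ρ, Integrable (fun z => (∫ y, k x y * l y z ∂σ) • φ z) τ ∧
      h.kernelOp (h'.kernelOp φ) x = ∫ z, (∫ y, k x y * l y z ∂σ) • φ z ∂τ := by
  filter_upwards [h.coeFn_kernelOp (h'.kernelOp φ), h.ae_integrable_comp h' φ] with x hx hi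
  have he : ∀ z, ∫ y, (k x y * l y z) • φ z ∂σ = (∫ y, k x y * l y z ∂σ) • φ z := fun z =>
    integral_smul_const (fun y => k x y * l y z) (φ z)
  refine ⟨?_, ?_⟩
  · simpa only [he] using hi.integral_prod_right
  · rw [hx]
    simp only [← he]
    rw [← integral_integral_swap (f := fun y z => (k x y * l y z) • φ z) hi]
    refine integral_congr_ae ?_
    filter_upwards [h'.coeFn_kernelOp φ] with y hy
    rw [hy, ← integral_smul]
    simp only [smul_smul]

end SchurKernel

/-! ### Normal components of chords -/

/-- The uniform Hölder bound on the normal component of chords of the boundary. -/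
theorem IsC1HolderDomain.exists_abs_inner_outwardNormal_le {μ : ℝ≥0} {Ω K : Set Plane}
    (h : IsC1HolderDomain μ Ω) (hb : Bornology.IsBounded Ω) (hK : IsCompact K)
    (hloc : ∀ p ∈ frontier Ω, ∀ᶠ y in nhds p, y ∈ K → y ∈ frontier Ω) :
    ∃ C : ℝ≥0, ∀ y ∈ K, ∀ z ∈ frontier Ω,
      |inner ℝ (z - y) (outwardNormal Ω z)| ≤ C * ‖z - y‖ ^ (1 + μ : ℝ) := by
  suffices H : ∃ C : ℝ≥0, ∀ q ∈ K ×ˢ frontier Ω, q.1 ∈ K → q.2 ∈ frontier Ω →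
      |inner ℝ (q.2 - q.1) (outwardNormal Ω q.2)| ≤ C * ‖q.2 - q.1‖ ^ (1 + μ : ℝ) by
    obtain ⟨C, hC⟩ := H
    exact ⟨C, fun y hy z hz => hC (y, z) ⟨hy, hz⟩ hy hz⟩
  refine (hK.prod (isCompact_frontier hb)).induction_on
    (p := fun s => ∃ C : ℝ≥0, ∀ q ∈ s, q.1 ∈ K → q.2 ∈ frontier Ω →
      |inner ℝ (q.2 - q.1) (outwardNormal Ω q.2)| ≤ C * ‖q.2 - q.1‖ ^ (1 + μ : ℝ))
    ⟨0, by simp⟩ ?_ ?_ ?_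
  · rintro s t hst ⟨C, hC⟩
    exact ⟨C, fun q hq => hC q (hst hq)⟩
  · rintro s t ⟨C, hC⟩ ⟨B, hB⟩
    refine ⟨max C B, fun q hq h1 h2 => ?_⟩
    rcases hq with hq | hq
    · refine (hC q hq h1 h2).trans ?_
      gcongr
      exact le_max_left _ _
    · refine (hB q hq h1 h2).trans ?_
      gcongr
      exact le_max_right _ _
  · rintro ⟨p, q⟩ ⟨hp, hq⟩
    simp only at hp hq
    -- Near the diagonal both points lie on the graph of one chart. Away from it the distance stays
    -- above half of `‖q - p‖`, and Cauchy–Schwarz suffices with the constant `(‖q - p‖ / 2) ^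
    -- (-μ)`.
    rcases eq_or_ne p q with rfl | hpq
    · obtain ⟨c⟩ := h.nonempty_graphChart hq
      refine ⟨{y | (y ∈ K → y ∈ frontier Ω) ∧ y ∈ Metric.ball p c.r} ×ˢ Metric.ball p c.r,
        mem_nhdsWithin_of_mem_nhds (prod_mem_nhds
          ((hloc p hq).and (Metric.ball_mem_nhds p c.r_pos))
          (Metric.ball_mem_nhds p c.r_pos)), c.C, ?_⟩
      rintro ⟨y, z⟩ ⟨⟨hy1, hy2⟩, hz⟩ hyK hzΩ
      simp only at hy1 hy2 hz hyK hzΩ ⊢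
      have hy0 := (c.mem_frontier_iff h.isOpen hy2).1 (hy1 hyK)
      have hz0 := (c.mem_frontier_iff h.isOpen hz).1 hzΩ
      have := c.abs_inner_normal_le hy0 hz0
      rw [c.outwardNormal_eq h.isOpen hz hzΩ, norm_sub_rev, ← neg_sub y z, inner_neg_left, abs_neg]
      exact this
    · have hd : 0 < ‖q - p‖ / 2 := by
        have := norm_pos_iff.2 (sub_ne_zero.2 hpq.symm)
        positivity
      refine ⟨{w | ‖q - p‖ / 2 < ‖w.2 - w.1‖}, mem_nhdsWithin_of_mem_nhds
        ((isOpen_lt (by fun_prop) (by fun_prop)).mem_nhds ?_),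
        ((‖q - p‖ / 2) ^ (-μ : ℝ)).toNNReal, ?_⟩
      · simp only [Set.mem_ofPred_eq]
        linarith
      · rintro ⟨y, z⟩ hyz hyK hzΩ
        simp only [Set.mem_ofPred_eq] at hyz hyK hzΩ ⊢
        have hpos : 0 < ‖z - y‖ := hd.trans hyz
        rw [Real.coe_toNNReal _ (by positivity), Real.rpow_add hpos, Real.rpow_one, mul_left_comm,
          Real.rpow_neg hd.le]
        refine (abs_real_inner_le_norm _ _).trans ?_
        rw [h.norm_outwardNormal hzΩ]
        refine mul_le_mul_of_nonneg_left ?_ hpos.le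
        rw [inv_mul_eq_div, one_le_div (by positivity)]
        gcongr

/-! ### Green's identity for the regularised fundamental solution -/

/-- The fundamental solution regularised at scale `ε`. -/
noncomputable def regFundSol (ε : ℝ) (x : Plane) : ℝ :=
  1 / (4 * Real.pi) * Real.log (‖x‖ ^ 2 + ε ^ 2)

/-- The Laplacian of the regularised fundamental solution. -/
noncomputable def regDelta (ε : ℝ) (x : Plane) : ℝ :=
  1 / Real.pi * (ε ^ 2 / (‖x‖ ^ 2 + ε ^ 2) ^ 2)

/-- The normal derivative of the regularised fundamental solution with singularity `y`. -/
noncomputable def regNpKernel (ε : ℝ) (Ω : Set Plane) (y z : Plane) : ℝ :=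
  1 / (2 * Real.pi) * (inner ℝ (z - y) (outwardNormal Ω z) / (‖z - y‖ ^ 2 + ε ^ 2))

section Regularised

variable {ε : ℝ}

theorem norm_sq_add_sq_pos (hε : 0 < ε) (x : Plane) : 0 < ‖x‖ ^ 2 + ε ^ 2 := by positivity

theorem contDiff_norm_sub_sq_add (ε : ℝ) (x : Plane) {n : WithTop ℕ∞} :
    ContDiff ℝ n fun z : Plane => ‖z - x‖ ^ 2 + ε ^ 2 :=
  ((contDiff_id.sub contDiff_const).norm_sq ℝ).add contDiff_const

theorem contDiff_regFundSol_sub (hε : 0 < ε) (x : Plane) {n : WithTop ℕ∞} :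
    ContDiff ℝ n fun z => regFundSol ε (z - x) :=
  contDiff_const.mul ((contDiff_norm_sub_sq_add ε x).log fun z =>
    (norm_sq_add_sq_pos hε (z - x)).ne')

theorem hasFDerivAt_norm_sub_sq_add (ε : ℝ) (x z : Plane) :
    HasFDerivAt (fun z : Plane => ‖z - x‖ ^ 2 + ε ^ 2) (2 • innerSL ℝ (z - x)) z := by
  have h := ((hasFDerivAt_id z).sub_const x).norm_sq.add_const (ε ^ 2)
  simpa using h

/-- Requiring only a nonzero denominator includes `ε = 0` away from the pole, which later yields the
gradient of `fundSol`. -/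
theorem hasFDerivAt_regFundSol_sub {x z : Plane} (hq : ‖z - x‖ ^ 2 + ε ^ 2 ≠ 0) :
    HasFDerivAt (fun z => regFundSol ε (z - x))
      ((1 / (2 * Real.pi) / (‖z - x‖ ^ 2 + ε ^ 2)) • innerSL ℝ (z - x)) z := by
  have h := ((hasFDerivAt_norm_sub_sq_add ε x z).log hq).const_mul (1 / (4 * Real.pi))
  refine (h : HasFDerivAt (fun z => regFundSol ε (z - x)) _ z).congr_fderiv ?_
  ext v
  simp only [smul_apply, innerSL_apply_apply, smul_eq_mul, nsmul_eq_mul, Nat.cast_ofNat]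
  field_simp
  ring

theorem fderiv_regFundSol_sub (hε : 0 < ε) (x z v : Plane) :
    fderiv ℝ (fun z => regFundSol ε (z - x)) z v =
      1 / (2 * Real.pi) * (inner ℝ (z - x) v / (‖z - x‖ ^ 2 + ε ^ 2)) := by
  rw [(hasFDerivAt_regFundSol_sub (norm_sq_add_sq_pos hε (z - x)).ne').fderiv, smul_apply,
    innerSL_apply_apply, smul_eq_mul]
  ring

/-- The partial derivative of the regularised fundamental solution in the direction `v`. -/
theorem contDiff_grad (hε : 0 < ε) (y v : Plane) {n : WithTop ℕ∞} :
    ContDiff ℝ n fun z : Plane => 1 / (2 * Real.pi) *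
      (inner ℝ (z - y) v / (‖z - y‖ ^ 2 + ε ^ 2)) :=
  contDiff_const.mul (((contDiff_id.sub contDiff_const).inner ℝ contDiff_const).div
    (contDiff_norm_sub_sq_add ε y) fun z => (norm_sq_add_sq_pos hε (z - y)).ne')

/-- The pure second derivative of the regularised solution; its sum over the two coordinate
directions is `regDelta`. -/
theorem fderiv_grad (hε : 0 < ε) (y v z : Plane) :
    fderiv ℝ (fun z : Plane => 1 / (2 * Real.pi) *
      (inner ℝ (z - y) v / (‖z - y‖ ^ 2 + ε ^ 2))) z v =
      1 / (2 * Real.pi) * ((inner ℝ v v * (‖z - y‖ ^ 2 + ε ^ 2) - 2 * inner ℝ (z - y) v ^ 2) /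
        (‖z - y‖ ^ 2 + ε ^ 2) ^ 2) := by
  have hq := (norm_sq_add_sq_pos hε (z - y)).ne'
  have h1 : HasFDerivAt (fun z : Plane => inner ℝ (z - y) v) (innerSL ℝ v) z := by
    have := ((innerSL ℝ v).hasFDerivAt (x := z)).sub_const (inner ℝ v y)
    refine this.congr_of_eventuallyEq (Filter.Eventually.of_forall fun z => ?_)
    simp [inner_sub_left, real_inner_comm]
  have h2 := (hasDerivAt_inv hq).comp_hasFDerivAt z (hasFDerivAt_norm_sub_sq_add ε y z)
  have h := (h1.mul h2).const_mul (1 / (2 * Real.pi))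
  have h' : HasFDerivAt (fun z : Plane => 1 / (2 * Real.pi) *
      (inner ℝ (z - y) v / (‖z - y‖ ^ 2 + ε ^ 2))) _ z := h
  rw [h'.fderiv]
  simp only [smul_apply, add_apply, innerSL_apply_apply, smul_eq_mul, nsmul_eq_mul,
    Nat.cast_ofNat, Function.comp_apply]
  field_simp
  ring

/-- Green's second identity for two regularised fundamental solutions. -/
theorem IsC1HolderDomain.green_regFundSol {μ : ℝ≥0} {Ω : Set Plane} (h : IsC1HolderDomain μ Ω)
    (hb : Bornology.IsBounded Ω) (hε : 0 < ε) (x y : Plane) :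
    ∫ z in Ω, (regFundSol ε (z - x) * regDelta ε (z - y) -
        regFundSol ε (z - y) * regDelta ε (z - x)) =
      ∫ z, (regFundSol ε (z - x) * regNpKernel ε Ω y z -
        regFundSol ε (z - y) * regNpKernel ε Ω x z) ∂(arcLength Ω) := by
  set e : Fin 2 → Plane := fun k => EuclideanSpace.single k 1 with he
  -- `U x y v` is the component along `v` of the field `G_ε(z - x) ∇G_ε(z - y)`.
  set U : Plane → Plane → Plane → Plane → ℝ := fun x y v z => regFundSol ε (z - x) *
    (1 / (2 * Real.pi) * (inner ℝ (z - y) v / (‖z - y‖ ^ 2 + ε ^ 2))) with hU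
  have hUd : ∀ x y v, ContDiff ℝ 1 (U x y v) := fun x y v =>
    (contDiff_regFundSol_sub hε x).mul (contDiff_grad hε y v)
  have hVd : ∀ v, ContDiff ℝ 1 (fun z => U x y v z - U y x v z) := fun v =>
    (hUd x y v).sub (hUd y x v)
  have hUf : ∀ x y v z, fderiv ℝ (U x y v) z v =
      regFundSol ε (z - x) * (1 / (2 * Real.pi) * ((inner ℝ v v * (‖z - y‖ ^ 2 + ε ^ 2) -
        2 * inner ℝ (z - y) v ^ 2) / (‖z - y‖ ^ 2 + ε ^ 2) ^ 2)) +
      (1 / (2 * Real.pi) * (inner ℝ (z - y) v / (‖z - y‖ ^ 2 + ε ^ 2))) *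
        (1 / (2 * Real.pi) * (inner ℝ (z - x) v / (‖z - x‖ ^ 2 + ε ^ 2))) := by
    intro x y v z
    simp only [hU]
    rw [fderiv_fun_mul ((contDiff_regFundSol_sub hε x (n := 1)).differentiable one_ne_zero z)
      ((contDiff_grad hε y v (n := 1)).differentiable one_ne_zero z)]
    simp only [add_apply, smul_apply, smul_eq_mul,
      fderiv_regFundSol_sub hε, fderiv_grad hε]
  have hinner : ∀ (w : Plane) k, inner ℝ w (e k) = w k := fun w k => by
    simp [he, PiLp.inner_apply]
  have hee : ∀ k, (e k) k = 1 := fun k => by simp [he]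
  have hint : ∀ v, IntegrableOn (fun z => fderiv ℝ (fun z => U x y v z - U y x v z) z v) Ω :=
    fun v => (((hVd v).continuous_fderiv one_ne_zero).clm_apply
      continuous_const).continuousOn.integrableOn_compact hb.isCompact_closure |>.mono_set
        subset_closure
  -- In the divergence of `U x y - U y x` the products of first derivatives are symmetric in `x` and
  -- `y` and cancel; only the Laplacians remain.
  have hpt : ∀ z, regFundSol ε (z - x) * regDelta ε (z - y) -
      regFundSol ε (z - y) * regDelta ε (z - x) =
      ∑ k, fderiv ℝ (fun z => U x y (e k) z - U y x (e k) z) z (e k) := by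
    intro z
    have hs : ∀ v, fderiv ℝ (fun z => U x y v z - U y x v z) z v =
        fderiv ℝ (U x y v) z v - fderiv ℝ (U y x v) z v := fun v => by
      rw [fderiv_fun_sub ((hUd x y v).differentiable one_ne_zero z)
        ((hUd y x v).differentiable one_ne_zero z), sub_apply]
    simp only [Fin.sum_univ_two, hs, hUf, hinner, hee, regDelta]
    have key : ∀ w : Plane, ε ^ 2 = ((1 * (‖w‖ ^ 2 + ε ^ 2) - 2 * (w 0) ^ 2) +
        (1 * (‖w‖ ^ 2 + ε ^ 2) - 2 * (w 1) ^ 2)) / 2 := fun w => by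
      rw [Plane.norm_sq_eq]; ring
    have hΔ : ∀ w : Plane, 1 / Real.pi * (ε ^ 2 / (‖w‖ ^ 2 + ε ^ 2) ^ 2) =
        1 / (2 * Real.pi) * ((1 * (‖w‖ ^ 2 + ε ^ 2) - 2 * (w 0) ^ 2) / (‖w‖ ^ 2 + ε ^ 2) ^ 2) +
        1 / (2 * Real.pi) * ((1 * (‖w‖ ^ 2 + ε ^ 2) - 2 * (w 1) ^ 2) / (‖w‖ ^ 2 + ε ^ 2) ^ 2) := by
      intro w
      have hq := (norm_sq_add_sq_pos hε w).ne'
      rw [← mul_add, ← add_div]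
      nth_rewrite 1 [key w]
      field_simp
    rw [hΔ, hΔ]
    ring
  have hbd : ∀ z, regFundSol ε (z - x) * regNpKernel ε Ω y z -
      regFundSol ε (z - y) * regNpKernel ε Ω x z =
      ∑ k, (U x y (e k) z - U y x (e k) z) * inner ℝ (e k) (outwardNormal Ω z) := by
    intro z
    simp only [Fin.sum_univ_two, hU, regNpKernel, real_inner_comm _ (e _), hinner]
    rw [Plane.inner_eq, Plane.inner_eq]
    ring
  simp only [hpt, hbd]
  rw [integral_finsetSum _ fun k _ => hint (e k), integral_finsetSum _ fun k _ =>
    h.integrable_mul_inner_outwardNormal hb (hVd (e k)).continuous (e k)]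
  exact Finset.sum_congr rfl fun k _ => h.setIntegral_fderiv_eq hb (hVd (e k)) (e k)

end Regularised

/-! ### Half a Dirac mass at a boundary point -/

theorem continuous_regDelta_one : Continuous (regDelta 1) := by
  unfold regDelta
  refine continuous_const.mul (continuous_const.div (by fun_prop) fun x => ?_)
  positivity

theorem regDelta_one_eq (w : Plane) :
    regDelta 1 w = 1 / Real.pi * (1 + ‖w‖ ^ 2) ^ (-(4 : ℝ) / 2) := by
  rw [regDelta, show (-(4 : ℝ) / 2) = -(2 : ℕ) by norm_num, Real.rpow_neg (by positivity),
    Real.rpow_natCast, one_pow, add_comm (‖w‖ ^ 2), one_div (_ ^ 2)]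

theorem integrable_regDelta_one : Integrable (regDelta 1) := by
  have h : Integrable (fun w : Plane => 1 / Real.pi * (1 + ‖w‖ ^ 2) ^ (-(4 : ℝ) / 2)) :=
    (integrable_rpow_neg_one_add_norm_sq (by simp; norm_num)).const_mul _
  exact h.congr (Filter.Eventually.of_forall fun w => (regDelta_one_eq w).symm)

/-- Linear growth costs one power of the decay `|w| ^ (-4)`, and `|w| ^ (-3)` is still integrable at
infinity in the plane. It serves as the majorant for the logarithm after rescaling. -/
theorem integrable_add_mul_norm_mul_regDelta_one (A B : ℝ) :
    Integrable (fun w : Plane => (A + B * ‖w‖) * regDelta 1 w) := by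
  have h : Integrable (fun w : Plane => (1 + ‖w‖ ^ 2) ^ (-(3 : ℝ) / 2)) :=
    integrable_rpow_neg_one_add_norm_sq (by simp; norm_num)
  refine (h.const_mul ((|A| + |B|) * (1 / Real.pi))).mono'
    ((by fun_prop : Continuous fun w : Plane => A + B * ‖w‖).mul
      continuous_regDelta_one).aestronglyMeasurable (Filter.Eventually.of_forall fun w => ?_)
  set q := 1 + ‖w‖ ^ 2 with hq
  have hq1 : 1 ≤ q := by rw [hq]; nlinarith [sq_nonneg ‖w‖]
  have hs1 : 1 ≤ q ^ (1 / 2 : ℝ) := Real.one_le_rpow hq1 (by norm_num)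
  have hs2 : ‖w‖ ≤ q ^ (1 / 2 : ℝ) := by
    rw [← Real.sqrt_eq_rpow]
    exact Real.le_sqrt_of_sq_le (by rw [hq]; linarith)
  have hAB : |A + B * ‖w‖| ≤ (|A| + |B|) * q ^ (1 / 2 : ℝ) := by
    refine (abs_add_le _ _).trans ?_
    rw [abs_mul, abs_of_nonneg (norm_nonneg w), add_mul]
    exact add_le_add (le_mul_of_one_le_right (abs_nonneg _) hs1)
      (mul_le_mul_of_nonneg_left hs2 (abs_nonneg _))
  have hsplit : q ^ (-(3 : ℝ) / 2) = q ^ (1 / 2 : ℝ) * q ^ (-(4 : ℝ) / 2) := by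
    rw [← Real.rpow_add (by linarith)]; norm_num
  rw [regDelta_one_eq, norm_mul, Real.norm_eq_abs, Real.norm_of_nonneg (by positivity), ← hq,
    hsplit]
  calc _ ≤ (|A| + |B|) * q ^ (1 / 2 : ℝ) * (1 / Real.pi * q ^ (-(4 : ℝ) / 2)) := by gcongr
    _ = _ := by ring

/-- The line orthogonal to `n` is a proper subspace, hence null. Tangency gives no information about
directions in this line. -/
theorem ae_inner_ne_zero {n : Plane} (hn : n ≠ 0) : ∀ᵐ w : Plane, inner ℝ w n ≠ 0 := by
  have h : volume ((LinearMap.ker (innerSL ℝ n).toLinearMap : Submodule ℝ Plane) : Set Plane) = 0 := by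
    refine Measure.addHaar_submodule _ _ fun htop => ?_
    have : n ∈ LinearMap.ker (innerSL ℝ n).toLinearMap := by rw [htop]; trivial
    rw [LinearMap.mem_ker] at this
    exact hn (inner_self_eq_zero.1 this)
  filter_upwards [measure_eq_zero_iff_ae_notMem.1 h] with w hw h0
  refine hw ?_
  rw [SetLike.mem_coe, LinearMap.mem_ker]
  change inner ℝ n w = 0
  rwa [real_inner_comm]

/-- Each half plane carries half of the mass of `regDelta 1`. -/
theorem setIntegral_halfPlane_regDelta_one {n : Plane} (hn : n ≠ 0) :
    ∫ w in {w : Plane | inner ℝ w n < 0}, regDelta 1 w = 1 / 2 * ∫ w, regDelta 1 w := by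
  have hm : MeasurableSet {w : Plane | inner ℝ w n < 0} :=
    (isOpen_lt (by fun_prop) continuous_const).measurableSet
  have hm' : MeasurableSet {w : Plane | 0 < inner ℝ w n} :=
    (isOpen_lt continuous_const (by fun_prop)).measurableSet
  have h1 : ∫ w in {w : Plane | inner ℝ w n < 0}, regDelta 1 w =
      ∫ w in {w : Plane | 0 < inner ℝ w n}, regDelta 1 w := by
    rw [← integral_indicator hm, ← integral_indicator hm', ← integral_neg_eq_self]
    congr 1
    ext w
    simp [Set.indicator_apply, regDelta, inner_neg_left]
  have h2 : ∫ w, regDelta 1 w = (∫ w in {w : Plane | inner ℝ w n < 0}, regDelta 1 w) +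
      ∫ w in {w : Plane | inner ℝ w n < 0}ᶜ, regDelta 1 w :=
    (integral_add_compl hm integrable_regDelta_one).symm
  have h3 : ∫ w in {w : Plane | inner ℝ w n < 0}ᶜ, regDelta 1 w =
      ∫ w in {w : Plane | 0 < inner ℝ w n}, regDelta 1 w := by
    refine setIntegral_congr_set ?_
    filter_upwards [ae_inner_ne_zero hn] with w hw
    refine propext ⟨fun h => ?_, fun h => ?_⟩
    · exact lt_of_le_of_ne (not_lt.1 h) (Ne.symm hw)
    · exact not_lt.2 (le_of_lt h)
  rw [h2, h3, ← h1]
  ring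

theorem regDelta_smul {ε : ℝ} (hε : 0 < ε) (w : Plane) :
    regDelta ε (ε • w) = (ε ^ 2)⁻¹ * regDelta 1 w := by
  rw [regDelta, regDelta, norm_smul, Real.norm_eq_abs, abs_of_pos hε]
  field_simp

open Filter Topology in
/-- Against a set with a tangent half plane at `y`, the Laplacian of the regularised fundamental
solution with singularity `y` acts like half a Dirac mass. -/
theorem tendsto_setIntegral_regFundSol_mul_regDelta {E : Set Plane} (hE : MeasurableSet E)
    (hb : Bornology.IsBounded E) {x y n : Plane} (hxy : x ≠ y) (hn : n ≠ 0)
    (hin : ∀ v, inner ℝ v n < 0 → ∀ᶠ t : ℝ in 𝓝[>] 0, y + t • v ∈ E)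
    (hout : ∀ v, 0 < inner ℝ v n → ∀ᶠ t : ℝ in 𝓝[>] 0, y + t • v ∉ E) :
    Tendsto (fun ε => ∫ z in E, regFundSol ε (z - x) * regDelta ε (z - y)) (𝓝[>] 0)
      (𝓝 (fundSol (y - x) * (1 / 2 * ∫ w, regDelta 1 w))) := by
  obtain ⟨R, hR⟩ : ∃ R : ℝ, ∀ z ∈ E, ‖z - x‖ ≤ R := by
    obtain ⟨R, hR⟩ := hb.subset_closedBall x
    exact ⟨R, fun z hz => by simpa [dist_eq_norm] using hR hz⟩
  set d := ‖y - x‖ with hd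
  have hdpos : 0 < d := norm_pos_iff.2 (sub_ne_zero.2 hxy.symm)
  -- Substitution `z = y + ε w`: the Jacobian `ε ^ 2` cancels the scaling factor of `regDelta`.
  have hrew : ∀ ε ∈ Set.Ioi (0 : ℝ), ∫ z in E, regFundSol ε (z - x) * regDelta ε (z - y) =
      ∫ w, E.indicator (fun z => regFundSol ε (z - x)) (y + ε • w) * regDelta 1 w := by
    intro ε hε
    rw [Set.mem_Ioi] at hε
    rw [← integral_indicator hE, ← integral_add_left_eq_self _ y]
    have h := Measure.integral_comp_smul volume (fun w =>
      E.indicator (fun z => regFundSol ε (z - x) * regDelta ε (z - y)) (y + w)) ε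
    rw [finrank_euclideanSpace_fin, abs_of_pos (by positivity), smul_eq_mul,
      inv_mul_eq_div, eq_div_iff (by positivity), mul_comm] at h
    rw [← h, ← integral_const_mul]
    congr 1
    ext w
    by_cases hw : y + ε • w ∈ E
    · rw [Set.indicator_of_mem hw, Set.indicator_of_mem hw, add_sub_cancel_left, regDelta_smul hε]
      field_simp
    · rw [Set.indicator_of_notMem hw, Set.indicator_of_notMem hw]
      simp
  have hlim : fundSol (y - x) * (1 / 2 * ∫ w, regDelta 1 w) =
      ∫ w, {w : Plane | inner ℝ w n < 0}.indicator (fun _ => fundSol (y - x)) w *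
        regDelta 1 w := by
    rw [← setIntegral_halfPlane_regDelta_one hn, ← integral_const_mul,
      ← integral_indicator (isOpen_lt (by fun_prop) continuous_const).measurableSet]
    congr 1
    ext w
    by_cases hw : w ∈ {w : Plane | inner ℝ w n < 0}
    · rw [Set.indicator_of_mem hw, Set.indicator_of_mem hw]
    · rw [Set.indicator_of_notMem hw, Set.indicator_of_notMem hw, zero_mul]
  rw [hlim, tendsto_congr' (eventually_nhdsWithin_of_forall hrew)]
  set A := |Real.log (R ^ 2 + 1)| + 2 * |Real.log d| with hA
  have hlogbound : ∀ ε : ℝ, 0 < ε → ε < 1 → ∀ w : Plane, y + ε • w ∈ E →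
      |Real.log (‖y + ε • w - x‖ ^ 2 + ε ^ 2)| ≤ A + 2 * ‖w‖ := by
    intro ε hε hε1 w hw
    set q := ‖y + ε • w - x‖ ^ 2 + ε ^ 2 with hq
    have hqpos : 0 < q := norm_sq_add_sq_pos hε _
    have hup : q ≤ R ^ 2 + 1 := by
      have h1 := hR _ hw
      have h2 := norm_nonneg (y + ε • w - x)
      rw [hq]
      nlinarith
    -- Both `‖y + ε • w - x‖` and `ε` are at most `√q`. With `log (1 + ‖w‖) ≤ ‖w‖` this bounds `log
    -- q` below by `2 log d - 2 ‖w‖`, uniformly in `ε`, although the rescaled point may come close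
    -- to `x`.
    have hlow : d ≤ √q * (1 + ‖w‖) := by
      have h1 : d ≤ ‖y + ε • w - x‖ + ε * ‖w‖ := by
        have : y - x = (y + ε • w - x) - ε • w := by abel
        rw [hd, this]
        refine (norm_sub_le _ _).trans_eq ?_
        rw [norm_smul, Real.norm_eq_abs, abs_of_pos hε]
      have h2 : ‖y + ε • w - x‖ ≤ √q := Real.le_sqrt_of_sq_le (by rw [hq]; nlinarith)
      have h3 : ε ≤ √q := Real.le_sqrt_of_sq_le (by rw [hq]; nlinarith [sq_nonneg ‖y + ε • w - x‖])
      nlinarith [norm_nonneg w]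
    have hlog2 : Real.log d ≤ Real.log q / 2 + ‖w‖ := by
      have h1 := Real.log_le_log hdpos hlow
      rw [Real.log_mul (by positivity) (by positivity), Real.log_sqrt hqpos.le] at h1
      have h2 := Real.log_le_sub_one_of_pos (show 0 < 1 + ‖w‖ by positivity)
      linarith
    have hlog1 : Real.log q ≤ Real.log (R ^ 2 + 1) := Real.log_le_log hqpos hup
    rw [abs_le]
    constructor
    · linarith [neg_abs_le (Real.log d), abs_nonneg (Real.log (R ^ 2 + 1))]
    · linarith [le_abs_self (Real.log (R ^ 2 + 1)), abs_nonneg (Real.log d), norm_nonneg w]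
  have hev : ∀ᶠ ε : ℝ in 𝓝[>] 0, 0 < ε ∧ ε < 1 := Ioo_mem_nhdsGT zero_lt_one
  refine tendsto_integral_filter_of_dominated_convergence
    (fun w => (1 / (4 * Real.pi) * A + 1 / (4 * Real.pi) * 2 * ‖w‖) * regDelta 1 w) ?_ ?_
    (integrable_add_mul_norm_mul_regDelta_one _ _) ?_
  · filter_upwards [hev] with ε hε
    refine AEStronglyMeasurable.mul ?_ continuous_regDelta_one.aestronglyMeasurable
    have hm : Measurable (E.indicator fun z => regFundSol ε (z - x)) :=
      (contDiff_regFundSol_sub hε.1 x (n := 0)).continuous.measurable.indicator hE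
    exact (hm.comp (by fun_prop : Measurable fun w : Plane => y + ε • w)).aestronglyMeasurable
  · filter_upwards [hev] with ε hε
    refine Eventually.of_forall fun w => ?_
    have h0 : 0 ≤ regDelta 1 w := by rw [regDelta]; positivity
    have hAn : 0 ≤ A := by positivity
    rw [norm_mul, Real.norm_of_nonneg h0]
    refine mul_le_mul_of_nonneg_right ?_ h0
    by_cases hw : y + ε • w ∈ E
    · rw [Set.indicator_of_mem hw, regFundSol, norm_mul, Real.norm_of_nonneg (by positivity)]
      refine (mul_le_mul_of_nonneg_left (hlogbound ε hε.1 hε.2 w hw) (by positivity)).trans_eq ?_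
      ring
    · rw [Set.indicator_of_notMem hw, norm_zero]
      positivity
  · filter_upwards [ae_inner_ne_zero hn] with w hw
    refine Tendsto.mul_const _ ?_
    have ht : Tendsto (fun ε : ℝ => regFundSol ε (y + ε • w - x)) (𝓝[>] 0)
        (𝓝 (fundSol (y - x))) := by
      have hq : Tendsto (fun ε : ℝ => ‖y + ε • w - x‖ ^ 2 + ε ^ 2) (𝓝[>] 0) (𝓝 (d ^ 2)) := by
        have h : Continuous (fun ε : ℝ => ‖y + ε • w - x‖ ^ 2 + ε ^ 2) := by fun_prop
        simpa [hd] using (h.tendsto 0).mono_left nhdsWithin_le_nhds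
      have h := ((Real.continuousAt_log (by positivity : d ^ 2 ≠ 0)).tendsto.comp hq).const_mul
        (1 / (4 * Real.pi))
      have he : fundSol (y - x) = 1 / (4 * Real.pi) * Real.log (d ^ 2) := by
        rw [fundSol, Real.log_pow, ← hd]
        push_cast
        field_simp
        ring
      rw [he]
      exact h
    -- Along a fixed direction `w` the point `y + ε • w` is eventually in `E` or eventually outside
    -- it, so the indicators converge to that of the half plane.
    rcases lt_or_gt_of_ne hw with h | h
    · rw [Set.indicator_of_mem (show w ∈ {w : Plane | inner ℝ w n < 0} from h)]
      refine ht.congr' ?_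
      filter_upwards [hin w h] with ε hε
      rw [Set.indicator_of_mem hε]
    · rw [Set.indicator_of_notMem (show w ∉ {w : Plane | inner ℝ w n < 0} from not_lt.2 h.le)]
      refine tendsto_const_nhds.congr' ?_
      filter_upwards [hout w h] with ε hε
      rw [Set.indicator_of_notMem hε]

/-! ### Limits of the boundary integrals -/

theorem regFundSol_zero (w : Plane) : regFundSol 0 w = fundSol w := by
  rw [regFundSol, fundSol, zero_pow two_ne_zero, add_zero, Real.log_pow]
  push_cast
  field_simp
  ring

theorem regNpKernel_zero (Ω : Set Plane) (y z : Plane) :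
    regNpKernel 0 Ω y z = npKernel Ω y z := by
  rw [regNpKernel, npKernel, zero_pow two_ne_zero, add_zero, norm_sub_rev y z]

theorem fundSol_sub_comm (x y : Plane) : fundSol (x - y) = fundSol (y - x) := by
  rw [fundSol, fundSol, norm_sub_rev]

theorem measurable_fundSol : Measurable fundSol := by
  unfold fundSol
  fun_prop

/-- On bounded sets the regularised fundamental solutions are uniformly bounded by any negative
power of the distance to the singularity. -/
theorem exists_abs_regFundSol_le {R b : ℝ} (hb : 0 < b) :
    ∃ C : ℝ≥0, ∀ ε ∈ Set.Icc (0 : ℝ) 1, ∀ w : Plane, w ≠ 0 → ‖w‖ ≤ R →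
      |regFundSol ε w| ≤ C * ‖w‖ ^ (-b) := by
  set Q := R ^ 2 + 1 with hQ
  have hQ1 : 1 ≤ Q := by rw [hQ]; nlinarith [sq_nonneg R]
  have hQlog : 0 ≤ Real.log Q := Real.log_nonneg hQ1
  have hC : 0 ≤ 1 / (4 * Real.pi) * (Real.log Q * |R| ^ b + 2 / b) := by positivity
  refine ⟨(1 / (4 * Real.pi) * (Real.log Q * |R| ^ b + 2 / b)).toNNReal, fun ε hε w hw hwR => ?_⟩
  have hpos : 0 < ‖w‖ := norm_pos_iff.2 hw
  have hRpos : 0 < R := hpos.trans_le hwR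
  set q := ‖w‖ ^ 2 + ε ^ 2 with hq
  have hq1 : ‖w‖ ^ 2 ≤ q := by rw [hq]; nlinarith [sq_nonneg ε]
  have hq2 : q ≤ Q := by rw [hq, hQ]; nlinarith [hε.1, hε.2]
  have hqpos : 0 < q := by positivity
  have h1 : Real.log q ≤ Real.log Q := Real.log_le_log hqpos hq2
  have h2 : 2 * Real.log ‖w‖ ≤ Real.log q := by
    have := Real.log_le_log (by positivity) hq1
    rwa [Real.log_pow, Nat.cast_ofNat] at this
  have h3 : -Real.log ‖w‖ ≤ ‖w‖ ^ (-b) / b := by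
    rw [← Real.log_inv, Real.rpow_neg hpos.le, ← Real.inv_rpow hpos.le]
    exact Real.log_le_rpow_div (by positivity) hb
  have h4 : 1 ≤ |R| ^ b * ‖w‖ ^ (-b) := by
    rw [abs_of_pos hRpos, Real.rpow_neg hpos.le, ← div_eq_mul_inv, one_le_div (by positivity)]
    gcongr
  -- The logarithm is bounded above by a constant, which `h4` converts into a multiple of the
  -- negative power, and below through `-log t ≤ t ^ (-b) / b`.
  have h5 : 0 ≤ ‖w‖ ^ (-b) / b := by positivity
  have h6 : Real.log Q ≤ Real.log Q * (|R| ^ b * ‖w‖ ^ (-b)) :=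
    le_mul_of_one_le_right hQlog h4
  rw [regFundSol, abs_mul, abs_of_nonneg (by positivity), Real.coe_toNNReal _ hC, mul_assoc]
  refine mul_le_mul_of_nonneg_left ?_ (by positivity)
  have h7 : (Real.log Q * |R| ^ b + 2 / b) * ‖w‖ ^ (-b) =
      Real.log Q * (|R| ^ b * ‖w‖ ^ (-b)) + 2 * (‖w‖ ^ (-b) / b) := by ring
  rw [h7, abs_le]
  constructor <;> linarith

/-- Dropping `ε ^ 2` from the denominator leaves a bound uniform in `ε` and valid at `ε = 0`. For `z
= y` the kernel is zero. -/
theorem abs_regNpKernel_le {Ω : Set Plane} {y z : Plane} {C : ℝ≥0} {m : ℝ}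
    (h : |inner ℝ (z - y) (outwardNormal Ω z)| ≤ C * ‖z - y‖ ^ (1 + m)) (ε : ℝ) :
    |regNpKernel ε Ω y z| ≤ C * ‖z - y‖ ^ (-(1 - m)) := by
  rcases eq_or_ne z y with rfl | hzy
  · simp [regNpKernel]
    positivity
  · have hpos : 0 < ‖z - y‖ := norm_pos_iff.2 (sub_ne_zero.2 hzy)
    have h2 : 1 / (2 * Real.pi) ≤ 1 := by
      rw [div_le_one (by positivity)]
      linarith [Real.pi_gt_three]
    rw [regNpKernel, abs_mul, abs_of_nonneg (by positivity : 0 ≤ 1 / (2 * Real.pi)), abs_div,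
      abs_of_nonneg (by positivity : 0 ≤ ‖z - y‖ ^ 2 + ε ^ 2)]
    calc _ ≤ 1 * (C * ‖z - y‖ ^ (1 + m) / ‖z - y‖ ^ 2) := by
          gcongr
          nlinarith [sq_nonneg ε]
      _ = _ := by
          rw [one_mul, mul_div_assoc, ← Real.rpow_natCast, ← Real.rpow_sub hpos]
          norm_num
          left
          ring_nf

/-- Arc length has no atoms, so the poles of the kernels, where default values appear, can be
discarded. -/
instance nullSingletonClass_arcLength (Ω : Set Plane) : NullSingletonClass (arcLength Ω) := by
  have := Measure.nullSingletonClass_hausdorff Plane (d := 1) zero_lt_one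
  unfold arcLength
  infer_instance

theorem ae_arcLength_ne (Ω : Set Plane) (x : Plane) : ∀ᵐ z ∂(arcLength Ω), z ≠ x :=
  measure_eq_zero_iff_ae_notMem.1 (measure_singleton x)

/-- Replacing the larger base by the smaller one merges both powers, so two poles never produce a
singularity worse than the sum of the exponents. -/
theorem rpow_mul_rpow_le_add {s t a b : ℝ} (hs : 0 < s) (ht : 0 < t) (ha : 0 ≤ a) (hb : 0 ≤ b) :
    s ^ (-a) * t ^ (-b) ≤ s ^ (-(a + b)) + t ^ (-(a + b)) := by
  rcases le_total s t with h | h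
  · have : t ^ (-b) ≤ s ^ (-b) := Real.rpow_le_rpow_of_nonpos hs h (by linarith)
    calc _ ≤ s ^ (-a) * s ^ (-b) := by gcongr
      _ = s ^ (-(a + b)) := by rw [← Real.rpow_add hs]; ring_nf
      _ ≤ _ := le_add_of_nonneg_right (by positivity)
  · have : s ^ (-a) ≤ t ^ (-a) := Real.rpow_le_rpow_of_nonpos ht h (by linarith)
    calc _ ≤ t ^ (-a) * t ^ (-b) := by gcongr
      _ = t ^ (-(a + b)) := by rw [← Real.rpow_add ht]; ring_nf
      _ ≤ _ := le_add_of_nonneg_left (by positivity)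

namespace IsC1HolderDomain

variable {μ : ℝ≥0} {Ω : Set Plane}

theorem integrable_norm_sub_rpow (h : IsC1HolderDomain μ Ω) (hb : Bornology.IsBounded Ω) {a : ℝ}
    (ha : 0 ≤ a) (ha1 : a < 1) (x : Plane) :
    Integrable (fun z => ‖z - x‖ ^ (-a)) (arcLength Ω) := by
  obtain ⟨M, hM⟩ := h.exists_lintegral_norm_sub_rpow_le hb ha ha1
  refine ⟨(by fun_prop : Measurable fun z : Plane => ‖z - x‖ ^ (-a)).aestronglyMeasurable, ?_⟩
  rw [hasFiniteIntegral_iff_ofReal (Filter.Eventually.of_forall fun z => by positivity)]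
  simp only [norm_sub_rev _ x]
  exact (hM x).trans_lt ENNReal.coe_lt_top

theorem aestronglyMeasurable_regNpKernel (h : IsC1HolderDomain μ Ω) (ε : ℝ) (y : Plane) :
    AEStronglyMeasurable (regNpKernel ε Ω y) (arcLength Ω) := by
  have h1 : AEStronglyMeasurable (fun z => inner ℝ (z - y) (outwardNormal Ω z)) (arcLength Ω) :=
    (by fun_prop : Continuous fun z : Plane => z - y).aestronglyMeasurable.inner
      h.aestronglyMeasurable_outwardNormal
  have h2 : AEStronglyMeasurable (fun z : Plane => (‖z - y‖ ^ 2 + ε ^ 2)⁻¹) (arcLength Ω) :=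
    (by fun_prop : Measurable fun z : Plane => (‖z - y‖ ^ 2 + ε ^ 2)⁻¹).aestronglyMeasurable
  exact (h1.mul h2).const_mul (1 / (2 * Real.pi))

/-- The regularised layer integrals have an integrable majorant. -/
theorem exists_integrable_bound (h : IsC1HolderDomain μ Ω) (hb : Bornology.IsBounded Ω)
    (hμ0 : 0 < μ) (hμ1 : μ < 1) {x y : Plane} {C : ℝ≥0}
    (hC : ∀ z ∈ frontier Ω,
      |inner ℝ (z - y) (outwardNormal Ω z)| ≤ C * ‖z - y‖ ^ (1 + μ : ℝ)) :
    ∃ g : Plane → ℝ, Integrable g (arcLength Ω) ∧ ∀ ε ∈ Set.Icc (0 : ℝ) 1,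
      ∀ᵐ z ∂(arcLength Ω), ‖regFundSol ε (z - x) * regNpKernel ε Ω y z‖ ≤ g z := by
  have hm0 : (0 : ℝ) < μ := hμ0
  have hm1 : (μ : ℝ) < 1 := hμ1
  obtain ⟨R, hR⟩ : ∃ R : ℝ, ∀ z ∈ frontier Ω, ‖z - x‖ ≤ R := by
    obtain ⟨R, hR⟩ := (isCompact_frontier hb).isBounded.subset_closedBall x
    exact ⟨R, fun z hz => by simpa [dist_eq_norm] using hR hz⟩
  -- The logarithm is charged the exponent `μ / 2`; with `1 - μ` from the other factor the total is
  -- `1 - μ / 2 < 1`.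
  obtain ⟨B, hB⟩ := exists_abs_regFundSol_le (R := R) (half_pos hm0)
  refine ⟨fun z => B * C * (‖z - x‖ ^ (-((μ / 2 : ℝ) + (1 - μ))) +
    ‖z - y‖ ^ (-((μ / 2 : ℝ) + (1 - μ)))), ((h.integrable_norm_sub_rpow hb (by linarith)
      (by linarith) x).add (h.integrable_norm_sub_rpow hb (by linarith)
      (by linarith) y)).const_mul _, fun ε hε => ?_⟩
  filter_upwards [ae_mem_frontier Ω, ae_arcLength_ne Ω x, ae_arcLength_ne Ω y] with z hz hzx hzy
  have hx : 0 < ‖z - x‖ := norm_pos_iff.2 (sub_ne_zero.2 hzx)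
  have hy : 0 < ‖z - y‖ := norm_pos_iff.2 (sub_ne_zero.2 hzy)
  rw [norm_mul, Real.norm_eq_abs, Real.norm_eq_abs]
  calc _ ≤ (B * ‖z - x‖ ^ (-(μ / 2 : ℝ))) * (C * ‖z - y‖ ^ (-(1 - μ : ℝ))) :=
        mul_le_mul (hB ε hε _ (sub_ne_zero.2 hzx) (hR z hz)) (abs_regNpKernel_le (hC z hz) ε)
          (abs_nonneg _) (by positivity)
    _ = B * C * (‖z - x‖ ^ (-(μ / 2 : ℝ)) * ‖z - y‖ ^ (-(1 - μ : ℝ))) := by ring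
    _ ≤ _ := by
        gcongr
        exact rpow_mul_rpow_le_add hx hy (by linarith) (by linarith)

theorem aestronglyMeasurable_reg_mul (h : IsC1HolderDomain μ Ω) (ε : ℝ) (x y : Plane) :
    AEStronglyMeasurable (fun z => regFundSol ε (z - x) * regNpKernel ε Ω y z) (arcLength Ω) := by
  refine AEStronglyMeasurable.mul ?_ (h.aestronglyMeasurable_regNpKernel ε y)
  unfold regFundSol
  exact (by fun_prop : Measurable fun z : Plane =>
    1 / (4 * Real.pi) * Real.log (‖z - x‖ ^ 2 + ε ^ 2)).aestronglyMeasurable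

theorem integrable_reg_mul (h : IsC1HolderDomain μ Ω) (hb : Bornology.IsBounded Ω)
    (hμ0 : 0 < μ) (hμ1 : μ < 1) {x y : Plane} {C : ℝ≥0}
    (hC : ∀ z ∈ frontier Ω,
      |inner ℝ (z - y) (outwardNormal Ω z)| ≤ C * ‖z - y‖ ^ (1 + μ : ℝ)) {ε : ℝ}
    (hε : ε ∈ Set.Icc (0 : ℝ) 1) :
    Integrable (fun z => regFundSol ε (z - x) * regNpKernel ε Ω y z) (arcLength Ω) := by
  obtain ⟨g, hg, hle⟩ := h.exists_integrable_bound hb hμ0 hμ1 (x := x) hC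
  exact hg.mono' (h.aestronglyMeasurable_reg_mul ε x y) (hle ε hε)

-- Dominated convergence: away from the two poles the integrand is continuous in `ε` at 0, with the
-- unregularised product as its value there.
open Filter Topology in
theorem tendsto_integral_reg_mul (h : IsC1HolderDomain μ Ω) (hb : Bornology.IsBounded Ω)
    (hμ0 : 0 < μ) (hμ1 : μ < 1) {x y : Plane} {C : ℝ≥0}
    (hC : ∀ z ∈ frontier Ω,
      |inner ℝ (z - y) (outwardNormal Ω z)| ≤ C * ‖z - y‖ ^ (1 + μ : ℝ)) :
    Tendsto (fun ε => ∫ z, regFundSol ε (z - x) * regNpKernel ε Ω y z ∂(arcLength Ω)) (𝓝[>] 0)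
      (𝓝 (∫ z, fundSol (z - x) * npKernel Ω y z ∂(arcLength Ω))) := by
  obtain ⟨g, hg, hle⟩ := h.exists_integrable_bound hb hμ0 hμ1 (x := x) hC
  refine tendsto_integral_filter_of_dominated_convergence g
    (Eventually.of_forall fun ε => h.aestronglyMeasurable_reg_mul ε x y) ?_ hg ?_
  · filter_upwards [Ioo_mem_nhdsGT (zero_lt_one' ℝ)] with ε hε
    exact hle ε ⟨hε.1.le, hε.2.le⟩
  · filter_upwards [ae_arcLength_ne Ω x, ae_arcLength_ne Ω y] with z hzx hzy
    have hx : 0 < ‖z - x‖ := norm_pos_iff.2 (sub_ne_zero.2 hzx)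
    have hy : 0 < ‖z - y‖ := norm_pos_iff.2 (sub_ne_zero.2 hzy)
    rw [← regFundSol_zero, ← regNpKernel_zero]
    have hc : ContinuousAt (fun ε => regFundSol ε (z - x) * regNpKernel ε Ω y z) 0 := by
      unfold regFundSol regNpKernel
      refine ContinuousAt.mul (continuousAt_const.mul (ContinuousAt.log (by fun_prop) ?_))
        (continuousAt_const.mul (ContinuousAt.div₀ continuousAt_const (by fun_prop) ?_))
      · positivity
      · positivity
    exact hc.tendsto.mono_left nhdsWithin_le_nhds

end IsC1HolderDomain

/-! ### Symmetry of the kernels on the boundary of the shell -/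

section Pair

variable {μ : ℝ≥0} {D Ω : Set Plane}

theorem notMem_frontier_of_closure_subset (hΩ : IsOpen Ω) (hDΩ : closure D ⊆ Ω) {x : Plane}
    (hx : x ∈ frontier D) : x ∉ frontier Ω := by
  rw [hΩ.frontier_eq]
  exact fun h => h.2 (hDΩ (frontier_subset_closure hx))

open Filter Topology in
/-- The region between two domains has a tangent half plane at each boundary point. -/
theorem exists_tangent_halfPlane (hΩ : IsC1HolderDomain μ Ω) (hD : IsC1HolderDomain μ D)
    (hDΩ : closure D ⊆ Ω) {y : Plane} (hy : y ∈ frontier D ∪ frontier Ω) :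
    ∃ n : Plane, n ≠ 0 ∧ (∀ v, inner ℝ v n < 0 → ∀ᶠ t : ℝ in 𝓝[>] 0, y + t • v ∈ Ω \ D) ∧
      ∀ v, 0 < inner ℝ v n → ∀ᶠ t : ℝ in 𝓝[>] 0, y + t • v ∉ Ω \ D := by
  have hopen : ∀ {U : Set Plane} (v : Plane), IsOpen U → y ∈ U →
      ∀ᶠ t : ℝ in 𝓝[>] 0, y + t • v ∈ U := by
    intro U v hU hyU
    have hc : Continuous fun t : ℝ => y + t • v := by fun_prop
    have : Tendsto (fun t : ℝ => y + t • v) (𝓝[>] 0) (𝓝 y) := by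
      simpa using (hc.tendsto 0).mono_left nhdsWithin_le_nhds
    exact this.eventually (hU.mem_nhds hyU)
  have hray : ∀ {p : Plane → Prop} {v : Plane},
      (∃ ε > 0, ∀ t : ℝ, 0 < t → t < ε → p (y + t • v)) → ∀ᶠ t : ℝ in 𝓝[>] 0, p (y + t • v) := by
    rintro p v ⟨ε, hε, h⟩
    filter_upwards [Ioo_mem_nhdsGT hε] with t ht
    exact h t ht.1 ht.2
  rcases hy with hy | hy
  · have hn := hD.isOutwardUnitNormal_outwardNormal hy
    -- Seen from the shell, the outward normal on the inner boundary is minus that of `D`.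
    refine ⟨-outwardNormal D y, ?_, fun v hv => ?_, fun v hv => ?_⟩
    · rw [neg_ne_zero, ← norm_ne_zero_iff, hn.1]
      exact one_ne_zero
    · rw [inner_neg_right, neg_lt_zero] at hv
      filter_upwards [hray (p := (· ∉ closure D)) (hn.2.2 v hv), hopen v hΩ.isOpen (hDΩ (frontier_subset_closure hy))]
        with t h1 h2
      exact ⟨h2, fun h => h1 (subset_closure h)⟩
    · rw [inner_neg_right, neg_pos] at hv
      filter_upwards [hray (p := (· ∈ D)) (hn.2.1 v hv)] with t h1 h2
      exact h2.2 h1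
  · have hn := hΩ.isOutwardUnitNormal_outwardNormal hy
    refine ⟨outwardNormal Ω y, ?_, fun v hv => ?_, fun v hv => ?_⟩
    · rw [← norm_ne_zero_iff, hn.1]
      exact one_ne_zero
    · have hyD : y ∉ closure D := fun h => by
        rw [hΩ.isOpen.frontier_eq] at hy
        exact hy.2 (hDΩ h)
      filter_upwards [hray (p := (· ∈ Ω)) (hn.2.1 v hv), hopen v isClosed_closure.isOpen_compl hyD] with t h1 h2
      exact ⟨h1, fun h => h2 (subset_closure h)⟩
    · filter_upwards [hray (p := (· ∉ closure Ω)) (hn.2.2 v hv)] with t h1 h2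
      exact h1 (subset_closure h2.1)

/-- The two boundaries are disjoint and closed, so near either one their union reduces to it. The
chord estimate therefore applies with this union as the compact set. -/
theorem exists_abs_inner_outwardNormal_le_pair (hΩ : IsC1HolderDomain μ Ω)
    (hΩb : Bornology.IsBounded Ω) (hD : IsC1HolderDomain μ D) (hDΩ : closure D ⊆ Ω) :
    ∃ C : ℝ≥0, ∀ y ∈ frontier D ∪ frontier Ω,
      (∀ z ∈ frontier D,
        |inner ℝ (z - y) (outwardNormal D z)| ≤ C * ‖z - y‖ ^ (1 + μ : ℝ)) ∧
      ∀ z ∈ frontier Ω,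
        |inner ℝ (z - y) (outwardNormal Ω z)| ≤ C * ‖z - y‖ ^ (1 + μ : ℝ) := by
  have hDb : Bornology.IsBounded D := hΩb.subset (subset_closure.trans hDΩ)
  have hK : IsCompact (frontier D ∪ frontier Ω) :=
    (IsC1HolderDomain.isCompact_frontier hDb).union (IsC1HolderDomain.isCompact_frontier hΩb)
  obtain ⟨C, hC⟩ := hD.exists_abs_inner_outwardNormal_le hDb hK fun p hp => by
    filter_upwards [isClosed_frontier.isOpen_compl.mem_nhds
      (notMem_frontier_of_closure_subset hΩ.isOpen hDΩ hp)] with y hy h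
    exact h.resolve_right hy
  obtain ⟨B, hB⟩ := hΩ.exists_abs_inner_outwardNormal_le hΩb hK fun p hp => by
    filter_upwards [isClosed_frontier.isOpen_compl.mem_nhds
      (fun h => notMem_frontier_of_closure_subset hΩ.isOpen hDΩ h hp)] with y hy h
    exact h.resolve_left hy
  refine ⟨max C B, fun y hy => ⟨fun z hz => (hC y hy z hz).trans ?_,
    fun z hz => (hB y hy z hz).trans ?_⟩⟩
  · gcongr
    exact le_max_left _ _
  · gcongr
    exact le_max_right _ _

open Filter Topology in
/-- The kernel form of the symmetrisation principle on the boundary of `Ω \ closure D`. -/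
theorem integral_fundSol_mul_npKernel_symm (hμ0 : 0 < μ) (hμ1 : μ < 1)
    (hΩ : IsC1HolderDomain μ Ω) (hΩb : Bornology.IsBounded Ω) (hD : IsC1HolderDomain μ D)
    (hDΩ : closure D ⊆ Ω) {x y : Plane} (hx : x ∈ frontier D ∪ frontier Ω)
    (hy : y ∈ frontier D ∪ frontier Ω) (hxy : x ≠ y) :
    ∫ z, fundSol (z - x) * npKernel Ω y z ∂(arcLength Ω) -
        ∫ z, fundSol (z - x) * npKernel D y z ∂(arcLength D) =
      ∫ z, fundSol (z - y) * npKernel Ω x z ∂(arcLength Ω) -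
        ∫ z, fundSol (z - y) * npKernel D x z ∂(arcLength D) := by
  have hDsub : D ⊆ Ω := subset_closure.trans hDΩ
  have hDb : Bornology.IsBounded D := hΩb.subset hDsub
  obtain ⟨C, hC⟩ := exists_abs_inner_outwardNormal_le_pair hΩ hΩb hD hDΩ
  have hm : MeasurableSet (Ω \ D) := hΩ.isOpen.measurableSet.diff hD.isOpen.measurableSet
  have hvol : ∀ {x y : Plane}, x ≠ y → y ∈ frontier D ∪ frontier Ω →
      Tendsto (fun ε => ∫ z in Ω \ D, regFundSol ε (z - x) * regDelta ε (z - y)) (𝓝[>] 0)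
        (𝓝 (fundSol (y - x) * (1 / 2 * ∫ w, regDelta 1 w))) := by
    intro x y hxy hy
    obtain ⟨n, hn, hin, hout⟩ := exists_tangent_halfPlane hΩ hD hDΩ hy
    exact tendsto_setIntegral_regFundSol_mul_regDelta hm (hΩb.subset Set.sdiff_subset) hxy hn
      hin hout
  have hV := (hvol hxy hy).sub (hvol hxy.symm hx)
  -- The two half masses cancel because `G` is even; the total mass of `regDelta 1` never has to be
  -- computed.
  rw [fundSol_sub_comm y x, sub_self] at hV
  have hlim := fun {x y : Plane} (hy : y ∈ frontier D ∪ frontier Ω) =>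
    (hΩ.tendsto_integral_reg_mul hΩb hμ0 hμ1 (x := x) (hC y hy).2).sub
      (hD.tendsto_integral_reg_mul hDb hμ0 hμ1 (x := x) (hC y hy).1)
  have hB := (hlim (x := x) hy).sub (hlim (x := y) hx)
  refine sub_eq_zero.1 (tendsto_nhds_unique hB (hV.congr' ?_))
  filter_upwards [Ioo_mem_nhdsGT (zero_lt_one' ℝ)] with ε hε
  have hεI : ε ∈ Set.Icc (0 : ℝ) 1 := ⟨hε.1.le, hε.2.le⟩
  have hcont : ∀ x y : Plane,
      Continuous fun z : Plane => regFundSol ε (z - x) * regDelta ε (z - y) := by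
    intro x y
    refine (contDiff_regFundSol_sub hε.1 x (n := 0)).continuous.mul ?_
    unfold regDelta
    refine continuous_const.mul (continuous_const.div (by fun_prop) fun z => ?_)
    have := norm_sq_add_sq_pos hε.1 (z - y)
    positivity
  have hint : ∀ x y : Plane, IntegrableOn
      (fun z : Plane => regFundSol ε (z - x) * regDelta ε (z - y)) Ω := fun x y =>
    ((hcont x y).continuousOn.integrableOn_compact hΩb.isCompact_closure).mono_set subset_closure
  -- The volume integral over the shell is that over `Ω` minus that over `D`, so Green's identity is
  -- used on each domain separately and the inner boundary acquires its minus sign.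
  have hdiff := setIntegral_sdiff (μ := volume) (f := fun z => regFundSol ε (z - x) *
    regDelta ε (z - y) - regFundSol ε (z - y) * regDelta ε (z - x)) hD.isOpen.measurableSet
    ((hint x y).sub (hint y x)) hDsub
  have hgΩ := hΩ.green_regFundSol hΩb hε.1 x y
  have hgD := hD.green_regFundSol hDb hε.1 x y
  rw [integral_sub (hΩ.integrable_reg_mul hΩb hμ0 hμ1 (hC y hy).2 hεI)
    (hΩ.integrable_reg_mul hΩb hμ0 hμ1 (hC x hx).2 hεI)] at hgΩ
  rw [integral_sub (hD.integrable_reg_mul hDb hμ0 hμ1 (hC y hy).1 hεI)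
    (hD.integrable_reg_mul hDb hμ0 hμ1 (hC x hx).1 hεI)] at hgD
  rw [← integral_sub ((hint x y).mono_set Set.sdiff_subset)
    ((hint y x).mono_set Set.sdiff_subset), hdiff, hgΩ, hgD]
  ring

end Pair

/-! ### Layer potentials as integral operators -/

/-- The outward normal, extended by zero off the boundary. -/
noncomputable def boundaryNormal (Ω : Set Plane) : Plane → Plane :=
  (frontier Ω).indicator (outwardNormal Ω)

/-- A version of `npKernel` that is measurable in both variables. -/
noncomputable def boundaryNpKernel (Ω : Set Plane) (x y : Plane) : ℝ :=
  1 / (2 * Real.pi) * (inner ℝ (y - x) (boundaryNormal Ω y) / ‖x - y‖ ^ 2)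

theorem boundaryNpKernel_eq {Ω : Set Plane} {y : Plane} (hy : y ∈ frontier Ω) (x : Plane) :
    boundaryNpKernel Ω x y = npKernel Ω x y := by
  rw [boundaryNpKernel, boundaryNormal, Set.indicator_of_mem hy, npKernel]

theorem hasFDerivAt_fundSol_sub {x z : Plane} (hxz : z ≠ x) :
    HasFDerivAt (fun z => fundSol (z - x))
      ((1 / (2 * Real.pi) / ‖z - x‖ ^ 2) • innerSL ℝ (z - x)) z := by
  have hpos : 0 < ‖z - x‖ := norm_pos_iff.2 (sub_ne_zero.2 hxz)
  have h := hasFDerivAt_regFundSol_sub (ε := 0) (x := x) (z := z) (by positivity)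
  simpa only [regFundSol_zero, zero_pow two_ne_zero, add_zero] using h

/-- With this agreement off the diagonal, a single kernel estimate serves both the diagonal and the
off-diagonal blocks. -/
theorem doubleLayerKernel_eq {Ω : Set Plane} {x y : Plane} (hxy : x ≠ y) :
    doubleLayerKernel Ω x y = npKernel Ω x y := by
  have h := hasFDerivAt_fundSol_sub (x := x) (z := y) hxy.symm
  simp only [fundSol_sub_comm _ x] at h
  rw [doubleLayerKernel, h.fderiv, npKernel, smul_apply, innerSL_apply_apply, smul_eq_mul,
    norm_sub_rev y x]
  ring

theorem L2Boundary.integrable {Ω : Set Plane} [IsFiniteMeasure (arcLength Ω)]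
    (φ : L2Boundary Ω) : Integrable (fun y => φ y) (arcLength Ω) :=
  (Lp.memLp φ).integrable (by norm_num)

/-- Half the radius of a ball missing the boundary serves both as the room for `x'` and as the
distance kept. It provides the uniform majorant for differentiation under the integral. -/
theorem exists_pos_le_norm_sub {Ω : Set Plane} {x : Plane} (hx : x ∉ frontier Ω) :
    ∃ δ > 0, ∀ x' ∈ Metric.ball x δ, ∀ y ∈ frontier Ω, δ ≤ ‖x' - y‖ := by
  obtain ⟨δ, hδ, hs⟩ := Metric.isOpen_iff.1 (isClosed_frontier (s := Ω)).isOpen_compl x hx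
  refine ⟨δ / 2, by positivity, fun x' hx' y hy => ?_⟩
  by_contra! h
  refine hs (show y ∈ Metric.ball x δ from ?_) hy
  rw [Metric.mem_ball] at hx' ⊢
  have h1 := dist_triangle y x' x
  rw [dist_comm y x', dist_eq_norm x' y] at h1
  linarith

namespace IsC1HolderDomain

variable {μ : ℝ≥0} {Ω : Set Plane}

theorem measurable_boundaryNormal (h : IsC1HolderDomain μ Ω) : Measurable (boundaryNormal Ω) := by
  classical
  unfold boundaryNormal
  rw [← Set.piecewise_eq_indicator]
  exact h.continuousOn_outwardNormal.measurable_piecewise continuousOn_const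
    isClosed_frontier.measurableSet

theorem measurable_boundaryNpKernel (h : IsC1HolderDomain μ Ω) :
    Measurable (Function.uncurry (boundaryNpKernel Ω)) := by
  have h1 : Measurable fun p : Plane × Plane => boundaryNormal Ω p.2 :=
    h.measurable_boundaryNormal.comp measurable_snd
  have h2 : Measurable fun p : Plane × Plane => p.2 - p.1 := by fun_prop
  exact ((h2.inner h1).div (by fun_prop)).const_mul _

/-- Differentiation under the integral sign in the single layer potential. -/
theorem hasFDerivAt_singleLayer (h : IsC1HolderDomain μ Ω) (hb : Bornology.IsBounded Ω)
    (φ : L2Boundary Ω) {x : Plane} (hx : x ∉ frontier Ω)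
    (hint : Integrable (fun y => fundSol (x - y) • φ y) (arcLength Ω)) :
    ∃ L : Plane →L[ℝ] ℂ, HasFDerivAt (singleLayer Ω φ) L x ∧ ∀ v,
      L v = ∫ y, (1 / (2 * Real.pi) * (inner ℝ (x - y) v / ‖x - y‖ ^ 2)) • φ y
        ∂(arcLength Ω) := by
  have := h.isFiniteMeasure_arcLength hb
  obtain ⟨δ, hδ, hd⟩ := exists_pos_le_norm_sub hx
  have hφ := L2Boundary.integrable φ
  set F' : Plane → Plane → Plane →L[ℝ] ℂ := fun x y =>
    ((1 / (2 * Real.pi) / ‖x - y‖ ^ 2) • innerSL ℝ (x - y)).smulRight (φ y) with hF'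
  have hF'm : AEStronglyMeasurable (F' x) (arcLength Ω) := by
    have h1 : Measurable fun y : Plane => (1 / (2 * Real.pi) / ‖x - y‖ ^ 2) := by fun_prop
    have h2 : Continuous fun y : Plane => innerSL ℝ (x - y) := by fun_prop
    exact (ContinuousLinearMap.smulRightL ℝ Plane ℂ).aestronglyMeasurable_comp₂
      (h1.aestronglyMeasurable.smul h2.aestronglyMeasurable) hφ.1
  have hbound : ∀ᵐ y ∂(arcLength Ω), ∀ x' ∈ Metric.ball x δ, ‖F' x' y‖ ≤ δ⁻¹ * ‖φ y‖ := by
    filter_upwards [ae_mem_frontier Ω] with y hy x' hx'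
    have h1 := hd x' hx' y hy
    have hpos : 0 < ‖x' - y‖ := hδ.trans_le h1
    have hpi : 1 / (2 * Real.pi) ≤ 1 := by
      rw [div_le_one (by positivity)]
      linarith [Real.pi_gt_three]
    rw [hF', ContinuousLinearMap.norm_smulRight_apply, norm_smul, innerSL_apply_norm,
      Real.norm_of_nonneg (by positivity)]
    refine mul_le_mul_of_nonneg_right ?_ (norm_nonneg _)
    calc _ ≤ 1 / ‖x' - y‖ ^ 2 * ‖x' - y‖ := by gcongr
      _ = ‖x' - y‖⁻¹ := by field_simp
      _ ≤ _ := by gcongr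
  have hgi : Integrable (fun y => δ⁻¹ * ‖φ y‖) (arcLength Ω) := hφ.norm.const_mul _
  have hF'i : Integrable (F' x) (arcLength Ω) := by
    refine hgi.mono' hF'm ?_
    filter_upwards [hbound] with y hy
    exact hy x (Metric.mem_ball_self hδ)
  refine ⟨∫ y, F' x y ∂(arcLength Ω), ?_, fun v => ?_⟩
  · refine hasFDerivAt_integral_of_dominated_of_fderiv_le (Metric.ball_mem_nhds x hδ)
      (Filter.Eventually.of_forall fun x' => ?_) hint hF'm hbound hgi ?_
    · exact (measurable_fundSol.comp (by fun_prop : Measurable fun y : Plane =>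
        x' - y)).aestronglyMeasurable.smul hφ.1
    · filter_upwards [ae_mem_frontier Ω] with y hy x' hx'
      have hne : x' ≠ y := by
        rintro rfl
        have := hd _ hx' _ hy
        simp at this
        linarith
      exact (hasFDerivAt_fundSol_sub hne).smul_const (φ y)
  · rw [ContinuousLinearMap.integral_apply hF'i]
    congr 1
    ext1 y
    rw [hF', ContinuousLinearMap.smulRight_apply, smul_apply, innerSL_apply_apply, smul_eq_mul]
    congr 1
    ring

/-- The logarithm is dominated by the power `-1/4` of the distance, whose square is integrable along
the boundary. -/
theorem memLp_fundSol_sub (h : IsC1HolderDomain μ Ω) (hb : Bornology.IsBounded Ω) (x : Plane) :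
    MemLp (fun y => fundSol (x - y)) 2 (arcLength Ω) := by
  obtain ⟨R, hR⟩ : ∃ R : ℝ, ∀ z ∈ frontier Ω, ‖z - x‖ ≤ R := by
    obtain ⟨R, hR⟩ := (isCompact_frontier hb).isBounded.subset_closedBall x
    exact ⟨R, fun z hz => by simpa [dist_eq_norm] using hR hz⟩
  obtain ⟨B, hB⟩ := exists_abs_regFundSol_le (R := R) (b := 1 / 4) (by norm_num)
  have hm : AEStronglyMeasurable (fun y => fundSol (x - y)) (arcLength Ω) :=
    (measurable_fundSol.comp (by fun_prop : Measurable fun y : Plane =>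
        x - y)).aestronglyMeasurable
  rw [memLp_two_iff_integrable_sq hm]
  refine ((h.integrable_norm_sub_rpow hb (a := 1 / 2) (by norm_num) (by norm_num) x).const_mul
    ((B : ℝ) ^ 2)).mono' (hm.pow 2) ?_
  filter_upwards [ae_mem_frontier Ω, ae_arcLength_ne Ω x] with z hz hzx
  have h1 := hB 0 (by simp) _ (sub_ne_zero.2 hzx) (hR z hz)
  rw [regFundSol_zero] at h1
  rw [norm_pow, Real.norm_eq_abs, fundSol_sub_comm]
  calc _ ≤ (B * ‖z - x‖ ^ (-(1 / 4 : ℝ))) ^ 2 := by gcongr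
    _ = _ := by
      rw [mul_pow, ← Real.rpow_natCast (_ ^ _), ← Real.rpow_mul (norm_nonneg _)]
      norm_num

theorem integrable_singleLayer (h : IsC1HolderDomain μ Ω) (hb : Bornology.IsBounded Ω)
    (φ : L2Boundary Ω) (x : Plane) :
    Integrable (fun y => fundSol (x - y) • φ y) (arcLength Ω) :=
  memLp_one_iff_integrable.1 ((Lp.memLp φ).smul (h.memLp_fundSol_sub hb x))

theorem integrable_doubleLayer (h : IsC1HolderDomain μ Ω) (hb : Bornology.IsBounded Ω)
    (φ : L2Boundary Ω) {x : Plane} (hx : x ∉ frontier Ω) :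
    Integrable (fun y => doubleLayerKernel Ω x y • φ y) (arcLength Ω) := by
  have := h.isFiniteMeasure_arcLength hb
  have hφ := L2Boundary.integrable φ
  obtain ⟨δ, hδ, hd⟩ := exists_pos_le_norm_sub hx
  have he : ∀ᵐ y ∂(arcLength Ω), doubleLayerKernel Ω x y = boundaryNpKernel Ω x y := by
    filter_upwards [ae_mem_frontier Ω, ae_arcLength_ne Ω x] with y hy hyx
    rw [doubleLayerKernel_eq hyx.symm, boundaryNpKernel_eq hy]
  refine Integrable.congr (f := fun y => boundaryNpKernel Ω x y • φ y) ?_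
    (by filter_upwards [he] with y hy; rw [hy])
  refine (hφ.norm.const_mul (δ⁻¹)).mono'
    ((h.measurable_boundaryNpKernel.comp measurable_prodMk_left).aestronglyMeasurable.smul hφ.1) ?_
  filter_upwards [ae_mem_frontier Ω] with y hy
  have h1 := hd x (Metric.mem_ball_self hδ) y hy
  have hpos : 0 < ‖x - y‖ := hδ.trans_le h1
  have hpi : 1 / (2 * Real.pi) ≤ 1 := by
    rw [div_le_one (by positivity)]
    linarith [Real.pi_gt_three]
  rw [norm_smul]
  refine mul_le_mul_of_nonneg_right ?_ (norm_nonneg _)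
  rw [boundaryNpKernel_eq hy, npKernel, norm_mul, Real.norm_of_nonneg (by positivity), norm_div,
    Real.norm_of_nonneg (sq_nonneg ‖x - y‖)]
  have h2 := norm_inner_le_norm (𝕜 := ℝ) (y - x) (outwardNormal Ω y)
  rw [h.norm_outwardNormal hy, mul_one, norm_sub_rev] at h2
  calc _ ≤ 1 * (‖x - y‖ / ‖x - y‖ ^ 2) := by gcongr
    _ = ‖x - y‖⁻¹ := by field_simp
    _ ≤ _ := by gcongr

end IsC1HolderDomain

/-- Kernels dominated by a weak singularity satisfy the hypotheses of the Schur test. -/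
theorem exists_schurKernel_of_le {μ ν : ℝ≥0} {A B : Set Plane} (hA : IsC1HolderDomain μ A)
    (hAb : Bornology.IsBounded A) (hB : IsC1HolderDomain ν B) (hBb : Bornology.IsBounded B)
    {k : Plane → Plane → ℝ} (hk : Measurable (Function.uncurry k)) {C : ℝ≥0} {a : ℝ} (ha : 0 ≤ a)
    (ha1 : a < 1) (hle : ∀ x ∈ frontier A, ∀ y ∈ frontier B, x ≠ y → |k x y| ≤ C * ‖x - y‖ ^ (-a)) :
    ∃ M, SchurKernel (arcLength A) (arcLength B) k M := by
  obtain ⟨M, hM⟩ := hA.exists_lintegral_norm_sub_rpow_le hAb ha ha1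
  obtain ⟨N, hN⟩ := hB.exists_lintegral_norm_sub_rpow_le hBb ha ha1
  have he : ∀ x ∈ frontier A, ∀ y ∈ frontier B, x ≠ y →
      ‖k x y‖ₑ ≤ C * ENNReal.ofReal (‖x - y‖ ^ (-a)) := by
    intro x hx y hy hxy
    rw [← ofReal_norm, Real.norm_eq_abs, ← ENNReal.ofReal_coe_nnreal,
      ← ENNReal.ofReal_mul C.coe_nonneg]
    exact ENNReal.ofReal_le_ofReal (hle x hx y hy hxy)
  refine ⟨C * max M N, hk, ?_, ?_⟩
  · filter_upwards [IsC1HolderDomain.ae_mem_frontier A] with x hx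
    calc _ ≤ ∫⁻ y, C * ENNReal.ofReal (‖x - y‖ ^ (-a)) ∂(arcLength B) := by
          refine lintegral_mono_ae ?_
          filter_upwards [IsC1HolderDomain.ae_mem_frontier B, ae_arcLength_ne B x] with y hy hyx
          exact he x hx y hy hyx.symm
      _ = C * ∫⁻ y, ENNReal.ofReal (‖x - y‖ ^ (-a)) ∂(arcLength B) :=
          lintegral_const_mul' _ _ ENNReal.coe_ne_top
      _ ≤ _ := by
          rw [ENNReal.coe_mul]
          gcongr
          exact (hN x).trans (by exact_mod_cast le_max_right _ _)
  · filter_upwards [IsC1HolderDomain.ae_mem_frontier B] with y hy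
    calc _ ≤ ∫⁻ x, C * ENNReal.ofReal (‖y - x‖ ^ (-a)) ∂(arcLength A) := by
          refine lintegral_mono_ae ?_
          filter_upwards [IsC1HolderDomain.ae_mem_frontier A, ae_arcLength_ne A y] with x hx hxy
          rw [norm_sub_rev y x]
          exact he x hx y hy hxy
      _ = C * ∫⁻ x, ENNReal.ofReal (‖y - x‖ ^ (-a)) ∂(arcLength A) :=
          lintegral_const_mul' _ _ ENNReal.coe_ne_top
      _ ≤ _ := by
          rw [ENNReal.coe_mul]
          gcongr
          exact (hM y).trans (by exact_mod_cast le_max_left _ _)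

/-- On bounded sets the logarithm is dominated by the power `-1/2`; any exponent in `(-1, 0)` would
do. -/
theorem exists_schurKernel_fundSol {μ ν : ℝ≥0} {A B : Set Plane} (hA : IsC1HolderDomain μ A)
    (hAb : Bornology.IsBounded A) (hB : IsC1HolderDomain ν B) (hBb : Bornology.IsBounded B) :
    ∃ M, SchurKernel (arcLength A) (arcLength B) (fun x y => fundSol (x - y)) M := by
  obtain ⟨R, hR⟩ := ((IsC1HolderDomain.isCompact_frontier hAb).isBounded.union
    (IsC1HolderDomain.isCompact_frontier hBb).isBounded).subset_closedBall 0
  obtain ⟨C, hC⟩ := exists_abs_regFundSol_le (R := R + R) (b := 1 / 2) (by norm_num)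
  refine exists_schurKernel_of_le hA hAb hB hBb (C := C) (a := 1 / 2)
    (measurable_fundSol.comp (by fun_prop)) (by norm_num) (by norm_num) fun x hx y hy hxy => ?_
  have h1 := hR (Or.inl hx)
  have h2 := hR (Or.inr hy)
  rw [mem_closedBall_zero_iff] at h1 h2
  rw [← regFundSol_zero]
  exact hC 0 (by simp) _ (sub_ne_zero.2 hxy) ((norm_sub_le _ _).trans (add_le_add h1 h2))

theorem exists_schurKernel_boundaryNpKernel {μ : ℝ≥0} (hμ0 : 0 < μ) (hμ1 : μ < 1) {A B : Set Plane}
    (hA : IsC1HolderDomain μ A)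
    (hAb : Bornology.IsBounded A) (hB : IsC1HolderDomain μ B) (hBb : Bornology.IsBounded B)
    {C : ℝ≥0} (hC : ∀ y ∈ frontier A, ∀ z ∈ frontier B,
        |inner ℝ (z - y) (outwardNormal B z)| ≤ C * ‖z - y‖ ^ (1 + μ : ℝ)) :
    ∃ M, SchurKernel (arcLength A) (arcLength B) (boundaryNpKernel B) M := by
  have hm0 : (0 : ℝ) < μ := hμ0
  have hm1 : (μ : ℝ) < 1 := hμ1
  refine exists_schurKernel_of_le hA hAb hB hBb (C := C) (a := 1 - μ)
    hB.measurable_boundaryNpKernel (by linarith) (by linarith) fun x hx y hy _ => ?_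
  rw [boundaryNpKernel_eq hy, ← regNpKernel_zero, norm_sub_rev]
  exact abs_regNpKernel_le (hC x hx y hy) 0

theorem npOp_eq (Ω : Set Plane) (φ : Plane → ℂ) (x : Plane) :
    npOp Ω φ x = ∫ y, boundaryNpKernel Ω x y • φ y ∂(arcLength Ω) := by
  refine integral_congr_ae ?_
  filter_upwards [IsC1HolderDomain.ae_mem_frontier Ω] with y hy
  rw [boundaryNpKernel_eq hy]

theorem npAdjOp_eq {Ω : Set Plane} (φ : Plane → ℂ) {x : Plane} (hx : x ∈ frontier Ω) :
    npAdjOp Ω φ x = ∫ y, boundaryNpKernel Ω y x • φ y ∂(arcLength Ω) := by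
  simp only [npAdjOp, boundaryNpKernel_eq hx]

theorem doubleLayer_eq (Ω : Set Plane) (φ : Plane → ℂ) (x : Plane) :
    doubleLayer Ω φ x = ∫ y, boundaryNpKernel Ω x y • φ y ∂(arcLength Ω) := by
  refine integral_congr_ae ?_
  filter_upwards [IsC1HolderDomain.ae_mem_frontier Ω, ae_arcLength_ne Ω x] with y hy hyx
  rw [boundaryNpKernel_eq hy, doubleLayerKernel_eq hyx.symm]

namespace IsC1HolderDomain

variable {μ : ℝ≥0} {Ω : Set Plane}

/-- Differentiation under the integral sign produces the transposed double layer kernel. This makes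
the off-diagonal blocks of `K*` and `K` transposes of each other. -/
theorem normalDeriv_singleLayer_eq (h : IsC1HolderDomain μ Ω) (hb : Bornology.IsBounded Ω)
    (φ : L2Boundary Ω) {A : Set Plane} {x : Plane} (hx : x ∈ frontier A) (hxΩ : x ∉ frontier Ω) :
    normalDeriv A (singleLayer Ω φ) x =
      ∫ y, boundaryNpKernel A y x • φ y ∂(arcLength Ω) := by
  obtain ⟨L, hL, hv⟩ := h.hasFDerivAt_singleLayer hb φ hxΩ (h.integrable_singleLayer hb φ x)
  rw [normalDeriv, hL.fderiv, hv]
  simp only [boundaryNpKernel_eq hx, npKernel, norm_sub_rev x]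

/-- The layer potentials of a bounded domain of class `C^{1,μ}` converge. -/
theorem layerPotentialsConverge (h : IsC1HolderDomain μ Ω) (hb : Bornology.IsBounded Ω)
    (hμ0 : 0 < μ) (hμ1 : μ < 1) : LayerPotentialsConverge Ω := by
  have := h.isFiniteMeasure_arcLength hb
  obtain ⟨C, hC⟩ := h.exists_abs_inner_outwardNormal_le hb (isCompact_frontier hb)
    fun p _ => Filter.Eventually.of_forall fun y hy => hy
  obtain ⟨M, hM⟩ := exists_schurKernel_boundaryNpKernel hμ0 hμ1 h hb h hb hC
  refine ⟨h.integrable_singleLayer hb, fun φ x hx => h.integrable_doubleLayer hb φ hx,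
    fun φ => ?_, fun φ => ?_, fun φ x hx => ?_⟩
  · filter_upwards [hM.ae_integrable (Lp.memLp φ)] with x hx
    refine hx.congr ?_
    filter_upwards [ae_mem_frontier Ω] with y hy
    rw [boundaryNpKernel_eq hy]
  · filter_upwards [hM.swap.ae_integrable (Lp.memLp φ), ae_mem_frontier Ω] with x hx hxΩ
    simpa only [boundaryNpKernel_eq hxΩ] using hx
  · obtain ⟨L, hL, -⟩ := h.hasFDerivAt_singleLayer hb φ hx (h.integrable_singleLayer hb φ x)
    exact hL.differentiableAt

end IsC1HolderDomain

/-! ### Sums of products of kernels and block operators -/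

namespace SchurKernel

variable {α β γ δ : Type*} [MeasurableSpace α] [MeasurableSpace β] [MeasurableSpace γ]
  [MeasurableSpace δ]

/-- It identifies the transposed single layer operator with the direct one, although their Schur
constants may differ. -/
theorem kernelOp_congr {σ : Measure α} {τ : Measure β} [SFinite σ] [SFinite τ]
    {k l : α → β → ℝ} {M N : ℝ≥0} (h : SchurKernel σ τ k M) (h' : SchurKernel σ τ l N)
    (hkl : ∀ x y, k x y = l x y) : h.kernelOp = h'.kernelOp := by
  ext φ
  filter_upwards [h.coeFn_kernelOp φ, h'.coeFn_kernelOp φ] with x h1 h2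
  rw [h1, h2]
  simp only [hkl]

theorem kernelOp_neg {σ : Measure α} {τ : Measure β} [SFinite σ] [SFinite τ]
    {k : α → β → ℝ} {M : ℝ≥0} (h : SchurKernel σ τ k M) (φ : Lp ℂ 2 τ) :
    h.neg.kernelOp φ =ᵐ[σ] fun x => -∫ y, k x y • φ y ∂τ := by
  filter_upwards [h.neg.coeFn_kernelOp φ] with x hx
  rw [hx, ← integral_neg]
  simp only [neg_smul]

/-- Sums of products of integral operators agree if their kernels do. -/
theorem kernelOp_comp_add_eq {ρ : Measure α} {σ₁ : Measure β} {σ₂ : Measure γ} {τ : Measure δ}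
    [SFinite ρ] [SFinite σ₁] [SFinite σ₂] [IsFiniteMeasure τ]
    {a₁ b₁ : α → β → ℝ} {a₂ b₂ : α → γ → ℝ} {c₁ d₁ : β → δ → ℝ} {c₂ d₂ : γ → δ → ℝ}
    {A₁ B₁ A₂ B₂ C₁ D₁ C₂ D₂ : ℝ≥0}
    (ha₁ : SchurKernel ρ σ₁ a₁ A₁) (hc₁ : SchurKernel σ₁ τ c₁ C₁)
    (ha₂ : SchurKernel ρ σ₂ a₂ A₂) (hc₂ : SchurKernel σ₂ τ c₂ C₂)
    (hb₁ : SchurKernel ρ σ₁ b₁ B₁) (hd₁ : SchurKernel σ₁ τ d₁ D₁)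
    (hb₂ : SchurKernel ρ σ₂ b₂ B₂) (hd₂ : SchurKernel σ₂ τ d₂ D₂)
    (heq : ∀ᵐ x ∂ρ, ∀ᵐ y ∂τ, ∫ z, a₁ x z * c₁ z y ∂σ₁ + ∫ z, a₂ x z * c₂ z y ∂σ₂ =
      ∫ z, b₁ x z * d₁ z y ∂σ₁ + ∫ z, b₂ x z * d₂ z y ∂σ₂) :
    ha₁.kernelOp ∘L hc₁.kernelOp + ha₂.kernelOp ∘L hc₂.kernelOp =
      hb₁.kernelOp ∘L hd₁.kernelOp + hb₂.kernelOp ∘L hd₂.kernelOp := by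
  ext φ
  rw [add_apply, add_apply]
  filter_upwards [ha₁.coeFn_kernelOp_kernelOp hc₁ φ, ha₂.coeFn_kernelOp_kernelOp hc₂ φ,
    hb₁.coeFn_kernelOp_kernelOp hd₁ φ, hb₂.coeFn_kernelOp_kernelOp hd₂ φ,
    Lp.coeFn_add (ha₁.kernelOp (hc₁.kernelOp φ)) (ha₂.kernelOp (hc₂.kernelOp φ)),
    Lp.coeFn_add (hb₁.kernelOp (hd₁.kernelOp φ)) (hb₂.kernelOp (hd₂.kernelOp φ)), heq]
    with x h1 h2 h3 h4 h5 h6 h7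
  simp only [ContinuousLinearMap.comp_apply]
  rw [h5, h6, Pi.add_apply, Pi.add_apply, h1.2, h2.2, h3.2, h4.2, ← integral_add h1.1 h2.1,
    ← integral_add h3.1 h4.1]
  refine integral_congr_ae ?_
  filter_upwards [h7] with y hy
  rw [← add_smul, ← add_smul, hy]

end SchurKernel

section Block

variable {E F : Type*} [NormedAddCommGroup E] [InnerProductSpace ℂ E] [NormedAddCommGroup F]
  [InnerProductSpace ℂ F]

/-- The block operator `[[A, B], [C, D]]` on a product of Hilbert spaces. -/
noncomputable def blockOp (A : E →L[ℂ] E) (B : F →L[ℂ] E) (C : E →L[ℂ] F) (D : F →L[ℂ] F) :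
    WithLp 2 (E × F) →L[ℂ] WithLp 2 (E × F) :=
  (WithLp.prodContinuousLinearEquiv 2 ℂ E F).symm.toContinuousLinearMap ∘L
    ((A.coprod B).prod (C.coprod D)) ∘L
      (WithLp.prodContinuousLinearEquiv 2 ℂ E F).toContinuousLinearMap

theorem fst_blockOp (A : E →L[ℂ] E) (B : F →L[ℂ] E) (C : E →L[ℂ] F) (D : F →L[ℂ] F)
    (Φ : WithLp 2 (E × F)) : (blockOp A B C D Φ).fst = A Φ.fst + B Φ.snd := rfl

theorem snd_blockOp (A : E →L[ℂ] E) (B : F →L[ℂ] E) (C : E →L[ℂ] F) (D : F →L[ℂ] F)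
    (Φ : WithLp 2 (E × F)) : (blockOp A B C D Φ).snd = C Φ.fst + D Φ.snd := rfl

theorem blockOp_comp (A A' : E →L[ℂ] E) (B B' : F →L[ℂ] E) (C C' : E →L[ℂ] F)
    (D D' : F →L[ℂ] F) : blockOp A B C D ∘L blockOp A' B' C' D' =
      blockOp (A ∘L A' + B ∘L C') (A ∘L B' + B ∘L D') (C ∘L A' + D ∘L C')
        (C ∘L B' + D ∘L D') := by
  refine ContinuousLinearMap.ext fun Φ => WithLp.ofLp_injective 2 (Prod.ext ?_ ?_)
  · change (blockOp A B C D (blockOp A' B' C' D' Φ)).fst = (blockOp _ _ _ _ Φ).fst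
    simp only [fst_blockOp, snd_blockOp, map_add, add_apply, ContinuousLinearMap.comp_apply]
    abel
  · change (blockOp A B C D (blockOp A' B' C' D' Φ)).snd = (blockOp _ _ _ _ Φ).snd
    simp only [fst_blockOp, snd_blockOp, map_add, add_apply, ContinuousLinearMap.comp_apply]
    abel

theorem adjoint_blockOp [CompleteSpace E] [CompleteSpace F] (A : E →L[ℂ] E) (B : F →L[ℂ] E)
    (C : E →L[ℂ] F) (D : F →L[ℂ] F) : ContinuousLinearMap.adjoint (blockOp A B C D) =
      blockOp (ContinuousLinearMap.adjoint A) (ContinuousLinearMap.adjoint C)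
        (ContinuousLinearMap.adjoint B) (ContinuousLinearMap.adjoint D) := by
  rw [eq_comm, ContinuousLinearMap.eq_adjoint_iff]
  intro Φ Ψ
  rw [WithLp.prod_inner_apply, WithLp.prod_inner_apply]
  change inner ℂ (blockOp _ _ _ _ Φ).fst Ψ.fst + inner ℂ (blockOp _ _ _ _ Φ).snd Ψ.snd =
    inner ℂ Φ.fst (blockOp _ _ _ _ Ψ).fst + inner ℂ Φ.snd (blockOp _ _ _ _ Ψ).snd
  simp only [fst_blockOp, snd_blockOp, inner_add_left, inner_add_right,
    ContinuousLinearMap.adjoint_inner_left]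
  ring

end Block

/-! ### Assembly of the block operators -/

theorem lemma3p4 (μ : ℝ≥0) (hμ0 : 0 < μ) (hμ1 : μ < 1) (D Ω : Set Plane)
    (hΩ : IsC1HolderDomain μ Ω) (hΩb : Bornology.IsBounded Ω)
    (hD : IsC1HolderDomain μ D) (hDΩ : closure D ⊆ Ω) :
    LayerPotentialsConverge D ∧ LayerPotentialsConverge Ω ∧
    ∃ S Kstar K : BlockL2 D Ω →L[ℂ] BlockL2 D Ω,
      IsBlockS D Ω S ∧ IsBlockKStar D Ω Kstar ∧ IsBlockK D Ω K ∧
      K = ContinuousLinearMap.adjoint Kstar ∧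
      S ∘L Kstar = K ∘L S ∧
      IsSelfAdjoint (S ∘L Kstar) := by
  have hDb : Bornology.IsBounded D := hΩb.subset (subset_closure.trans hDΩ)
  have := hΩ.isFiniteMeasure_arcLength hΩb
  have := hD.isFiniteMeasure_arcLength hDb
  obtain ⟨C, hC⟩ := exists_abs_inner_outwardNormal_le_pair hΩ hΩb hD hDΩ
  have hCD := fun y hy => (hC y hy).1
  have hCΩ := fun y hy => (hC y hy).2
  have hfD : frontier D ⊆ frontier D ∪ frontier Ω := Set.subset_union_left
  have hfΩ : frontier Ω ⊆ frontier D ∪ frontier Ω := Set.subset_union_right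
  obtain ⟨_, gDD⟩ := exists_schurKernel_fundSol hD hDb hD hDb
  obtain ⟨_, gDΩ⟩ := exists_schurKernel_fundSol hD hDb hΩ hΩb
  obtain ⟨_, gΩD⟩ := exists_schurKernel_fundSol hΩ hΩb hD hDb
  obtain ⟨_, gΩΩ⟩ := exists_schurKernel_fundSol hΩ hΩb hΩ hΩb
  obtain ⟨_, nDD⟩ := exists_schurKernel_boundaryNpKernel hμ0 hμ1 hD hDb hD hDb
    fun y hy => hCD y (hfD hy)
  obtain ⟨_, nDΩ⟩ := exists_schurKernel_boundaryNpKernel hμ0 hμ1 hD hDb hΩ hΩb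
    fun y hy => hCΩ y (hfD hy)
  obtain ⟨_, nΩD⟩ := exists_schurKernel_boundaryNpKernel hμ0 hμ1 hΩ hΩb hD hDb
    fun y hy => hCD y (hfΩ hy)
  obtain ⟨_, nΩΩ⟩ := exists_schurKernel_boundaryNpKernel hμ0 hμ1 hΩ hΩb hΩ hΩb
    fun y hy => hCΩ y (hfΩ hy)
  set S : BlockL2 D Ω →L[ℂ] BlockL2 D Ω :=
    blockOp gDD.kernelOp gDΩ.kernelOp gΩD.kernelOp gΩΩ.kernelOp with hS
  -- The entries of `Kstar` are the swapped kernels of `K`, so that adjointness holds block by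
  -- block.
  set Kstar : BlockL2 D Ω →L[ℂ] BlockL2 D Ω := blockOp nDD.neg.swap.kernelOp
    nΩD.neg.swap.kernelOp nDΩ.swap.kernelOp nΩΩ.swap.kernelOp with hKstar
  set K : BlockL2 D Ω →L[ℂ] BlockL2 D Ω := blockOp nDD.neg.kernelOp nDΩ.kernelOp
    nΩD.neg.kernelOp nΩΩ.kernelOp with hK
  have hadj : K = ContinuousLinearMap.adjoint Kstar := by
    rw [hKstar, adjoint_blockOp]
    simp only [SchurKernel.adjoint_kernelOp]
    rfl
  have hSadj : ContinuousLinearMap.adjoint S = S := by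
    rw [hS, adjoint_blockOp]
    simp only [SchurKernel.adjoint_kernelOp]
    rw [gDD.swap.kernelOp_congr gDD fun x y => fundSol_sub_comm y x,
      gΩD.swap.kernelOp_congr gDΩ fun x y => fundSol_sub_comm y x,
      gDΩ.swap.kernelOp_congr gΩD fun x y => fundSol_sub_comm y x,
      gΩΩ.swap.kernelOp_congr gΩΩ fun x y => fundSol_sub_comm y x]
  -- The left side is the kernel of `S K*` and the right side that of `K S`. One formula covers all
  -- four blocks, as `x` and `y` range over both boundaries.
  have hker : ∀ {x y : Plane}, x ∈ frontier D ∪ frontier Ω → y ∈ frontier D ∪ frontier Ω →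
      x ≠ y →
      ∫ z, fundSol (x - z) * -boundaryNpKernel D y z ∂(arcLength D) +
        ∫ z, fundSol (x - z) * boundaryNpKernel Ω y z ∂(arcLength Ω) =
      ∫ z, -boundaryNpKernel D x z * fundSol (z - y) ∂(arcLength D) +
        ∫ z, boundaryNpKernel Ω x z * fundSol (z - y) ∂(arcLength Ω) := by
    intro x y hx hy hxy
    have hsymm := integral_fundSol_mul_npKernel_symm hμ0 hμ1 hΩ hΩb hD hDΩ hx hy hxy
    have hae : ∀ (A : Set Plane) (x y : Plane),
        ∫ z, fundSol (z - x) * npKernel A y z ∂(arcLength A) =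
          ∫ z, fundSol (z - x) * boundaryNpKernel A y z ∂(arcLength A) := by
      intro A x y
      refine integral_congr_ae ?_
      filter_upwards [IsC1HolderDomain.ae_mem_frontier A] with z hz
      rw [boundaryNpKernel_eq hz]
    rw [hae, hae, hae, hae] at hsymm
    simp only [fundSol_sub_comm x, mul_neg, integral_neg, mul_comm _ (fundSol (_ - y))]
    linarith
  have haeker : ∀ {A B : Set Plane}, frontier A ⊆ frontier D ∪ frontier Ω →
      frontier B ⊆ frontier D ∪ frontier Ω →
      ∀ᵐ x ∂(arcLength A), ∀ᵐ y ∂(arcLength B),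
      ∫ z, fundSol (x - z) * -boundaryNpKernel D y z ∂(arcLength D) +
        ∫ z, fundSol (x - z) * boundaryNpKernel Ω y z ∂(arcLength Ω) =
      ∫ z, -boundaryNpKernel D x z * fundSol (z - y) ∂(arcLength D) +
        ∫ z, boundaryNpKernel Ω x z * fundSol (z - y) ∂(arcLength Ω) := by
    intro A B hA hB
    filter_upwards [IsC1HolderDomain.ae_mem_frontier A] with x hx
    -- The identity is only available for `x ≠ y`, but points are null.
    filter_upwards [IsC1HolderDomain.ae_mem_frontier B, ae_arcLength_ne B x] with y hy hyx
    exact hker (hA hx) (hB hy) hyx.symm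
  have hcomm : S ∘L Kstar = K ∘L S := by
    rw [hS, hKstar, hK, blockOp_comp, blockOp_comp]
    congr 1
    · exact SchurKernel.kernelOp_comp_add_eq _ _ _ _ _ _ _ _ (haeker hfD hfD)
    · exact SchurKernel.kernelOp_comp_add_eq _ _ _ _ _ _ _ _ (haeker hfD hfΩ)
    · exact SchurKernel.kernelOp_comp_add_eq _ _ _ _ _ _ _ _ (haeker hfΩ hfD)
    · exact SchurKernel.kernelOp_comp_add_eq _ _ _ _ _ _ _ _ (haeker hfΩ hfΩ)
  refine ⟨hD.layerPotentialsConverge hDb hμ0 hμ1, hΩ.layerPotentialsConverge hΩb hμ0 hμ1, S,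
    Kstar, K, fun Φ => ⟨?_, ?_⟩, fun Φ => ⟨?_, ?_⟩, fun Φ => ⟨?_, ?_⟩, hadj, hcomm, ?_⟩
  · rw [hS, fst_blockOp]
    filter_upwards [Lp.coeFn_add (gDD.kernelOp Φ.fst) (gDΩ.kernelOp Φ.snd),
      gDD.coeFn_kernelOp Φ.fst, gDΩ.coeFn_kernelOp Φ.snd] with x h1 h2 h3
    rw [h1, Pi.add_apply, h2, h3]
    rfl
  · rw [hS, snd_blockOp]
    filter_upwards [Lp.coeFn_add (gΩD.kernelOp Φ.fst) (gΩΩ.kernelOp Φ.snd),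
      gΩD.coeFn_kernelOp Φ.fst, gΩΩ.coeFn_kernelOp Φ.snd] with x h1 h2 h3
    rw [h1, Pi.add_apply, h2, h3]
    rfl
  · rw [hKstar, fst_blockOp]
    filter_upwards [Lp.coeFn_add (nDD.neg.swap.kernelOp Φ.fst) (nΩD.neg.swap.kernelOp Φ.snd),
      nDD.swap.kernelOp_neg Φ.fst, nΩD.swap.kernelOp_neg Φ.snd,
      IsC1HolderDomain.ae_mem_frontier D] with x h1 h2 h3 hx
    rw [h1, Pi.add_apply, npAdjOp_eq _ hx, hΩ.normalDeriv_singleLayer_eq hΩb _ hx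
      (notMem_frontier_of_closure_subset hΩ.isOpen hDΩ hx), sub_eq_add_neg, ← h2, ← h3]
  · rw [hKstar, snd_blockOp]
    filter_upwards [Lp.coeFn_add (nDΩ.swap.kernelOp Φ.fst) (nΩΩ.swap.kernelOp Φ.snd),
      nDΩ.swap.coeFn_kernelOp Φ.fst, nΩΩ.swap.coeFn_kernelOp Φ.snd,
      IsC1HolderDomain.ae_mem_frontier Ω] with x h1 h2 h3 hx
    rw [h1, Pi.add_apply, npAdjOp_eq _ hx, hD.normalDeriv_singleLayer_eq hDb _ hx
      (fun h => notMem_frontier_of_closure_subset hΩ.isOpen hDΩ h hx), h2, h3]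
  · rw [hK, fst_blockOp]
    filter_upwards [Lp.coeFn_add (nDD.neg.kernelOp Φ.fst) (nDΩ.kernelOp Φ.snd),
      nDD.kernelOp_neg Φ.fst, nDΩ.coeFn_kernelOp Φ.snd] with x h1 h2 h3
    rw [h1, Pi.add_apply, h2, h3, npOp_eq, doubleLayer_eq]
  · rw [hK, snd_blockOp]
    filter_upwards [Lp.coeFn_add (nΩD.neg.kernelOp Φ.fst) (nΩΩ.kernelOp Φ.snd),
      nΩD.kernelOp_neg Φ.fst, nΩΩ.coeFn_kernelOp Φ.snd] with x h1 h2 h3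
    rw [h1, Pi.add_apply, h2, h3, npOp_eq, doubleLayer_eq]
  · rw [ContinuousLinearMap.isSelfAdjoint_iff', ContinuousLinearMap.adjoint_comp, ← hadj, hSadj,
      hcomm]
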